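/- Let $0<p<q<\infty$ and $\alpha>-1$, and let $\mu$ be a positive Borel measure on the open unit disc $\mathbb D$. Let $dA=\frac1\pi\,dx\,dy$, and let $D^p_\alpha$ be the space of analytic functions $f$ on $\mathbb D$ with $$\|f\|_{D^p_\alpha}=\Big(|f(0)|^p+\int_{\mathbb D}|f'(z)|^p(1-|z|^2)^\alpha\,dA(z)\Big)^{1/p}<\infty .$$ For an interval $I\subset\partial\mathbb D$ of normalized length $|I|\in(0,1]$ put $S(I)=\{re^{i\theta}: e^{i\theta}\in I,\ 1-|I|\le r<1\}$. The embedding $D^p_\alpha\subset L^q(\mu)$ is called compact if every $f\in D^p_\alpha$ belongs to $L^q(\mu)$ and every bounded sequence in $D^p_\alpha$ has a subsequence that converges in $L^q(\mu)$. In (1) and (2) assume that $\mu$ is finite on the compact subsets of $\mathbb D$. Then: (1) If $p<\alpha+2$, then $D^p_\alpha\subset L^q(\mu)$ is compact if and only if $\mu$ is a vanishing $\frac{q(\alpha+2-p)}{p}$-Carleson measure, that is, $\mu(S(I))=o\big(|I|^{q(\alpha+2-p)/p}\big)$ as $|I|\to0$. (2) If $p=\alpha+2$, then $D^p_\alpha\subset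 L^q(\mu)$ is compact if and only if $\mu(S(I))=o\Big(\big(\log\frac1{|I|}\big)^{(1/p-1)q}\Big)$ as $|I|\to0$. (3) If $p>\alpha+2$, then $D^p_\alpha\subset L^q(\mu)$ is compact if and only if $\mu$ is a finite measure. Here $\mu(S(I))=o(h(|I|))$ as $|I|\to0$ means that for every $\varepsilon>0$ there is $\delta>0$ such that $\mu(S(I))\le\varepsilon h(|I|)$ for all intervals $I\subset\partial\mathbb D$ with $0<|I|<\delta$. -/

import Mathlib

open MeasureTheory Filter Topology
open scoped ENNReal

noncomputable section

/-- The open unit disc of the complex plane, as a set. -/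
abbrev unitDiscSet : Set ℂ := Metric.ball (0 : ℂ) 1

/-- The open unit disc as a space, with its Borel sigma-algebra (as a subspace of `ℂ`). -/
abbrev DiscPt : Type := unitDiscSet

/-- The normalized area measure `dA = (1/π) dx dy` on `ℂ`. -/
def normalizedArea : Measure ℂ := ENNReal.ofReal (Real.pi)⁻¹ • (volume : Measure ℂ)

/-- The (quasi-)norm of the weighted Dirichlet space `D^p_α`, with values in `[0, ∞]`:
`(|f(0)|^p + ∫_𝔻 |f'(z)|^p (1 - |z|^2)^α dA(z))^(1/p)`. -/
def dirichletNorm (p α : ℝ) (f : ℂ → ℂ) : ℝ≥0∞ :=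
  (ENNReal.ofReal (‖f 0‖ ^ p) +
    ∫⁻ z in unitDiscSet, ENNReal.ofReal (‖deriv f z‖ ^ p * (1 - ‖z‖ ^ 2) ^ α)
      ∂normalizedArea) ^ (1 / p)

/-- The weighted Dirichlet space `D^p_α`. An analytic function on the disc is represented by a
function on `ℂ` that is holomorphic on the disc; its values off the disc play no role. -/
def dirichletSpace (p α : ℝ) : Set (ℂ → ℂ) :=
  {f | DifferentiableOn ℂ f unitDiscSet ∧ dirichletNorm p α f < ∞}

/-- The restriction of a function to the disc. -/
def onDisc (f : ℂ → ℂ) : DiscPt → ℂ := fun z => f (z : ℂ)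

/-- The embedding `D^p_α ⊂ L^q(μ)` is (well defined and) compact: every function of `D^p_α` is in
`L^q(μ)`, and every sequence that is bounded in `D^p_α` has a subsequence that converges
in `L^q(μ)`. -/
def IsCompactDirichletEmbedding (p α q : ℝ) (μ : Measure DiscPt) : Prop :=
  (∀ f ∈ dirichletSpace p α, MemLp (onDisc f) (ENNReal.ofReal q) μ) ∧
  ∀ F : ℕ → ℂ → ℂ, (∀ n, F n ∈ dirichletSpace p α) →
    (∃ M : ℝ, ∀ n, dirichletNorm p α (F n) ≤ ENNReal.ofReal M) →
    ∃ (φ : ℕ → ℕ) (g : DiscPt → ℂ), StrictMono φ ∧ MemLp g (ENNReal.ofReal q) μ ∧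
      Tendsto (fun n => eLpNorm (onDisc (F (φ n)) - g) (ENNReal.ofReal q) μ) atTop (𝓝 0)

/-- `J` is an interval of angles (open, closed or half-open), of positive length at most `2π`.
It describes the interval `I = {e^{iθ} : θ ∈ J}` of the unit circle, and every nondegenerate
interval of the circle, the whole circle included, is of this form. -/
def IsArc (J : Set ℝ) : Prop :=
  J.OrdConnected ∧ 0 < volume J ∧ volume J ≤ ENNReal.ofReal (2 * Real.pi)

/-- The normalized length `|I|` of the interval `I` of the circle given by `J`. -/
def arcLength (J : Set ℝ) : ℝ := (volume J).toReal / (2 * Real.pi)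

/-- The Carleson square `S(I) = {r e^{iθ} : e^{iθ} ∈ I, 1 - |I| ≤ r < 1}`. -/
def carlesonSquare (J : Set ℝ) : Set DiscPt :=
  {z | ∃ r θ : ℝ, θ ∈ J ∧ 1 - arcLength J ≤ r ∧ r < 1 ∧
    (z : ℂ) = (r : ℂ) * Complex.exp ((θ : ℂ) * Complex.I)}

/-- `μ(S(I)) = o(h(|I|))` as `|I| → 0`, uniformly over all intervals `I` of the circle. -/
def CarlesonLittleO (μ : Measure DiscPt) (h : ℝ → ℝ) : Prop :=
  ∀ ε : ℝ, 0 < ε → ∃ δ : ℝ, 0 < δ ∧ ∀ J : Set ℝ, IsArc J → arcLength J < δ →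
    μ (carlesonSquare J) ≤ ENNReal.ofReal (ε * h (arcLength J))

/-- `μ` is a vanishing `s`-Carleson measure: `μ(S(I)) = o(|I|^s)` as `|I| → 0`. -/
def IsVanishingCarleson (s : ℝ) (μ : Measure DiscPt) : Prop :=
  CarlesonLittleO μ (fun t => t ^ s)

end

/-! Compactness is equivalent to uniform smallness, over bounded sets of the space, of what happens
near the circle. This is `TailEstimate`: beyond the radius 1 - 2^{-K} a function differs little in
L^q(μ) from its value at the radial projection on that circle. Given this,
`isCompactDirichletEmbedding_of_tailEstimate` concludes by normal families and Fatou.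

The tail is discretized. Along a radius, the oscillation of f is at most the sum of the numbers
2^{-k} sup |f'| over the dyadic polar boxes met (`norm_sub_radial_le`). The ℓ^p sum of these numbers
with weights 2^{-k(α+2-p)} is at most a constant times the Dirichlet integral
(`exists_tsum_boxCoeff_le`), because |f'|^p is dominated by its local means and slightly enlarged
boxes overlap boundedly. What remains is an embedding of weighted ℓ^p on a dyadic tree into L^q(μ),
and for p < q it follows from a bound on the measure of single boxes (`lintegral_boxSum_rpow_le`). A
weak type estimate is obtained by duality and summation over generations. It becomes strong by
Maz'ya truncation: a dyadic layer of an ancestor sum is again an ancestor sum, and the energies of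
the layers add up to at most the original energy.

The box condition involves the partial sums of the dual weights. They grow geometrically if p < α+2,
which gives the power condition, and linearly if p = α+2, which gives the logarithm. If p > α+2 the
coefficients decay geometrically, the oscillation is uniformly small and a finite mass is enough.

For necessity, normalized negative powers (p < α+2) or logarithms (p = α+2) of 1 - (1-t)vz have
bounded norm, tend to zero pointwise as t → 0 and are large on a Carleson square of size t.
Chebyshev's inequality then gives the little-o condition. If p > α+2 the constant function 1
suffices. -/

/-! ### Weak type estimates for superpositions of boxes. -/

/-- Summation by comparison with `∫ min(x, ε h^{-τ})^s dh`. -/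
theorem tsum_mul_min_rpow_le {G : ℕ → ℝ} (hG : ∀ k, 0 < G k) {s τ x ε : ℝ} (hs : 0 < s)
    (hτ : 0 < τ) (hsτ : 1 < s * τ) (hx : 0 < x) (hε : 0 < ε) :
    ∑' k, ENNReal.ofReal (G k *
        (min x (ε * (∑ i ∈ Finset.range (k + 1), G i) ^ (-τ))) ^ s) ≤
      ENNReal.ofReal ((1 + 1 / (s * τ - 1)) * (ε ^ (1 / τ) * x ^ (s - 1 / τ))) := by
  set H : ℕ → ℝ := fun k => ∑ i ∈ Finset.range k, G i with hH
  have H0 : ∀ k, 0 ≤ H k := fun k => Finset.sum_nonneg fun i _ => (hG i).le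
  have Hsucc : ∀ k, H (k + 1) = H k + G k := fun k => Finset.sum_range_succ _ _
  have Hmono : Monotone H := monotone_nat_of_le_succ fun k => by
    rw [Hsucc]; linarith [hG k]
  set φ : ℝ → ℝ := fun h => (min x (ε * h ^ (-τ))) ^ s with hφ
  have hφanti : ∀ a b, 0 < a → a ≤ b → φ b ≤ φ a := by
    intro a b ha hab
    have hb := ha.trans_le hab
    refine Real.rpow_le_rpow (le_min hx.le (by positivity)) ?_ hs.le
    refine min_le_min le_rfl (mul_le_mul_of_nonneg_left ?_ hε.le)
    exact Real.rpow_le_rpow_of_nonpos ha hab (by linarith)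
  -- `G k` is the length of the k-th interval, and the decreasing `φ` has its minimum there at the
  -- right end.
  have step : ∀ k, ENNReal.ofReal (G k * φ (H (k + 1))) ≤
      ∫⁻ h in Set.Ioc (H k) (H (k + 1)), ENNReal.ofReal (φ h) := by
    intro k
    calc ENNReal.ofReal (G k * φ (H (k + 1)))
        = ∫⁻ _ in Set.Ioc (H k) (H (k + 1)), ENNReal.ofReal (φ (H (k + 1))) := by
          rw [setLIntegral_const, Real.volume_Ioc, Hsucc, add_sub_cancel_left,
            ENNReal.ofReal_mul (hG k).le, mul_comm]
      _ ≤ _ := by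
          refine setLIntegral_mono_ae' measurableSet_Ioc (Eventually.of_forall fun h hh => ?_)
          exact ENNReal.ofReal_le_ofReal (hφanti _ _ ((H0 k).trans_lt hh.1) hh.2)
  have hdisj : Pairwise (Function.onFun Disjoint fun k => Set.Ioc (H k) (H (k + 1))) :=
    Hmono.pairwise_disjoint_on_Ioc_succ
  -- `h₀` is the point where the two entries of the minimum agree. Below it `x` is used, above it
  -- the power, which is integrable at infinity because sτ > 1. Both pieces are multiples of ε^{1/τ}
  -- x^{s-1/τ}.
  set h₀ : ℝ := (ε / x) ^ (1 / τ) with hh₀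
  have h₀pos : 0 < h₀ := by positivity
  have hint : ∫⁻ h in Set.Ioi h₀, ENNReal.ofReal (ε ^ s * h ^ (-(s * τ))) =
      ENNReal.ofReal (ε ^ s * (h₀ ^ (1 - s * τ) / (s * τ - 1))) := by
    rw [← ofReal_integral_eq_lintegral_ofReal]
    · rw [integral_const_mul, integral_Ioi_rpow_of_lt (by linarith) h₀pos]
      congr 2
      rw [show -(s * τ) + 1 = -(s * τ - 1) by ring, neg_div_neg_eq]
      congr 2; ring
    · exact (integrableOn_Ioi_rpow_of_lt (by linarith) h₀pos).const_mul _
    · filter_upwards [ae_restrict_mem measurableSet_Ioi] with h hh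
      have : 0 < h := h₀pos.trans hh
      positivity
  calc _ = ∑' k, ENNReal.ofReal (G k * φ (H (k + 1))) := rfl
    _ ≤ ∑' k, ∫⁻ h in Set.Ioc (H k) (H (k + 1)), ENNReal.ofReal (φ h) :=
        ENNReal.tsum_le_tsum step
    _ = ∫⁻ h in ⋃ k, Set.Ioc (H k) (H (k + 1)), ENNReal.ofReal (φ h) :=
        (lintegral_iUnion (fun _ => measurableSet_Ioc) hdisj _).symm
    _ ≤ ∫⁻ h in Set.Ioc 0 h₀ ∪ Set.Ioi h₀, ENNReal.ofReal (φ h) := by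
        refine lintegral_mono_set ?_
        rw [Set.Ioc_union_Ioi_eq_Ioi h₀pos.le]
        exact Set.iUnion_subset fun k h hh => (H0 k).trans_lt hh.1
    _ ≤ (∫⁻ h in Set.Ioc 0 h₀, ENNReal.ofReal (φ h)) +
        ∫⁻ h in Set.Ioi h₀, ENNReal.ofReal (φ h) := lintegral_union_le _ _ _
    _ ≤ (∫⁻ _ in Set.Ioc 0 h₀, ENNReal.ofReal (x ^ s)) +
        ∫⁻ h in Set.Ioi h₀, ENNReal.ofReal (ε ^ s * h ^ (-(s * τ))) := by
        refine add_le_add ?_ ?_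
        · refine setLIntegral_mono_ae' measurableSet_Ioc (Eventually.of_forall fun h hh => ?_)
          have : 0 < h := hh.1
          exact ENNReal.ofReal_le_ofReal (Real.rpow_le_rpow (le_min hx.le (by positivity))
            (min_le_left _ _) hs.le)
        · refine setLIntegral_mono_ae' measurableSet_Ioi (Eventually.of_forall fun h hh => ?_)
          have : 0 < h := h₀pos.trans hh
          refine ENNReal.ofReal_le_ofReal ((Real.rpow_le_rpow (le_min hx.le (by positivity))
            (min_le_right _ _) hs.le).trans_eq ?_)
          rw [Real.mul_rpow hε.le (by positivity), ← Real.rpow_mul this.le]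
          congr 2; ring
    _ = _ := by
        rw [hint, setLIntegral_const, Real.volume_Ioc, sub_zero, ← ENNReal.ofReal_mul (by positivity),
          ← ENNReal.ofReal_add (by positivity)
            (mul_nonneg (by positivity) (div_nonneg (by positivity) (by linarith)))]
        congr 1
        have e1 : x ^ s * h₀ = ε ^ (1 / τ) * x ^ (s - 1 / τ) := by
          rw [hh₀, Real.div_rpow hε.le hx.le, Real.rpow_sub hx]; ring
        have e2 : ε ^ s * h₀ ^ (1 - s * τ) = ε ^ (1 / τ) * x ^ (s - 1 / τ) := by
          rw [hh₀, ← Real.rpow_mul (by positivity), Real.div_rpow hε.le hx.le, mul_div_assoc',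
            ← Real.rpow_add hε, show s + 1 / τ * (1 - s * τ) = 1 / τ by field_simp; ring,
            show 1 / τ * (1 - s * τ) = -(s - 1 / τ) by field_simp; ring, Real.rpow_neg hx.le,
            div_inv_eq_mul]
        rw [e1, mul_div_assoc', e2]; ring

theorem ENNReal.tsum_mul_le_Lp_mul_Lq {ι : Type*} [Countable ι] {p q : ℝ}
    (hpq : p.HolderConjugate q) (f g : ι → ℝ≥0∞) :
    ∑' i, f i * g i ≤ (∑' i, f i ^ p) ^ (1 / p) * (∑' i, g i ^ q) ^ (1 / q) := by
  let _ : MeasurableSpace ι := ⊤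
  have := ENNReal.lintegral_mul_le_Lp_mul_Lq (Measure.count : Measure ι) hpq (f := f) (g := g)
    (measurable_from_top).aemeasurable (measurable_from_top).aemeasurable
  simpa [lintegral_count] using this

section BoxSums

variable {X : Type*} [MeasurableSpace X]

/-- The superposition `∑ a(k,j) 1_{T(k,j)}` of boxes, arranged in generations. -/
noncomputable def boxSum (T : ℕ → ℕ → Set X) (a : ℕ → ℕ → ℝ≥0∞) (z : X) : ℝ≥0∞ :=
  ∑' i : ℕ × ℕ, (T i.1 i.2).indicator (fun _ => a i.1 i.2) z

theorem measurable_boxSum {T : ℕ → ℕ → Set X} (hT : ∀ k j, MeasurableSet (T k j))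
    (a : ℕ → ℕ → ℝ≥0∞) : Measurable (boxSum T a) :=
  Measurable.tsum fun i => measurable_const.indicator (hT i.1 i.2)

/-- The weighted `ℓ^p` energy of a family of coefficients. -/
noncomputable def boxEnergy (p : ℝ) (G : ℕ → ℝ) (a : ℕ → ℕ → ℝ≥0∞) : ℝ≥0∞ :=
  ∑' i : ℕ × ℕ, a i.1 i.2 ^ p * ENNReal.ofReal (G i.1 ^ (-(p - 1)))

variable {μ : Measure X} {T : ℕ → ℕ → Set X} {a : ℕ → ℕ → ℝ≥0∞} {G : ℕ → ℝ} {p q ε : ℝ} {K : ℕ}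

/-- The dual side of Hölder's inequality. Boxes of one generation are disjoint, so one factor μ(E ∩
T) sums to at most μ(E). The remaining power p' - 1 is bounded by the smaller of μ(E) and the box
bound. The sum over generations is then `tsum_mul_min_rpow_le` with s = p' - 1 and τ = q/p'. Its
requirement sτ = q/p > 1 is where p < q enters. -/
theorem tsum_measure_box_rpow_le (hT : ∀ k j, MeasurableSet (T k j))
    (hdisj : ∀ k, Pairwise (Function.onFun Disjoint (T k)))
    {p' : ℝ} (hp : p.HolderConjugate p') (hpq : p < q) (hG : ∀ k, 0 < G k) (hε : 0 < ε)
    (hμ : ∀ k, K ≤ k → ∀ j, μ (T k j) ≤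
      ENNReal.ofReal (ε * (∑ i ∈ Finset.range (k + 1), G i) ^ (-(q / p'))))
    {E : Set X} (hE : MeasurableSet E) (hEfin : μ E ≠ ∞) (hE0 : μ E ≠ 0) :
    ∑' i : ℕ × ℕ, (if K ≤ i.1 then μ (E ∩ T i.1 i.2) ^ p' * ENNReal.ofReal (G i.1) else 0) ≤
      ENNReal.ofReal ((q / (q - p)) * ε ^ (p' / q)) * μ E ^ (p' - p' / q) := by
  have hp0 := hp.pos
  have hp'0 := hp.symm.pos
  have hp'1 := hp.symm.lt
  have hq0 : 0 < q := hp0.trans hpq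
  set x := (μ E).toReal with hx
  have hxE : μ E = ENNReal.ofReal x := (ENNReal.ofReal_toReal hEfin).symm
  have hx0 : 0 < x := ENNReal.toReal_pos hE0 hEfin
  have key := tsum_mul_min_rpow_le hG (s := p' - 1) (τ := q / p') (x := x) (ε := ε)
    (by linarith) (by positivity) (by
      have : (p' - 1) * (q / p') = q / p := by
        have h1 := hp.sub_one_mul_conj
        have h2 := hp.mul_eq_add
        field_simp; linarith
      rw [this, one_lt_div hp0]; exact hpq) hx0 hε
  have hexp : (p' - 1) * (q / p') = q / p := by
    have h2 := hp.mul_eq_add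
    field_simp; linarith
  rw [ENNReal.tsum_prod']
  calc _ ≤ ∑' k, μ E * ENNReal.ofReal (G k *
        (min x (ε * (∑ i ∈ Finset.range (k + 1), G i) ^ (-(q / p')))) ^ (p' - 1)) := by
        refine ENNReal.tsum_le_tsum fun k => ?_
        by_cases hk : K ≤ k
        swap
        · simp [hk]
        simp only [hk, if_true]
        have hS : 0 < ∑ i ∈ Finset.range (k + 1), G i :=
          Finset.sum_pos (fun i _ => hG i) (by simp)
        set m := min x (ε * (∑ i ∈ Finset.range (k + 1), G i) ^ (-(q / p'))) with hm
        have hm0 : 0 < m := lt_min hx0 (by positivity)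
        have hmeas : ∀ j, μ (E ∩ T k j) ≤ ENNReal.ofReal m := by
          intro j
          rw [hm, ENNReal.ofReal_min]
          exact le_min (by rw [← hxE]; exact measure_mono Set.inter_subset_left)
            ((measure_mono Set.inter_subset_right).trans (hμ k hk j))
        have hsum : ∑' j, μ (E ∩ T k j) ≤ μ E := by
          rw [← measure_iUnion]
          · exact measure_mono (Set.iUnion_subset fun j => Set.inter_subset_left)
          · intro i j hij
            exact (hdisj k hij).mono Set.inter_subset_right Set.inter_subset_right
          · exact fun j => hE.inter (hT k j)
        calc ∑' j, μ (E ∩ T k j) ^ p' * ENNReal.ofReal (G k)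
            ≤ ∑' j, μ (E ∩ T k j) * ENNReal.ofReal (G k * m ^ (p' - 1)) := by
              refine ENNReal.tsum_le_tsum fun j => ?_
              rw [mul_comm (G k), ENNReal.ofReal_mul (by positivity), ← mul_assoc,
                ← ENNReal.ofReal_rpow_of_pos hm0]
              gcongr
              calc μ (E ∩ T k j) ^ p' = μ (E ∩ T k j) ^ (1 + (p' - 1)) := by congr 1; ring
                _ = μ (E ∩ T k j) * μ (E ∩ T k j) ^ (p' - 1) := by
                  rw [ENNReal.rpow_add_of_nonneg _ _ zero_le_one (by linarith), ENNReal.rpow_one]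
                _ ≤ _ := by
                  exact mul_le_mul_right (ENNReal.rpow_le_rpow (hmeas j) (by linarith)) _
          _ = (∑' j, μ (E ∩ T k j)) * ENNReal.ofReal (G k * m ^ (p' - 1)) := ENNReal.tsum_mul_right
          _ ≤ _ := by gcongr
    _ ≤ μ E * ENNReal.ofReal ((1 + 1 / ((p' - 1) * (q / p') - 1)) *
          (ε ^ (1 / (q / p')) * x ^ (p' - 1 - 1 / (q / p')))) := by
        rw [ENNReal.tsum_mul_left]
        gcongr
    _ = _ := by
        rw [hexp, hxE, ENNReal.ofReal_rpow_of_pos hx0, ← ENNReal.ofReal_mul hx0.le,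
          ← ENNReal.ofReal_mul (by have : 0 < q - p := by linarith
                                   positivity)]
        congr 1
        have h1 : 1 + 1 / (q / p - 1) = q / (q - p) := by
          have : q - p ≠ 0 := by linarith
          have h3 : q / p - 1 = (q - p) / p := by field_simp
          rw [h3]; field_simp; ring
        have h2 : p' - p' / q = 1 + (p' - 1 - 1 / (q / p')) := by
          rw [one_div_div]; ring
        rw [h1, h2, Real.rpow_add hx0, Real.rpow_one, one_div_div]; ring

/-- Restricted weak type estimate for superpositions of boxes. -/
theorem setLIntegral_boxSum_le (hT : ∀ k j, MeasurableSet (T k j))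
    (hdisj : ∀ k, Pairwise (Function.onFun Disjoint (T k)))
    (hp : 1 < p) (hpq : p < q) (hG : ∀ k, 0 < G k) (hε : 0 < ε)
    (hμ : ∀ k, K ≤ k → ∀ j, μ (T k j) ≤
      ENNReal.ofReal (ε * (∑ i ∈ Finset.range (k + 1), G i) ^ (-(q * (1 - 1 / p)))))
    (ha : ∀ k, k < K → ∀ j, a k j = 0)
    {E : Set X} (hE : MeasurableSet E) (hEfin : μ E ≠ ∞) (hE0 : μ E ≠ 0) :
    ∫⁻ z in E, boxSum T a z ∂μ ≤ boxEnergy p G a ^ (1 / p) *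
      (ENNReal.ofReal ((q / (q - p)) ^ (1 - 1 / p) * ε ^ (1 / q)) * μ E ^ (1 - 1 / q)) := by
  set p' := p.conjExponent with hp'
  have hc : p.HolderConjugate p' := Real.HolderConjugate.conjExponent hp
  have hp0 := hc.pos
  have hp'0 := hc.symm.pos
  have hq0 : 0 < q := hp0.trans hpq
  have hinv : 1 - 1 / p = 1 / p' := by
    have := hc.inv_add_inv_eq_one
    rw [one_div, one_div]; linarith
  have hμ' : ∀ k, K ≤ k → ∀ j, μ (T k j) ≤
      ENNReal.ofReal (ε * (∑ i ∈ Finset.range (k + 1), G i) ^ (-(q / p'))) := by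
    intro k hk j
    have := hμ k hk j
    rwa [hinv, mul_one_div] at this
  have h2 := tsum_measure_box_rpow_le hT hdisj hc hpq hG hε hμ' hE hEfin hE0
  calc ∫⁻ z in E, boxSum T a z ∂μ = ∑' i : ℕ × ℕ, a i.1 i.2 * μ (E ∩ T i.1 i.2) := by
        unfold boxSum
        rw [lintegral_tsum (f := fun (i : ℕ × ℕ) z => (T i.1 i.2).indicator (fun _ => a i.1 i.2) z)
          fun i => (measurable_const.indicator (hT i.1 i.2)).aemeasurable]
        congr 1 with i
        rw [lintegral_indicator_const (hT _ _), Measure.restrict_apply (hT _ _), Set.inter_comm]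
    -- Inserting G^{-1/p'} G^{1/p'} makes the ℓ^p norm of the first factor equal to the p-th root of
    -- the energy, since p/p' = p - 1.
    _ = ∑' i : ℕ × ℕ, (a i.1 i.2 * ENNReal.ofReal (G i.1 ^ (-(1 / p')))) *
          (if K ≤ i.1 then μ (E ∩ T i.1 i.2) * ENNReal.ofReal (G i.1 ^ (1 / p')) else 0) := by
        congr 1 with i
        by_cases hk : K ≤ i.1
        · simp only [hk, if_true]
          rw [mul_mul_mul_comm, ← ENNReal.ofReal_mul (Real.rpow_nonneg (hG _).le _),
            ← Real.rpow_add (hG _)]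
          simp
        · simp [ha _ (not_le.mp hk)]
    _ ≤ _ := ENNReal.tsum_mul_le_Lp_mul_Lq hc _ _
    _ ≤ _ := by
        gcongr
        · rw [boxEnergy]
          refine le_of_eq ?_
          congr 1 with i
          rw [ENNReal.mul_rpow_of_nonneg _ _ hp0.le, ENNReal.ofReal_rpow_of_nonneg
            (Real.rpow_nonneg (hG _).le _) hp0.le, ← Real.rpow_mul (hG _).le]
          congr 3
          rw [← hinv]; field_simp
        · rw [hinv]
          calc _ ≤ (ENNReal.ofReal ((q / (q - p)) * ε ^ (p' / q)) * μ E ^ (p' - p' / q)) ^ (1 / p') := by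
                gcongr
                refine le_trans (le_of_eq ?_) h2
                congr 1 with i
                split_ifs
                · rw [ENNReal.mul_rpow_of_nonneg _ _ hp'0.le, ENNReal.ofReal_rpow_of_nonneg
                    (Real.rpow_nonneg (hG _).le _) hp'0.le, ← Real.rpow_mul (hG _).le]
                  congr 2
                  rw [one_div_mul_cancel hp'0.ne', Real.rpow_one]
                · exact ENNReal.zero_rpow_of_pos hp'0
            _ = _ := by
                have h3 : 0 < q - p := by linarith
                rw [ENNReal.mul_rpow_of_nonneg _ _ (by positivity), ← ENNReal.rpow_mul,
                  ENNReal.ofReal_rpow_of_pos (by positivity), Real.mul_rpow (by positivity)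
                  (by positivity), ← Real.rpow_mul hε.le]
                congr 3
                · field_simp
                · field_simp

/-- Weak type estimate for superpositions of boxes. -/
theorem measure_le_boxSum_le [IsFiniteMeasure μ] (hT : ∀ k j, MeasurableSet (T k j))
    (hdisj : ∀ k, Pairwise (Function.onFun Disjoint (T k)))
    (hp : 1 < p) (hpq : p < q) (hG : ∀ k, 0 < G k) (hε : 0 < ε)
    (hμ : ∀ k, K ≤ k → ∀ j, μ (T k j) ≤
      ENNReal.ofReal (ε * (∑ i ∈ Finset.range (k + 1), G i) ^ (-(q * (1 - 1 / p)))))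
    (ha : ∀ k, k < K → ∀ j, a k j = 0) (t : ℝ≥0∞) :
    t ^ q * μ {z | t ≤ boxSum T a z} ≤
      ENNReal.ofReal ((q / (q - p)) ^ (q * (1 - 1 / p)) * ε) * boxEnergy p G a ^ (q / p) := by
  have hp0 : 0 < p := by linarith
  have hq0 : 0 < q := hp0.trans hpq
  set E := {z | t ≤ boxSum T a z} with hEdef
  have hE : MeasurableSet E := measurableSet_le measurable_const (measurable_boxSum hT a)
  by_cases hE0 : μ E = 0
  · simp [hE0]
  have hEfin : μ E ≠ ∞ := measure_ne_top μ E
  -- The restricted estimate is used on the superlevel set itself. A power of its measure, positive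
  -- and finite, is then cancelled.
  have h1 := setLIntegral_boxSum_le hT hdisj hp hpq hG hε hμ ha hE hEfin hE0
  have h2 : t * μ E ≤ ∫⁻ z in E, boxSum T a z ∂μ := by
    rw [← setLIntegral_const]
    exact setLIntegral_mono (measurable_boxSum hT a) fun z hz => hz
  have h3 : t * μ E ^ (1 / q) ≤ boxEnergy p G a ^ (1 / p) *
      ENNReal.ofReal ((q / (q - p)) ^ (1 - 1 / p) * ε ^ (1 / q)) := by
    have hne : μ E ^ (1 - 1 / q) ≠ 0 := by
      simp [ENNReal.rpow_eq_zero_iff, hE0, hEfin]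
    have hnt : μ E ^ (1 - 1 / q) ≠ ∞ := by
      simp [ENNReal.rpow_eq_top_iff, hE0, hEfin]
    rw [← ENNReal.mul_le_mul_iff_left hne hnt, mul_assoc, ← ENNReal.rpow_add _ _ hE0 hEfin, mul_assoc]
    simpa using h2.trans h1
  have h4 := ENNReal.rpow_le_rpow h3 hq0.le
  have h5 : 0 < q - p := by linarith
  rw [ENNReal.mul_rpow_of_nonneg _ _ hq0.le, ENNReal.mul_rpow_of_nonneg _ _ hq0.le,
    ← ENNReal.rpow_mul, ← ENNReal.rpow_mul, one_div_mul_cancel hq0.ne', ENNReal.rpow_one,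
    ENNReal.ofReal_rpow_of_pos (by positivity), Real.mul_rpow (by positivity) (by positivity),
    ← Real.rpow_mul (by positivity), ← Real.rpow_mul hε.le, one_div_mul_cancel hq0.ne',
    Real.rpow_one, mul_comm (_ ^ _) (ENNReal.ofReal _)] at h4
  rwa [mul_comm q, one_div_mul_eq_div] at *

end BoxSums

/-! ### Dyadic truncation and the embedding theorem on the tree. -/

theorem ENNReal.tsum_rpow_le_rpow_tsum {ι : Type*} {s : ℝ} (hs : 1 ≤ s) (f : ι → ℝ≥0∞) :
    ∑' i, f i ^ s ≤ (∑' i, f i) ^ s := by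
  have key : ∀ x : ℝ≥0∞, x ^ s = x * x ^ (s - 1) := fun x => by
    conv_lhs => rw [show s = 1 + (s - 1) by ring]
    rw [ENNReal.rpow_add_of_nonneg _ _ zero_le_one (by linarith), ENNReal.rpow_one]
  calc ∑' i, f i ^ s ≤ ∑' i, f i * (∑' i, f i) ^ (s - 1) := by
        refine ENNReal.tsum_le_tsum fun i => ?_
        rw [key]
        exact mul_le_mul_right (ENNReal.rpow_le_rpow (ENNReal.le_tsum i) (by linarith)) _
    _ = _ := by rw [ENNReal.tsum_mul_right, ← key]

/-- The part of `x` between the heights `2^i` and `2^(i+1)`. -/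
noncomputable def dyadicLayer (i : ℤ) (x : ℝ≥0∞) : ℝ≥0∞ :=
  min x ((2 : ℝ≥0∞) ^ (i + 1)) - min x ((2 : ℝ≥0∞) ^ i)

theorem two_zpow_ne_top (i : ℤ) : (2 : ℝ≥0∞) ^ i ≠ ∞ :=
  ENNReal.zpow_ne_top (by simp) (by simp) i

theorem two_zpow_succ (i : ℤ) : (2 : ℝ≥0∞) ^ (i + 1) = 2 ^ i + 2 ^ i := by
  rw [ENNReal.zpow_add (by simp) (by simp), zpow_one, mul_two]

theorem two_zpow_le_succ (i : ℤ) : (2 : ℝ≥0∞) ^ i ≤ 2 ^ (i + 1) := by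
  rw [two_zpow_succ]; exact le_self_add

theorem dyadicLayer_of_le {i : ℤ} {x : ℝ≥0∞} (h : x ≤ 2 ^ i) : dyadicLayer i x = 0 := by
  rw [dyadicLayer, min_eq_left h, min_eq_left (h.trans (two_zpow_le_succ i)), tsub_self]

theorem dyadicLayer_mono (i : ℤ) : Monotone (dyadicLayer i) := by
  intro x y hxy
  rcases le_total x (2 ^ i) with h | h
  · rw [dyadicLayer_of_le h]; exact zero_le
  · unfold dyadicLayer
    rw [min_eq_right h, min_eq_right (h.trans hxy)]
    exact tsub_le_tsub_right (min_le_min_right _ hxy) _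

theorem dyadicLayer_eq {i : ℤ} {x : ℝ≥0∞} (h : 2 ^ (i + 1) ≤ x) : dyadicLayer i x = 2 ^ i := by
  rw [dyadicLayer, min_eq_right h, min_eq_right ((two_zpow_le_succ i).trans h), two_zpow_succ,
    ENNReal.add_sub_cancel_right (two_zpow_ne_top i)]

/-- One telescoping step: truncation at 2^{i+1} is truncation at 2^i plus the layer `i`. The cases,
by the position of x and y relative to 2^i, are there for the truncated subtraction. -/
theorem min_sub_min_add_dyadicLayer_sub_le {x y : ℝ≥0∞} (hxy : x ≤ y) (i : ℤ) :
    (min y (2 ^ i) - min x (2 ^ i)) + (dyadicLayer i y - dyadicLayer i x) ≤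
      min y (2 ^ (i + 1)) - min x (2 ^ (i + 1)) := by
  rcases le_total y (2 ^ i) with h | h
  · rw [dyadicLayer_of_le h, min_eq_left h, min_eq_left (hxy.trans h),
      min_eq_left (h.trans (two_zpow_le_succ i)),
      min_eq_left ((hxy.trans h).trans (two_zpow_le_succ i))]
    simp
  rcases le_total x (2 ^ i) with h' | h'
  · rw [dyadicLayer_of_le h', dyadicLayer, min_eq_left h', min_eq_right h,
      min_eq_left (h'.trans (two_zpow_le_succ i)), tsub_zero, add_comm]
    exact (tsub_add_tsub_cancel (le_min h (two_zpow_le_succ i)) h').le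
  · rw [dyadicLayer, dyadicLayer, min_eq_right h, min_eq_right h', tsub_self, zero_add,
      tsub_tsub, add_tsub_cancel_of_le (le_min h' (two_zpow_le_succ i))]

theorem sum_range_dyadicLayer_sub_le {x y : ℝ≥0∞} (hxy : x ≤ y) (s : ℤ) (n : ℕ) :
    ∑ i ∈ Finset.range n, (dyadicLayer (s + i) y - dyadicLayer (s + i) x) ≤
      min y (2 ^ (s + n)) - min x (2 ^ (s + n)) := by
  induction n with
  | zero => simp
  | succ n ih =>
    rw [Finset.sum_range_succ]
    refine (add_le_add_left ih _).trans ?_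
    have := min_sub_min_add_dyadicLayer_sub_le hxy (s + n)
    push_cast
    rwa [← add_assoc]

/-- Every finite set of integers lies in a run s, ..., s+n-1, over which the increments telescope.
-/
theorem tsum_dyadicLayer_sub_le {x y : ℝ≥0∞} (hxy : x ≤ y) :
    ∑' i : ℤ, (dyadicLayer i y - dyadicLayer i x) ≤ y - x := by
  refine ENNReal.summable.tsum_le_of_sum_le fun F => ?_
  obtain ⟨M, hM⟩ := F.exists_le
  obtain ⟨s, hs⟩ : ∃ s, ∀ i ∈ F, s ≤ i := by
    obtain ⟨s, hs⟩ := (F.image Neg.neg).exists_le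
    refine ⟨-s, fun i hi => ?_⟩
    have := hs (-i) (Finset.mem_image_of_mem _ hi)
    omega
  set n := (M - s + 1).toNat
  have hsub : F ⊆ (Finset.range n).image fun k : ℕ => s + (k : ℤ) := by
    intro i hi
    have h1 := hM i hi
    have h2 := hs i hi
    refine Finset.mem_image.mpr ⟨(i - s).toNat, ?_, ?_⟩
    · rw [Finset.mem_range]; omega
    · omega
  refine (Finset.sum_le_sum_of_subset hsub).trans ?_
  rw [Finset.sum_image (by intro a _ b _ h; simpa using h)]
  refine (sum_range_dyadicLayer_sub_le hxy s n).trans ?_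
  rcases le_total x (2 ^ (s + n)) with h | h
  · rw [min_eq_left h]; exact tsub_le_tsub_right (min_le_left _ _) _
  · rw [min_eq_right h, min_eq_right (h.trans hxy), tsub_self]; exact zero_le

section TreeEmbedding

variable {X : Type*}

/-- The box of generation `k` and position `j` determined by a level function and position
functions. -/
def levelBox (N : X → ℕ) (idx : ℕ → X → ℕ) (k j : ℕ) : Set X := {z | k ≤ N z ∧ idx k z = j}

theorem boxSum_levelBox [MeasurableSpace X] (N : X → ℕ) (idx : ℕ → X → ℕ) (a : ℕ → ℕ → ℝ≥0∞)
    (z : X) :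
    boxSum (levelBox N idx) a z = ∑ k ∈ Finset.range (N z + 1), a k (idx k z) := by
  unfold boxSum
  rw [ENNReal.tsum_prod', tsum_eq_sum (s := Finset.range (N z + 1))]
  · refine Finset.sum_congr rfl fun k hk => ?_
    rw [tsum_eq_single (idx k z)]
    · have : k ≤ N z := by simpa [Nat.lt_succ_iff] using hk
      simp [levelBox, this]
    · intro j hj
      simp [levelBox, hj.symm]
  · intro k hk
    have : ¬ k ≤ N z := by simpa [Nat.lt_succ_iff] using hk
    simp [levelBox, this]

/-- The sum of the coefficients along the ancestors of a node of the dyadic tree. -/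
noncomputable def ancestorSum (a : ℕ → ℕ → ℝ≥0∞) : ℕ → ℕ → ℝ≥0∞
  | 0, j => a 0 j
  | k + 1, j => ancestorSum a k (j / 2) + a (k + 1) j

/-- Halving a position gives the parent, so the boxes around `z` up to generation `n` are the
ancestors of a single node, itself included. -/
theorem sum_range_eq_ancestorSum {idx : ℕ → X → ℕ} (hidx : ∀ k z, idx k z = idx (k + 1) z / 2)
    (a : ℕ → ℕ → ℝ≥0∞) (z : X) (n : ℕ) :
    ∑ k ∈ Finset.range (n + 1), a k (idx k z) = ancestorSum a n (idx n z) := by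
  induction n with
  | zero => simp [ancestorSum]
  | succ n ih => rw [Finset.sum_range_succ, ih, ancestorSum, hidx n z]

/-- The coefficients whose ancestor sums are the layers of the ancestor sums of `a`. -/
noncomputable def layerCoeff (a : ℕ → ℕ → ℝ≥0∞) (i : ℤ) : ℕ → ℕ → ℝ≥0∞
  | 0, j => dyadicLayer i (a 0 j)
  | k + 1, j =>
    dyadicLayer i (ancestorSum a (k + 1) j) - dyadicLayer i (ancestorSum a k (j / 2))

/-- The reason truncation is compatible with the tree. Ancestor sums increase along branches and
layers are monotone, so the truncated differences defining the coefficients telescope without loss.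
-/
theorem ancestorSum_layerCoeff (a : ℕ → ℕ → ℝ≥0∞) (i : ℤ) (k j : ℕ) :
    ancestorSum (layerCoeff a i) k j = dyadicLayer i (ancestorSum a k j) := by
  induction k generalizing j with
  | zero => rfl
  | succ k ih =>
    rw [ancestorSum, ih, layerCoeff]
    refine add_tsub_cancel_of_le (dyadicLayer_mono i ?_)
    rw [ancestorSum]; exact le_self_add

theorem tsum_layerCoeff_le (a : ℕ → ℕ → ℝ≥0∞) (k j : ℕ) :
    ∑' i, layerCoeff a i k j ≤ a k j := by
  cases k with
  | zero =>
    have := tsum_dyadicLayer_sub_le (zero_le (a := a 0 j))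
    simpa [dyadicLayer_of_le (zero_le : (0 : ℝ≥0∞) ≤ _), layerCoeff] using this
  | succ k =>
    have hle : ancestorSum a k (j / 2) ≤ ancestorSum a (k + 1) j := le_self_add
    refine (tsum_dyadicLayer_sub_le hle).trans ?_
    rw [ancestorSum, tsub_le_iff_left]

theorem ancestorSum_eq_zero {a : ℕ → ℕ → ℝ≥0∞} {K : ℕ} (ha : ∀ k, k < K → ∀ j, a k j = 0) (k : ℕ)
    (hk : k < K) (j : ℕ) : ancestorSum a k j = 0 := by
  induction k generalizing j with
  | zero => exact ha 0 hk j
  | succ k ih => rw [ancestorSum, ih (by omega), ha _ hk, add_zero]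

theorem layerCoeff_eq_zero {a : ℕ → ℕ → ℝ≥0∞} {K : ℕ} (ha : ∀ k, k < K → ∀ j, a k j = 0) (i : ℤ)
    (k : ℕ) (hk : k < K) (j : ℕ) : layerCoeff a i k j = 0 := by
  cases k with
  | zero => rw [layerCoeff, ha 0 hk, dyadicLayer_of_le zero_le]
  | succ k => rw [layerCoeff, ancestorSum_eq_zero ha _ hk, dyadicLayer_of_le zero_le, zero_tsub]

/-- At each node the layer coefficients add up to at most the original one, and x ↦ x^p is
superadditive for p ≥ 1. -/
theorem tsum_boxEnergy_layerCoeff_le (a : ℕ → ℕ → ℝ≥0∞) {p : ℝ}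
    (hp : 1 ≤ p) (G : ℕ → ℝ) : ∑' i, boxEnergy p G (layerCoeff a i) ≤ boxEnergy p G a := by
  unfold boxEnergy
  rw [ENNReal.tsum_comm]
  refine ENNReal.tsum_le_tsum fun n => ?_
  rw [ENNReal.tsum_mul_right]
  gcongr
  exact (ENNReal.tsum_rpow_le_rpow_tsum hp _).trans
    (ENNReal.rpow_le_rpow (tsum_layerCoeff_le a _ _) (by linarith))

theorem rpow_le_tsum_dyadic {q : ℝ} (hq : 0 < q) {x : ℝ≥0∞} (hx : x ≠ ∞) :
    x ^ q ≤ ∑' i : ℤ, Set.indicator {i : ℤ | (2 : ℝ≥0∞) ^ (i + 1) ≤ x}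
      (fun i => ((4 : ℝ≥0∞) * 2 ^ i) ^ q) i := by
  rcases eq_or_ne x 0 with rfl | hx0
  · simp [hq]
  obtain ⟨n, hn⟩ := ENNReal.exists_mem_Ico_zpow hx0 hx (y := 2) (by simp) (by simp)
  refine le_trans ?_ (ENNReal.le_tsum (n - 1))
  -- With 2^n ≤ x < 2^{n+1} the single term i = n - 1 is enough, because 4 · 2^{n-1} = 2^{n+1}.
  rw [Set.indicator_of_mem (by simpa using hn.1)]
  refine ENNReal.rpow_le_rpow (hn.2.le.trans (le_of_eq ?_)) hq.le
  have : n + 1 = (n - 1) + 1 + 1 := by ring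
  rw [this, two_zpow_succ, two_zpow_succ]
  ring

variable [MeasurableSpace X]

/-- Embedding theorem for the dyadic tree: a one-box condition suffices when `p < q`. -/
theorem lintegral_boxSum_rpow_le {μ : Measure X} [IsFiniteMeasure μ] {N : X → ℕ}
    {idx : ℕ → X → ℕ} (hN : Measurable N) (hidxm : ∀ k, Measurable (idx k))
    (hidx : ∀ k z, idx k z = idx (k + 1) z / 2) {a : ℕ → ℕ → ℝ≥0∞} {G : ℕ → ℝ} {p q ε : ℝ} {K : ℕ}
    (hp : 1 < p) (hpq : p < q) (hG : ∀ k, 0 < G k) (hε : 0 < ε)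
    (hμ : ∀ k, K ≤ k → ∀ j, μ (levelBox N idx k j) ≤
      ENNReal.ofReal (ε * (∑ i ∈ Finset.range (k + 1), G i) ^ (-(q * (1 - 1 / p)))))
    (ha : ∀ k, k < K → ∀ j, a k j = 0) :
    ∫⁻ z, boxSum (levelBox N idx) a z ^ q ∂μ ≤
      ENNReal.ofReal (4 ^ q * (q / (q - p)) ^ (q * (1 - 1 / p)) * ε) *
        boxEnergy p G a ^ (q / p) := by
  have hp0 : 0 < p := by linarith
  have hq0 : 0 < q := hp0.trans hpq
  have hqp : 0 < q - p := by linarith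
  have hC : 0 < (q / (q - p)) ^ (q * (1 - 1 / p)) * ε := by positivity
  set T := levelBox N idx with hTdef
  have hT : ∀ k j, MeasurableSet (T k j) := fun k j =>
    (measurableSet_le measurable_const hN).inter (hidxm k (measurableSet_singleton j))
  have hdisj : ∀ k, Pairwise (Function.onFun Disjoint (T k)) := by
    intro k i j hij
    refine Set.disjoint_left.mpr fun z hz hz' => hij (hz.2.symm.trans hz'.2)
  by_cases hE : boxEnergy p G a = ∞
  · rw [hE, ENNReal.top_rpow_of_pos (by positivity), ENNReal.mul_top]
    · exact le_top
    · rw [mul_assoc]; simp only [ne_eq, ENNReal.ofReal_eq_zero, not_le]; positivity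
  -- Finite energy forces finite coefficients and hence finite box sums, as the decomposition into
  -- dyadic heights requires.
  have hfin : ∀ k j, a k j ≠ ∞ := by
    intro k j h
    have := ENNReal.ne_top_of_tsum_ne_top hE (k, j)
    simp only [h, ENNReal.top_rpow_of_pos hp0] at this
    rw [ENNReal.top_mul] at this
    · exact this rfl
    · simp only [ne_eq, ENNReal.ofReal_eq_zero, not_le]; exact Real.rpow_pos_of_pos (hG _) _
  have hBfin : ∀ z, boxSum T a z ≠ ∞ := by
    intro z
    rw [boxSum_levelBox]
    exact ENNReal.sum_ne_top.mpr fun k _ => hfin _ _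
  have hlayer : ∀ i z, boxSum T (layerCoeff a i) z = dyadicLayer i (boxSum T a z) := by
    intro i z
    rw [boxSum_levelBox, boxSum_levelBox, sum_range_eq_ancestorSum hidx,
      sum_range_eq_ancestorSum hidx, ancestorSum_layerCoeff]
  have hset : ∀ i : ℤ, MeasurableSet {z | (2 : ℝ≥0∞) ^ (i + 1) ≤ boxSum T a z} := fun i =>
    measurableSet_le measurable_const (measurable_boxSum hT a)
  calc ∫⁻ z, boxSum T a z ^ q ∂μ
      ≤ ∫⁻ z, ∑' i : ℤ, Set.indicator {z | (2 : ℝ≥0∞) ^ (i + 1) ≤ boxSum T a z}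
          (fun _ => ((4 : ℝ≥0∞) * 2 ^ i) ^ q) z ∂μ :=
        lintegral_mono fun z => rpow_le_tsum_dyadic hq0 (hBfin z)
    _ = ∑' i : ℤ, ((4 : ℝ≥0∞) * 2 ^ i) ^ q * μ {z | (2 : ℝ≥0∞) ^ (i + 1) ≤ boxSum T a z} := by
        rw [lintegral_tsum fun i => (measurable_const.indicator (hset i)).aemeasurable]
        congr 1 with i
        rw [lintegral_indicator_const (hset i)]
    _ ≤ ∑' i : ℤ, 4 ^ q * (ENNReal.ofReal ((q / (q - p)) ^ (q * (1 - 1 / p)) * ε) *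
          boxEnergy p G (layerCoeff a i) ^ (q / p)) := by
        refine ENNReal.tsum_le_tsum fun i => ?_
        rw [ENNReal.mul_rpow_of_nonneg _ _ hq0.le, mul_assoc]
        refine mul_le_mul_right ?_ _
        -- Where the box sum is at least 2^{i+1}, its layer `i` is exactly 2^i. The weak type
        -- estimate is therefore applied to the layer coefficients at height 2^i.
        refine le_trans ?_ (measure_le_boxSum_le hT hdisj hp hpq hG hε hμ
          (layerCoeff_eq_zero ha i) (2 ^ i))
        refine mul_le_mul_right (measure_mono fun z hz => ?_) _
        rw [Set.mem_ofPred_eq, hlayer, dyadicLayer_eq hz]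
    _ = ENNReal.ofReal (4 ^ q * (q / (q - p)) ^ (q * (1 - 1 / p)) * ε) *
          ∑' i : ℤ, boxEnergy p G (layerCoeff a i) ^ (q / p) := by
        rw [ENNReal.tsum_mul_left, ENNReal.tsum_mul_left, ← mul_assoc, mul_assoc (4 ^ q : ℝ),
          ENNReal.ofReal_mul (p := (4 : ℝ) ^ q) (by positivity),
          ← ENNReal.ofReal_rpow_of_pos (by norm_num), ENNReal.ofReal_ofNat]
    _ ≤ _ := by
        gcongr
        -- Since q/p ≥ 1, the sum over the layers can be moved inside the power.
        refine (ENNReal.tsum_rpow_le_rpow_tsum ?_ _).trans ?_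
        · rw [one_le_div hp0]; exact hpq.le
        · exact ENNReal.rpow_le_rpow (tsum_boxEnergy_layerCoeff_le a hp.le G) (by positivity)

end TreeEmbedding

/-! ### Local means of |f'|^p. -/

/-- Local domination of `‖h w‖ ^ p` by the area mean of `‖h‖ ^ p`, for every `p > 0`. -/
theorem exists_rpow_norm_le_lintegral_ball {p : ℝ} (hp : 0 < p) :
    ∃ C : ℝ, 0 < C ∧ ∀ (h : ℂ → ℂ) (U : Set ℂ) (w : ℂ) (R : ℝ), 0 < R → IsOpen U →
      Metric.closedBall w R ⊆ U → DifferentiableOn ℂ h U →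
      ENNReal.ofReal (‖h w‖ ^ p * R ^ 2) ≤
        ENNReal.ofReal C * ∫⁻ z in Metric.ball w R, ENNReal.ofReal (‖h z‖ ^ p) := by
  set κ : ℝ := 4 ^ (1 / p) with hκ
  have hκ1 : 1 ≤ κ := Real.one_le_rpow (by norm_num) (by positivity)
  have hκ0 : 0 < κ := by linarith
  have hκp : κ ^ p = 4 := by rw [hκ, ← Real.rpow_mul (by norm_num), one_div_mul_cancel hp.ne', Real.rpow_one]
  refine ⟨2 ^ p * 64 * κ ^ 2 / Real.pi, by positivity, fun h U w R hR hU hball hh => ?_⟩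
  -- In place of subharmonicity of |h|^p, the weighted function `φ` is maximized. Around a maximum
  -- point `z₀` at distance d from the boundary of the ball, the weight stays above (d/2)², so |h|^p
  -- ≤ 4|h(z₀)|^p within distance d/2; hence κ^p = 4.
  set φ : ℂ → ℝ := fun z => ‖h z‖ ^ p * (R - ‖z - w‖) ^ 2 with hφ
  have hcont : ContinuousOn φ (Metric.closedBall w R) := by
    refine ContinuousOn.mul ?_ (by fun_prop)
    exact ((hh.continuousOn.mono hball).norm).rpow_const fun _ _ => Or.inr hp.le
  obtain ⟨z₀, hz₀, hmax⟩ := (isCompact_closedBall w R).exists_isMaxOn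
    ⟨w, Metric.mem_closedBall_self hR.le⟩ hcont
  have hw : ‖h w‖ ^ p * R ^ 2 ≤ φ z₀ := by
    have := hmax (Metric.mem_closedBall_self hR.le : w ∈ _)
    simpa [hφ] using this
  have hd0 : 0 ≤ R - ‖z₀ - w‖ := by rw [← dist_eq_norm]; linarith [Metric.mem_closedBall.mp hz₀]
  rcases (show 0 ≤ φ z₀ by positivity).eq_or_lt with h0 | hpos
  · rw [ENNReal.ofReal_of_nonpos (by linarith)]; exact zero_le
  set d := R - ‖z₀ - w‖ with hd
  set H := ‖h z₀‖ with hH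
  have hdpos : 0 < d := by
    refine hd0.lt_of_ne fun h0 => hpos.ne' ?_
    simp only [hφ, ← hd, ← h0]; simp
  have hHpos : 0 < H := by
    refine (norm_nonneg _).lt_of_ne fun h0 => hpos.ne' ?_
    simp only [hφ, ← hH]
    rw [show H = 0 from h0.symm, Real.zero_rpow hp.ne', zero_mul]
  have hin : ∀ z, ‖z - z₀‖ ≤ d / 2 → z ∈ Metric.closedBall w R ∧ d / 2 ≤ R - ‖z - w‖ := by
    intro z hz
    have : ‖z - w‖ ≤ ‖z - z₀‖ + ‖z₀ - w‖ := norm_sub_le_norm_sub_add_norm_sub _ _ _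
    refine ⟨?_, by linarith⟩
    rw [Metric.mem_closedBall, dist_eq_norm]; linarith
  have hbd : ∀ z, ‖z - z₀‖ ≤ d / 2 → ‖h z‖ ≤ κ * H := by
    intro z hz
    obtain ⟨h1, h2⟩ := hin z hz
    have h3 : ‖h z‖ ^ p * (R - ‖z - w‖) ^ 2 ≤ H ^ p * d ^ 2 := hmax h1
    have h4 : ‖h z‖ ^ p * (d / 2) ^ 2 ≤ H ^ p * d ^ 2 := by
      refine le_trans ?_ h3
      gcongr
    have h5 : ‖h z‖ ^ p ≤ (κ * H) ^ p := by
      rw [Real.mul_rpow hκ0.le hHpos.le, hκp]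
      have : 0 < d ^ 2 := by positivity
      nlinarith
    exact (Real.rpow_le_rpow_iff (norm_nonneg _) (by positivity) hp).mp h5
  have hdiffU : ∀ z, ‖z - z₀‖ ≤ d / 2 → DifferentiableAt ℂ h z := fun z hz =>
    hh.differentiableAt (hU.mem_nhds (hball (hin z hz).1))
  have hderiv : ∀ c ∈ Metric.ball z₀ (d / 4), ‖deriv h c‖ ≤ κ * H / (d / 4) := by
    intro c hc
    rw [Metric.mem_ball, dist_eq_norm] at hc
    have hle : ∀ z, ‖z - c‖ ≤ d / 4 → ‖z - z₀‖ ≤ d / 2 := by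
      intro z hz
      have : ‖z - z₀‖ ≤ ‖z - c‖ + ‖c - z₀‖ := norm_sub_le_norm_sub_add_norm_sub _ _ _
      linarith
    refine Complex.norm_deriv_le_of_forall_mem_sphere_norm_le (by positivity) ?_ ?_
    · refine DifferentiableOn.diffContOnCl fun z hz => ?_
      refine (hdiffU z (hle z ?_)).differentiableWithinAt
      have := Metric.closure_ball_subset_closedBall hz
      rwa [Metric.mem_closedBall, dist_eq_norm] at this
    · intro z hz
      rw [mem_sphere_iff_norm] at hz
      exact hbd z (hle z hz.le)
  -- This radius makes the Cauchy bound κH/(d/4) times r equal to H/2, so that |h| ≥ H/2 on the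
  -- small ball.
  set r := d / (8 * κ) with hr
  have hr4 : r ≤ d / 4 := by
    rw [hr, div_le_div_iff₀ (by positivity) (by norm_num)]; nlinarith
  have hrpos : 0 < r := by positivity
  have hlow : ∀ z ∈ Metric.ball z₀ r, H / 2 ≤ ‖h z‖ := by
    intro z hz
    have h1 : ‖h z - h z₀‖ ≤ κ * H / (d / 4) * ‖z - z₀‖ := by
      refine (convex_ball z₀ (d / 4)).norm_image_sub_le_of_norm_deriv_le (fun x hx => ?_) hderiv
        (Metric.mem_ball_self (by positivity)) (Metric.ball_subset_ball hr4 hz)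
      rw [Metric.mem_ball, dist_eq_norm] at hx
      exact hdiffU x (by linarith)
    rw [Metric.mem_ball, dist_eq_norm] at hz
    have h2 : κ * H / (d / 4) * ‖z - z₀‖ ≤ κ * H / (d / 4) * r := by gcongr
    have h3 : κ * H / (d / 4) * r = H / 2 := by rw [hr]; field_simp; norm_num
    have h4 : H - ‖h z‖ ≤ ‖h z - h z₀‖ := by
      rw [norm_sub_rev]; exact norm_sub_norm_le _ _
    linarith
  have hint : ENNReal.ofReal ((H / 2) ^ p * (r ^ 2 * Real.pi)) ≤
      ∫⁻ z in Metric.ball w R, ENNReal.ofReal (‖h z‖ ^ p) := by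
    calc _ = ∫⁻ _ in Metric.ball z₀ r, ENNReal.ofReal ((H / 2) ^ p) := by
          rw [setLIntegral_const, Complex.volume_ball, ENNReal.ofReal_mul (by positivity),
            ENNReal.ofReal_mul (by positivity), ENNReal.ofReal_pow hrpos.le]
          congr 2
          exact ENNReal.ofReal_coe_nnreal (p := NNReal.pi)
      _ ≤ ∫⁻ z in Metric.ball z₀ r, ENNReal.ofReal (‖h z‖ ^ p) := by
          refine setLIntegral_mono_ae' measurableSet_ball (Eventually.of_forall fun z hz => ?_)
          exact ENNReal.ofReal_le_ofReal (Real.rpow_le_rpow (by positivity) (hlow z hz) hp.le)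
      _ ≤ _ := by
          refine lintegral_mono_set (Metric.ball_subset_ball' ?_)
          rw [dist_eq_norm]; linarith
  calc ENNReal.ofReal (‖h w‖ ^ p * R ^ 2) ≤ ENNReal.ofReal (2 ^ p * 64 * κ ^ 2 / Real.pi *
        ((H / 2) ^ p * (r ^ 2 * Real.pi))) := by
        refine ENNReal.ofReal_le_ofReal (hw.trans (le_of_eq ?_))
        simp only [hφ, ← hd, ← hH]
        rw [hr, Real.div_rpow hHpos.le (by norm_num)]
        have : (0 : ℝ) < 2 ^ p := by positivity
        field_simp; norm_num
    _ ≤ _ := by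
        rw [ENNReal.ofReal_mul (by positivity)]
        gcongr

/-- Comparison of powers of a quantity between `3/8` and `9/4` times `t`. -/
theorem exists_mul_rpow_le (α : ℝ) : ∃ c : ℝ, 0 < c ∧ ∀ t x : ℝ, 0 < t → 3 / 8 * t ≤ x →
    x ≤ 9 / 4 * t → c * t ^ α ≤ x ^ α := by
  refine ⟨min ((3 / 8) ^ α) ((9 / 4) ^ α), by positivity, fun t x ht h1 h2 => ?_⟩
  have hx : 0 < x := by linarith
  rcases le_total 0 α with hα | hα
  · calc _ ≤ (3 / 8 : ℝ) ^ α * t ^ α := by gcongr; exact min_le_left _ _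
      _ = (3 / 8 * t) ^ α := by rw [Real.mul_rpow (by norm_num) ht.le]
      _ ≤ _ := Real.rpow_le_rpow (by positivity) h1 hα
  · calc _ ≤ (9 / 4 : ℝ) ^ α * t ^ α := by gcongr; exact min_le_right _ _
      _ = (9 / 4 * t) ^ α := by rw [Real.mul_rpow (by norm_num) ht.le]
      _ ≤ _ := Real.rpow_le_rpow_of_nonpos hx h2 hα

/-- The weighted energy density of the derivative. -/
noncomputable def dirichletDensity (p α : ℝ) (f : ℂ → ℂ) (z : ℂ) : ℝ≥0∞ :=
  ENNReal.ofReal (‖deriv f z‖ ^ p * (1 - ‖z‖ ^ 2) ^ α)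

/-- The Dirichlet integral `∫ |f'|^p (1 - |z|^2)^α dA`. -/
noncomputable def dirichletEnergy (p α : ℝ) (f : ℂ → ℂ) : ℝ≥0∞ :=
  ∫⁻ z in unitDiscSet, dirichletDensity p α f z ∂normalizedArea

theorem exists_rpow_norm_deriv_le {p : ℝ} (hp : 0 < p) (α : ℝ) :
    ∃ C : ℝ, 0 < C ∧ ∀ (f : ℂ → ℂ) (w : ℂ) (t : ℝ), DifferentiableOn ℂ f unitDiscSet → 0 < t →
      t / 2 ≤ 1 - ‖w‖ → 1 - ‖w‖ ≤ t →
      ENNReal.ofReal (‖deriv f w‖ ^ p * t ^ (α + 2)) ≤ ENNReal.ofReal C *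
        ∫⁻ z in Metric.ball w (t / 8), dirichletDensity p α f z ∂normalizedArea := by
  obtain ⟨C, hC, hC'⟩ := exists_rpow_norm_le_lintegral_ball hp
  obtain ⟨c, hc, hc'⟩ := exists_mul_rpow_le α
  refine ⟨64 * C * Real.pi / c, by positivity, fun f w t hf ht h1 h2 => ?_⟩
  have hsub : Metric.closedBall w (t / 8) ⊆ unitDiscSet := by
    intro z hz
    rw [Metric.mem_closedBall, dist_eq_norm] at hz
    rw [Metric.mem_ball, dist_zero_right]
    have : ‖z‖ ≤ ‖w‖ + ‖z - w‖ := norm_le_norm_add_norm_sub' _ _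
    linarith
  have key := hC' (deriv f) unitDiscSet w (t / 8) (by positivity) Metric.isOpen_ball hsub
    (hf.deriv Metric.isOpen_ball)
  have hmono : ∫⁻ z in Metric.ball w (t / 8), ENNReal.ofReal (‖deriv f z‖ ^ p) ≤
      ∫⁻ z in Metric.ball w (t / 8), ENNReal.ofReal (1 / (c * t ^ α)) * dirichletDensity p α f z := by
    refine setLIntegral_mono_ae' measurableSet_ball (Eventually.of_forall fun z hz => ?_)
    rw [Metric.mem_ball, dist_eq_norm] at hz
    have h3 : ‖z‖ ≤ ‖w‖ + ‖z - w‖ := norm_le_norm_add_norm_sub' _ _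
    have h4 : ‖w‖ ≤ ‖z‖ + ‖w - z‖ := norm_le_norm_add_norm_sub' _ _
    rw [norm_sub_rev] at h4
    have h5 : 0 ≤ ‖z‖ := norm_nonneg z
    -- Here 1 - |z| lies between 3t/8 and 9t/8, and 1 + |z| between 1 and 2, so the weight is at
    -- least a constant times t^α.
    have h6 := hc' t (1 - ‖z‖ ^ 2) ht (by nlinarith) (by nlinarith)
    rw [dirichletDensity, ← ENNReal.ofReal_mul (by positivity)]
    refine ENNReal.ofReal_le_ofReal ?_
    have h7 : 0 < c * t ^ α := by positivity
    rw [one_div_mul_eq_div, le_div_iff₀ h7]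
    gcongr
  rw [lintegral_const_mul' _ _ ENNReal.ofReal_ne_top] at hmono
  have hna : ∫⁻ z in Metric.ball w (t / 8), dirichletDensity p α f z =
      ENNReal.ofReal Real.pi *
        ∫⁻ z in Metric.ball w (t / 8), dirichletDensity p α f z ∂normalizedArea := by
    rw [normalizedArea, Measure.restrict_smul, lintegral_smul_measure, smul_eq_mul, ← mul_assoc,
      ← ENNReal.ofReal_mul (by positivity), mul_inv_cancel₀ Real.pi_ne_zero]
    simp
  calc ENNReal.ofReal (‖deriv f w‖ ^ p * t ^ (α + 2))
      = ENNReal.ofReal (64 * t ^ α) * ENNReal.ofReal (‖deriv f w‖ ^ p * (t / 8) ^ 2) := by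
        rw [← ENNReal.ofReal_mul (by positivity), Real.rpow_add ht]
        congr 1
        norm_cast
        ring
    _ ≤ ENNReal.ofReal (64 * t ^ α) * (ENNReal.ofReal C * (ENNReal.ofReal (1 / (c * t ^ α)) *
          (ENNReal.ofReal Real.pi *
            ∫⁻ z in Metric.ball w (t / 8), dirichletDensity p α f z ∂normalizedArea))) := by
        rw [← hna]
        refine mul_le_mul_right (key.trans (mul_le_mul_right hmono _)) _
    _ = _ := by
        rw [← mul_assoc, ← mul_assoc, ← mul_assoc, ← ENNReal.ofReal_mul (by positivity),
          ← ENNReal.ofReal_mul (by positivity), ← ENNReal.ofReal_mul (by positivity)]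
        congr 2
        have : 0 < t ^ α := by positivity
        field_simp

/-! ### Dyadic polar boxes and their separation. -/

/-- The position of the dyadic arc of generation `k` containing the argument of `z`. -/
noncomputable def arcIndex (k : ℕ) (z : ℂ) : ℕ :=
  ⌊(2 : ℝ) ^ k * ((Real.pi - z.arg) / (2 * Real.pi))⌋₊

/-- Since `Complex.arg` takes values in (-π, π], measuring downwards from π gives a fraction in [0,
1), closed on the side that the floor needs. -/
theorem argFraction_nonneg (z : ℂ) : 0 ≤ (Real.pi - z.arg) / (2 * Real.pi) := by
  have := Complex.arg_le_pi z
  have := Real.pi_pos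
  exact div_nonneg (by linarith) (by linarith)

theorem argFraction_lt_one (z : ℂ) : (Real.pi - z.arg) / (2 * Real.pi) < 1 := by
  have := Complex.neg_pi_lt_arg z
  have := Real.pi_pos
  rw [div_lt_one (by linarith)]; linarith

theorem arcIndex_eq_iff {k j : ℕ} {z : ℂ} : arcIndex k z = j ↔
    (j : ℝ) ≤ 2 ^ k * ((Real.pi - z.arg) / (2 * Real.pi)) ∧
      2 ^ k * ((Real.pi - z.arg) / (2 * Real.pi)) < j + 1 :=
  Nat.floor_eq_iff (mul_nonneg (by positivity) (argFraction_nonneg z))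

theorem arcIndex_lt (k : ℕ) (z : ℂ) : arcIndex k z < 2 ^ k := by
  have h1 := (arcIndex_eq_iff (k := k) (z := z)).mp rfl
  have h2 : (2 : ℝ) ^ k * ((Real.pi - z.arg) / (2 * Real.pi)) < 2 ^ k :=
    mul_lt_of_lt_one_right (by positivity) (argFraction_lt_one z)
  exact_mod_cast h1.1.trans_lt h2

theorem arcIndex_succ_div_two (k : ℕ) (z : ℂ) : arcIndex k z = arcIndex (k + 1) z / 2 := by
  have := Nat.floor_div_natCast ((2 : ℝ) ^ (k + 1) * ((Real.pi - z.arg) / (2 * Real.pi))) 2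
  rw [arcIndex, arcIndex, ← this]
  congr 1
  push_cast
  ring

theorem measurable_arcIndex (k : ℕ) : Measurable (arcIndex k) :=
  Nat.measurable_floor.comp
    (measurable_const.mul ((measurable_const.sub Complex.measurable_arg).div_const _))

theorem arcIndex_real_mul (k : ℕ) {r : ℝ} (hr : 0 < r) (u : ℂ) :
    arcIndex k (r * u) = arcIndex k u := by
  rw [arcIndex, arcIndex, Complex.arg_real_mul _ hr]

/-- The polar box of generation `k` and position `j`. -/
def polarBox (k j : ℕ) : Set ℂ :=
  {w | (1 / 2 : ℝ) ^ k / 2 ≤ 1 - ‖w‖ ∧ 1 - ‖w‖ ≤ (1 / 2 : ℝ) ^ k ∧ arcIndex k w = j}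

/-- Points of modulus at least `1/2` are separated by the distance of their arguments. -/
theorem le_norm_sub_of_arg {w w' : ℂ} (hw : 1 / 2 ≤ ‖w‖) (hw' : 1 / 2 ≤ ‖w'‖) {δ : ℝ} (hδ : 0 ≤ δ)
    (h1 : δ ≤ |w.arg - w'.arg|) (h2 : |w.arg - w'.arg| ≤ 2 * Real.pi - δ) :
    δ / Real.pi ≤ ‖w - w'‖ := by
  have hπ := Real.pi_pos
  set θ := |w.arg - w'.arg| with hθ
  have hcos : Real.cos (w.arg - w'.arg) ≤ 1 - 2 / Real.pi ^ 2 * δ ^ 2 := by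
    rw [← Real.cos_abs, ← hθ]
    have hδπ : δ ≤ Real.pi := by linarith
    refine le_trans ?_ (Real.cos_le_one_sub_mul_cos_sq (abs_le.mpr ⟨by linarith, hδπ⟩))
    rcases le_total θ Real.pi with h | h
    · exact Real.cos_le_cos_of_nonneg_of_le_pi hδ h h1
    · rw [← Real.cos_two_pi_sub]
      exact Real.cos_le_cos_of_nonneg_of_le_pi hδ (by linarith) (by linarith)
  -- Law of cosines. As |w||w'| ≥ 1/4 and 1 - cos ≥ 2δ²/π², the second term is at least (δ/π)².
  have hsq : ‖w - w'‖ ^ 2 = (‖w‖ - ‖w'‖) ^ 2 +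
      2 * (‖w‖ * ‖w'‖) * (1 - Real.cos (w.arg - w'.arg)) := by
    rw [← Complex.normSq_eq_norm_sq, Complex.normSq_apply, Complex.sub_re, Complex.sub_im,
      ← Complex.norm_mul_cos_arg w, ← Complex.norm_mul_sin_arg w, ← Complex.norm_mul_cos_arg w',
      ← Complex.norm_mul_sin_arg w', Real.cos_sub]
    linear_combination (‖w‖ ^ 2) * (Real.sin_sq_add_cos_sq w.arg) +
      (‖w'‖ ^ 2) * (Real.sin_sq_add_cos_sq w'.arg)
  have hprod : 1 / 4 ≤ ‖w‖ * ‖w'‖ := by nlinarith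
  have h3 : 2 / Real.pi ^ 2 * δ ^ 2 ≤ 1 - Real.cos (w.arg - w'.arg) := by linarith
  have h4 : (δ / Real.pi) ^ 2 ≤ ‖w - w'‖ ^ 2 := by
    have h5 : (δ / Real.pi) ^ 2 = 2 * (1 / 4) * (2 / Real.pi ^ 2 * δ ^ 2) := by
      field_simp; norm_num
    have h6 : 0 ≤ 2 / Real.pi ^ 2 * δ ^ 2 := by positivity
    rw [hsq, h5]
    have : 2 * (1 / 4) * (2 / Real.pi ^ 2 * δ ^ 2) ≤
      2 * (‖w‖ * ‖w'‖) * (1 - Real.cos (w.arg - w'.arg)) := by gcongr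
    nlinarith [sq_nonneg (‖w‖ - ‖w'‖)]
  exact (sq_le_sq₀ (by positivity) (norm_nonneg _)).mp h4

theorem polarBox_same_level_dist {k j j' : ℕ} (hj : j < j') (hpar : j % 2 = j' % 2) {w w' : ℂ}
    (hw : w ∈ polarBox k j) (hw' : w' ∈ polarBox k j') : (1 / 2 : ℝ) ^ k ≤ ‖w - w'‖ := by
  obtain ⟨_, hw2, hw3⟩ := hw
  obtain ⟨_, hw2', hw3'⟩ := hw'
  have hlt : j' < 2 ^ k := hw3' ▸ arcIndex_lt k w'
  have hk : k ≠ 0 := by rintro rfl; simp at hlt; omega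
  have heven : (2 ^ k) % 2 = 0 := by
    obtain ⟨m, rfl⟩ := Nat.exists_eq_succ_of_ne_zero hk
    simp [pow_succ]
  have hA : (j : ℝ) + 2 ≤ j' := by exact_mod_cast (by omega : j + 2 ≤ j')
  have hB : (j' : ℝ) + 1 ≤ 2 ^ k := by exact_mod_cast (by omega : j' + 1 ≤ 2 ^ k)
  obtain ⟨e1, e2⟩ := arcIndex_eq_iff.mp hw3
  obtain ⟨e1', e2'⟩ := arcIndex_eq_iff.mp hw3'
  have hj0 : (0 : ℝ) ≤ j := j.cast_nonneg
  have hhalf : (1 / 2 : ℝ) ^ k ≤ 1 / 2 := by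
    simpa using pow_le_pow_of_le_one (by norm_num : (0 : ℝ) ≤ 1 / 2) (by norm_num)
      (Nat.one_le_iff_ne_zero.mpr hk)
  have hπ := Real.pi_pos
  set P : ℝ := 2 ^ k with hP
  have hPpos : 0 < P := by positivity
  have hinv : (1 / 2 : ℝ) ^ k = 1 / P := by rw [hP, one_div_pow]
  have hdiff : w.arg - w'.arg = 2 * Real.pi / P * (P * ((Real.pi - w'.arg) / (2 * Real.pi)) -
      P * ((Real.pi - w.arg) / (2 * Real.pi))) := by field_simp; ring
  set A := P * ((Real.pi - w.arg) / (2 * Real.pi))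
  set B := P * ((Real.pi - w'.arg) / (2 * Real.pi))
  have hBA : 1 ≤ B - A := by linarith
  have hBA' : B - A ≤ P - 1 := by
    -- Positions 0 and 2^k - 1 are neighbours on the circle. Equal parity excludes this pair because
    -- 2^k is even.
    have hpar2 : j = 0 → j' + 2 ≤ 2 ^ k := by intro h; omega
    rcases Nat.eq_zero_or_pos j with h | h
    · have : (j' : ℝ) + 2 ≤ P := by rw [hP]; exact_mod_cast hpar2 h
      linarith
    · have : (1 : ℝ) ≤ j := by exact_mod_cast h
      linarith
  have hc : 0 < 2 * Real.pi / P := by positivity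
  have habs : |w.arg - w'.arg| = 2 * Real.pi / P * (B - A) := by
    rw [hdiff, abs_of_nonneg (mul_nonneg hc.le (by linarith))]
  have := le_norm_sub_of_arg (w := w) (w' := w') (δ := 2 * Real.pi / P) (by linarith) (by linarith)
    hc.le (by rw [habs]; exact le_mul_of_one_le_right hc.le hBA)
    (by
      rw [habs]
      calc 2 * Real.pi / P * (B - A) ≤ 2 * Real.pi / P * (P - 1) := by gcongr
        _ = _ := by field_simp)
  have e : 2 * Real.pi / P / Real.pi = 2 * (1 / P) := by field_simp
  rw [e, ← hinv] at this
  have : (0 : ℝ) < (1 / 2) ^ k := by positivity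
  linarith

theorem polarBox_diff_level_dist {k k' j j' : ℕ} (hk : k + 2 ≤ k') {w w' : ℂ}
    (hw : w ∈ polarBox k j) (hw' : w' ∈ polarBox k' j') : (1 / 2 : ℝ) ^ k / 4 ≤ ‖w - w'‖ := by
  have h1 := hw.1
  have h2 := hw'.2.1
  have h3 : (1 / 2 : ℝ) ^ k' ≤ (1 / 2 : ℝ) ^ (k + 2) :=
    pow_le_pow_of_le_one (by norm_num) (by norm_num) hk
  rw [pow_add] at h3
  have h4 : ‖w'‖ - ‖w‖ ≤ ‖w - w'‖ := by rw [norm_sub_rev]; exact norm_sub_norm_le _ _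
  linarith

/-- The neighbourhood of a polar box over which a local mean is taken. -/
def fatBox (k j : ℕ) : Set ℂ := Metric.thickening ((1 / 2 : ℝ) ^ k / 8) (polarBox k j)

/-- Distinct generations of equal parity differ by at least two, which leaves a radial gap of a
quarter of the larger scale. In one generation, distinct positions of equal parity leave an angular
gap of a full scale. Neighbourhoods of an eighth of the scale fit into both gaps. -/
theorem fatBox_disjoint {i i' : ℕ × ℕ} (hne : i ≠ i') (h1 : i.1 % 2 = i'.1 % 2)
    (h2 : i.2 % 2 = i'.2 % 2) : Disjoint (fatBox i.1 i.2) (fatBox i'.1 i'.2) := by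
  rw [Set.disjoint_left]
  intro z hz hz'
  obtain ⟨w, hw, hzw⟩ := Metric.mem_thickening_iff.mp hz
  obtain ⟨w', hw', hzw'⟩ := Metric.mem_thickening_iff.mp hz'
  have hd : ‖w - w'‖ < (1 / 2 : ℝ) ^ i.1 / 8 + (1 / 2 : ℝ) ^ i'.1 / 8 := by
    rw [← dist_eq_norm]
    linarith [dist_triangle_left w w' z]
  have hpos : ∀ n : ℕ, (0 : ℝ) < (1 / 2) ^ n := fun n => by positivity
  have hanti : ∀ m n : ℕ, m ≤ n → (1 / 2 : ℝ) ^ n ≤ (1 / 2) ^ m := fun m n h =>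
    pow_le_pow_of_le_one (by norm_num) (by norm_num) h
  rcases lt_trichotomy i.1 i'.1 with h | h | h
  · have := polarBox_diff_level_dist (by omega) hw hw'
    linarith [hanti _ _ h.le]
  · have hj : i.2 ≠ i'.2 := fun h' => hne (Prod.ext h h')
    rw [h] at hw hd
    rcases lt_or_gt_of_ne hj with h' | h'
    · have := polarBox_same_level_dist h' h2 hw hw'
      linarith [hpos i'.1]
    · have := polarBox_same_level_dist h' h2.symm hw' hw
      rw [norm_sub_rev] at this
      linarith [hpos i'.1]
  · have := polarBox_diff_level_dist (by omega) hw' hw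
    rw [norm_sub_rev] at this
    linarith [hanti _ _ h.le]

theorem fatBox_subset (k j : ℕ) : fatBox k j ⊆ unitDiscSet := by
  intro z hz
  obtain ⟨w, hw, hzw⟩ := Metric.mem_thickening_iff.mp hz
  rw [dist_eq_norm] at hzw
  rw [Metric.mem_ball, dist_zero_right]
  have h1 : ‖z‖ ≤ ‖w‖ + ‖z - w‖ := norm_le_norm_add_norm_sub' _ _
  have h2 := hw.1
  have : (0 : ℝ) < (1 / 2) ^ k := by positivity
  linarith

/-- Bounded overlap in the form of a finite colouring: each colour class is disjoint and contributes
at most the total mass. -/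
theorem tsum_measure_le_of_coloring {ι κ X : Type*} [Countable ι] [Fintype κ] [DecidableEq κ]
    [MeasurableSpace X] (ν : Measure X) (V : ι → Set X) (hV : ∀ i, MeasurableSet (V i)) (c : ι → κ)
    (hd : ∀ i j, i ≠ j → c i = c j → Disjoint (V i) (V j)) :
    ∑' i, ν (V i) ≤ Fintype.card κ * ν Set.univ := by
  have hsplit : ∀ i, ν (V i) = ∑ b : κ, ν (if c i = b then V i else ∅) := by
    intro i
    rw [Finset.sum_eq_single (c i)]
    · simp
    · intro b _ hb
      simp [hb.symm]
    · simp
  calc ∑' i, ν (V i) = ∑' i, ∑ b : κ, ν (if c i = b then V i else ∅) := by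
        congr 1 with i; exact hsplit i
    _ = ∑ b : κ, ∑' i, ν (if c i = b then V i else ∅) :=
        Summable.tsum_finsetSum fun _ _ => ENNReal.summable
    _ ≤ ∑ _b : κ, ν Set.univ := by
        refine Finset.sum_le_sum fun b _ => ?_
        rw [← measure_iUnion]
        · exact measure_mono (Set.subset_univ _)
        · intro i j hij
          by_cases h1 : c i = b <;> by_cases h2 : c j = b <;> simp [Function.onFun, h1, h2]
          exact hd i j hij (h1.trans h2.symm)
        · intro i
          split_ifs
          exacts [hV i, MeasurableSet.empty]
    _ = _ := by simp

/-! ### Box coefficients: energy bound and radial oscillation. -/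

/-- The coefficient `2^{-k} sup |f'|` of a polar box. -/
noncomputable def boxCoeff (f : ℂ → ℂ) (k j : ℕ) : ℝ≥0∞ :=
  (⨆ w ∈ polarBox k j, ENNReal.ofReal ‖deriv f w‖) * ENNReal.ofReal ((1 / 2) ^ k)

/-- The box coefficients are controlled by the Dirichlet integral. -/
theorem exists_tsum_boxCoeff_le {p : ℝ} (hp : 0 < p) (α : ℝ) :
    ∃ C : ℝ, 0 < C ∧ ∀ f : ℂ → ℂ, DifferentiableOn ℂ f unitDiscSet →
      ∑' i : ℕ × ℕ, boxCoeff f i.1 i.2 ^ p *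
        ENNReal.ofReal (((1 / 2 : ℝ) ^ i.1) ^ (α + 2 - p)) ≤
      ENNReal.ofReal C * dirichletEnergy p α f := by
  obtain ⟨C, hC, hC'⟩ := exists_rpow_norm_deriv_le hp α
  refine ⟨C * 4, by positivity, fun f hf => ?_⟩
  -- With the energy density turned into a measure, the sum over enlarged boxes is a colouring count
  -- with the four parity classes.
  set ν : Measure ℂ := (normalizedArea.restrict unitDiscSet).withDensity (dirichletDensity p α f)
  have hmeas : ∀ k j, MeasurableSet (fatBox k j) := fun k j => Metric.isOpen_thickening.measurableSet
  have hν : ∀ V : Set ℂ, MeasurableSet V → V ⊆ unitDiscSet →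
      ν V = ∫⁻ z in V, dirichletDensity p α f z ∂normalizedArea := by
    intro V hV hVs
    rw [withDensity_apply _ hV, Measure.restrict_restrict hV, Set.inter_eq_left.mpr hVs]
  have hterm : ∀ k j, boxCoeff f k j ^ p * ENNReal.ofReal (((1 / 2 : ℝ) ^ k) ^ (α + 2 - p)) ≤
      ENNReal.ofReal C * ν (fatBox k j) := by
    intro k j
    set t : ℝ := (1 / 2) ^ k with ht
    have htpos : 0 < t := by positivity
    have hsup : (⨆ w ∈ polarBox k j, ENNReal.ofReal ‖deriv f w‖) ^ p ≤
        ENNReal.ofReal (t ^ (-(α + 2))) * (ENNReal.ofReal C * ν (fatBox k j)) := by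
      rw [← ENNReal.le_rpow_inv_iff hp]
      refine iSup₂_le fun w hw => ?_
      rw [ENNReal.le_rpow_inv_iff hp, ENNReal.ofReal_rpow_of_nonneg (norm_nonneg _) hp.le]
      have hball : Metric.ball w (t / 8) ⊆ fatBox k j := fun z hz =>
        Metric.mem_thickening_iff.mpr ⟨w, hw, hz⟩
      have h1 := hC' f w t hf htpos hw.1 hw.2.1
      calc ENNReal.ofReal (‖deriv f w‖ ^ p) = ENNReal.ofReal (t ^ (-(α + 2))) *
            ENNReal.ofReal (‖deriv f w‖ ^ p * t ^ (α + 2)) := by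
            rw [← ENNReal.ofReal_mul (by positivity)]
            congr 1
            rw [Real.rpow_neg htpos.le]
            have : 0 < t ^ (α + 2) := by positivity
            field_simp
        _ ≤ _ := by
            refine mul_le_mul_right (h1.trans (mul_le_mul_right ?_ _)) _
            rw [hν _ (hmeas k j) (fatBox_subset k j)]
            exact lintegral_mono_set hball
    rw [boxCoeff, ENNReal.mul_rpow_of_nonneg _ _ hp.le, ENNReal.ofReal_rpow_of_pos htpos, mul_assoc,
      ← ENNReal.ofReal_mul (by positivity), ← Real.rpow_add htpos]
    calc _ ≤ ENNReal.ofReal (t ^ (-(α + 2))) * (ENNReal.ofReal C * ν (fatBox k j)) *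
          ENNReal.ofReal (t ^ (p + (α + 2 - p))) := mul_le_mul_left hsup _
      _ = _ := by
          rw [mul_right_comm, ← ENNReal.ofReal_mul (by positivity), ← Real.rpow_add htpos]
          simp
  calc _ ≤ ∑' i : ℕ × ℕ, ENNReal.ofReal C * ν (fatBox i.1 i.2) :=
        ENNReal.tsum_le_tsum fun i => hterm i.1 i.2
    _ = ENNReal.ofReal C * ∑' i : ℕ × ℕ, ν (fatBox i.1 i.2) := ENNReal.tsum_mul_left
    _ ≤ ENNReal.ofReal C * (Fintype.card (Fin 2 × Fin 2) * ν Set.univ) := by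
        refine mul_le_mul_right (tsum_measure_le_of_coloring ν (fun i : ℕ × ℕ => fatBox i.1 i.2)
          (fun i => hmeas _ _)
          (fun i => ((⟨i.1 % 2, Nat.mod_lt _ two_pos⟩, ⟨i.2 % 2, Nat.mod_lt _ two_pos⟩) :
            Fin 2 × Fin 2)) ?_) _
        intro i j hij hc
        simp only [Prod.mk.injEq, Fin.mk.injEq] at hc
        exact fatBox_disjoint hij hc.1 hc.2
    _ = _ := by
        rw [withDensity_apply _ MeasurableSet.univ, Measure.restrict_univ,
          ENNReal.ofReal_mul hC.le, dirichletEnergy, mul_assoc]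
        simp

/-- Mean value inequality on a radial segment, which has length at most 2^{-k} and stays in one
polar box. The condition k ≥ 1 keeps the radii positive, so the argument does not change along the
segment. -/
theorem norm_sub_le_boxCoeff {f : ℂ → ℂ} (hf : DifferentiableOn ℂ f unitDiscSet) {u : ℂ}
    (hu : ‖u‖ = 1) {k : ℕ} (hk : 1 ≤ k) {a b : ℝ} (ha : (1 / 2 : ℝ) ^ k / 2 ≤ 1 - a)
    (ha' : 1 - a ≤ (1 / 2 : ℝ) ^ k) (hb : (1 / 2 : ℝ) ^ k / 2 ≤ 1 - b)
    (hb' : 1 - b ≤ (1 / 2 : ℝ) ^ k) :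
    ENNReal.ofReal ‖f (b * u) - f (a * u)‖ ≤ boxCoeff f k (arcIndex k u) := by
  have htpos : (0 : ℝ) < (1 / 2) ^ k := by positivity
  have hthalf : (1 / 2 : ℝ) ^ k ≤ 1 / 2 := by
    simpa using pow_le_pow_of_le_one (by norm_num : (0 : ℝ) ≤ 1 / 2) (by norm_num) hk
  set S := ⨆ w ∈ polarBox k (arcIndex k u), ENNReal.ofReal ‖deriv f w‖ with hS
  by_cases hSt : S = ∞
  · rw [boxCoeff, ← hS, hSt, ENNReal.top_mul (by simp)]; exact le_top
  have hseg : ∀ x ∈ segment ℝ ((a : ℂ) * u) (b * u), x ∈ polarBox k (arcIndex k u) := by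
    rintro x ⟨s, t, hs, ht, hst, rfl⟩
    have : s • ((a : ℂ) * u) + t • ((b : ℂ) * u) = ((s * a + t * b : ℝ) : ℂ) * u := by
      simp only [Complex.real_smul]; push_cast; ring
    rw [this]
    have hm : 1 - (s * a + t * b) = s * (1 - a) + t * (1 - b) := by linear_combination -hst
    have h1 : (1 / 2 : ℝ) ^ k / 2 ≤ 1 - (s * a + t * b) := by rw [hm]; nlinarith
    have h2 : 1 - (s * a + t * b) ≤ (1 / 2 : ℝ) ^ k := by rw [hm]; nlinarith
    have hpos : 0 < s * a + t * b := by linarith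
    have hn : ‖((s * a + t * b : ℝ) : ℂ) * u‖ = s * a + t * b := by
      rw [norm_mul, hu, mul_one, Complex.norm_real, Real.norm_eq_abs, abs_of_pos hpos]
    exact ⟨by rw [hn]; exact h1, by rw [hn]; exact h2, arcIndex_real_mul k hpos u⟩
  have hdisc : ∀ x ∈ polarBox k (arcIndex k u), x ∈ unitDiscSet := by
    intro x hx
    rw [Metric.mem_ball, dist_zero_right]
    linarith [hx.1]
  have hder : ∀ x ∈ polarBox k (arcIndex k u), ‖deriv f x‖ ≤ S.toReal := by
    intro x hx
    rw [← ENNReal.ofReal_le_iff_le_toReal hSt, hS]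
    exact le_iSup₂ (f := fun w (_ : w ∈ polarBox k (arcIndex k u)) => ENNReal.ofReal ‖deriv f w‖) x hx
  have key := (convex_segment ((a : ℂ) * u) (b * u)).norm_image_sub_le_of_norm_deriv_le
    (fun x hx => hf.differentiableAt (Metric.isOpen_ball.mem_nhds (hdisc x (hseg x hx))))
    (fun x hx => hder x (hseg x hx)) (left_mem_segment ℝ _ _) (right_mem_segment ℝ _ _)
  have hlen : ‖(b : ℂ) * u - a * u‖ ≤ (1 / 2 : ℝ) ^ k := by
    rw [← sub_mul, norm_mul, hu, mul_one, ← Complex.ofReal_sub, Complex.norm_real, Real.norm_eq_abs,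
      abs_le]
    constructor <;> linarith
  calc ENNReal.ofReal ‖f (b * u) - f (a * u)‖ ≤ ENNReal.ofReal (S.toReal * (1 / 2) ^ k) :=
        ENNReal.ofReal_le_ofReal (key.trans (mul_le_mul_of_nonneg_left hlen ENNReal.toReal_nonneg))
    _ = _ := by rw [ENNReal.ofReal_mul ENNReal.toReal_nonneg, ENNReal.ofReal_toReal hSt, boxCoeff]

/-- Consecutive closed annuli share the radius 1 - 2^{-(n+1)}, and the triangle inequality is
chained through these radii. -/
theorem norm_sub_le_sum_boxCoeff {f : ℂ → ℂ} (hf : DifferentiableOn ℂ f unitDiscSet) {u : ℂ}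
    (hu : ‖u‖ = 1) {K : ℕ} (hK : 1 ≤ K) {n : ℕ} (hn : K ≤ n) {r : ℝ}
    (h1 : (1 / 2 : ℝ) ^ n / 2 ≤ 1 - r) (h2 : 1 - r ≤ (1 / 2 : ℝ) ^ n) :
    ENNReal.ofReal ‖f (r * u) - f ((1 - (1 / 2) ^ K : ℝ) * u)‖ ≤
      ∑ k ∈ Finset.Icc K n, boxCoeff f k (arcIndex k u) := by
  have hp : ∀ m : ℕ, (0 : ℝ) < (1 / 2) ^ m := fun m => by positivity
  induction n, hn using Nat.le_induction generalizing r with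
  | base =>
    rw [Finset.Icc_self, Finset.sum_singleton]
    refine norm_sub_le_boxCoeff hf hu hK ?_ ?_ h1 h2
    · linarith [hp K]
    · linarith [hp K]
  | succ n hn ih =>
    rw [Finset.sum_Icc_succ_top (by omega)]
    have e1 : (1 / 2 : ℝ) ^ (n + 1) = (1 / 2) ^ n / 2 := by rw [pow_succ]; ring
    have h3 := ih (r := 1 - (1 / 2) ^ (n + 1)) (by rw [e1]; linarith) (by rw [e1]; linarith [hp n])
    have h4 := norm_sub_le_boxCoeff hf hu (k := n + 1) (by omega) (a := 1 - (1 / 2) ^ (n + 1)) (b := r)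
      (by linarith [hp (n + 1)]) (by linarith) h1 h2
    calc _ ≤ ENNReal.ofReal (‖f (((1 - (1 / 2) ^ (n + 1) : ℝ) : ℂ) * u) -
            f ((1 - (1 / 2) ^ K : ℝ) * u)‖ + ‖f (r * u) - f (((1 - (1 / 2) ^ (n + 1) : ℝ) : ℂ) * u)‖) := by
          refine ENNReal.ofReal_le_ofReal ?_
          rw [add_comm]
          exact norm_sub_le_norm_sub_add_norm_sub _ _ _
      _ ≤ _ := by
          rw [ENNReal.ofReal_add (norm_nonneg _) (norm_nonneg _)]
          exact add_le_add h3 h4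

/-! ### Normal families and properties of the Dirichlet integral. -/

/-- A Montel theorem on the disc, for functions with a common bound on the derivatives. -/
theorem exists_subseq_tendstoLocallyUniformlyOn {F : ℕ → ℂ → ℂ}
    (hF : ∀ n, DifferentiableOn ℂ (F n) unitDiscSet) {B : ℝ} (hB : ∀ n, ‖F n 0‖ ≤ B) {L : ℝ → ℝ}
    (hLmono : ∀ r s, 0 ≤ r → r ≤ s → s < 1 → L r ≤ L s)
    (hL : ∀ n, ∀ w ∈ unitDiscSet, ‖deriv (F n) w‖ ≤ L ‖w‖) :
    ∃ (φ : ℕ → ℕ) (g : ℂ → ℂ), StrictMono φ ∧ DifferentiableOn ℂ g unitDiscSet ∧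
      TendstoLocallyUniformlyOn (fun n => F (φ n)) g atTop unitDiscSet := by
  have _ : LocallyCompactSpace DiscPt := Metric.isOpen_ball.locallyCompactSpace
  have _ : SigmaCompactSpace DiscPt := sigmaCompactSpace_of_locallyCompact_secondCountable
  have hlt : ∀ z : DiscPt, ‖(z : ℂ)‖ < 1 := fun z => by
    have := Metric.mem_ball.mp z.2
    rwa [dist_zero_right] at this
  let o : DiscPt := ⟨0, Metric.mem_ball_self one_pos⟩
  -- A bound at 0 and Lipschitz bounds on smaller discs are closed under pointwise limits. They give
  -- pointwise compactness by Tychonoff and equicontinuity, and Arzelà–Ascoli passes to the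
  -- compact-open topology.
  let P : (DiscPt → ℂ) → Prop := fun h => ‖h o‖ ≤ B ∧ ∀ r : ℝ, r < 1 → ∀ z w : DiscPt,
    ‖(z : ℂ)‖ ≤ r → ‖(w : ℂ)‖ ≤ r → ‖h z - h w‖ ≤ L r * ‖(z : ℂ) - w‖
  have hmod : ∀ z₀ : DiscPt, ∃ b : DiscPt → ℝ, Tendsto b (𝓝 z₀) (𝓝 0) ∧
      ∀ᶠ w in 𝓝 z₀, ∀ h : {h // P h}, dist (h.1 z₀) (h.1 w) ≤ b w := by
    intro z₀
    set r := (1 + ‖(z₀ : ℂ)‖) / 2 with hr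
    have h1 := hlt z₀
    refine ⟨fun w => L r * ‖(z₀ : ℂ) - w‖, ?_, ?_⟩
    · have : Continuous fun w : DiscPt => L r * ‖(z₀ : ℂ) - w‖ := by fun_prop
      simpa using this.tendsto z₀
    · have hc : Continuous fun w : DiscPt => ‖(w : ℂ)‖ := by fun_prop
      filter_upwards [hc.tendsto z₀ |>.eventually (Iic_mem_nhds (show ‖(z₀ : ℂ)‖ < r by linarith))]
        with w hw h
      rw [dist_eq_norm]
      exact h.2.2 r (by linarith) z₀ w (by linarith) hw
  have heqc : Equicontinuous (fun h : {h // P h} => h.1) := fun z₀ => by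
    obtain ⟨b, hb, hb'⟩ := hmod z₀
    exact Metric.equicontinuousAt_of_continuity_modulus b hb _ hb'
  let S : Set C(DiscPt, ℂ) := {h | P h}
  have himage : ContinuousMap.toFun '' S = {h | P h} := by
    ext h
    refine ⟨?_, fun hh => ⟨⟨h, heqc.continuous ⟨h, hh⟩⟩, hh, rfl⟩⟩
    rintro ⟨h', hh', rfl⟩
    exact hh'
  have hclosed : IsClosed {h : DiscPt → ℂ | P h} := by
    have h2 : IsClosed {h : DiscPt → ℂ | ∀ r : ℝ, r < 1 → ∀ z w : DiscPt,
        ‖(z : ℂ)‖ ≤ r → ‖(w : ℂ)‖ ≤ r → ‖h z - h w‖ ≤ L r * ‖(z : ℂ) - w‖} := by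
      simp only [Set.ofPred_forall]
      refine isClosed_iInter fun r => isClosed_iInter fun _ => isClosed_iInter fun z =>
        isClosed_iInter fun w => isClosed_iInter fun _ => isClosed_iInter fun _ =>
        isClosed_le ?_ continuous_const
      exact ((continuous_apply z).sub (continuous_apply w)).norm
    exact IsClosed.inter (isClosed_le (continuous_apply o).norm continuous_const) h2
  have hcpt : IsCompact {h : DiscPt → ℂ | P h} := by
    refine (isCompact_univ_pi fun z : DiscPt => isCompact_closedBall (0 : ℂ)
      (B + L ‖(z : ℂ)‖ * ‖(z : ℂ)‖)).of_isClosed_subset hclosed ?_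
    intro h hh z _
    have h1 := hh.2 ‖(z : ℂ)‖ (hlt z) z o le_rfl (by simp [o])
    rw [Metric.mem_closedBall, dist_zero_right]
    have h2 : ‖h z‖ ≤ ‖h o‖ + ‖h z - h o‖ := norm_le_norm_add_norm_sub' _ _
    have h3 : ‖(z : ℂ) - o‖ = ‖(z : ℂ)‖ := by simp [o]
    rw [h3] at h1
    linarith [hh.1]
  have hS : IsCompact S := by
    refine ArzelaAscoli.isCompact_of_equicontinuous S (himage ▸ hcpt) ?_
    intro z₀
    obtain ⟨b, hb, hb'⟩ := hmod z₀
    refine Metric.equicontinuousAt_of_continuity_modulus b hb _ ?_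
    filter_upwards [hb'] with w hw h
    exact hw ⟨h.1, h.2⟩
  let Φ : ℕ → C(DiscPt, ℂ) := fun n =>
    ⟨fun z => F n z, (hF n).continuousOn.comp_continuous continuous_subtype_val fun z => z.2⟩
  have hΦ : ∀ n, Φ n ∈ S := by
    intro n
    refine ⟨hB n, fun r hr z w hz hw => ?_⟩
    have hsub : Metric.closedBall (0 : ℂ) r ⊆ unitDiscSet := Metric.closedBall_subset_ball hr
    exact (convex_closedBall (0 : ℂ) r).norm_image_sub_le_of_norm_deriv_le
      (fun x hx => (hF n).differentiableAt (Metric.isOpen_ball.mem_nhds (hsub hx)))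
      (fun x hx => (hL n x (hsub hx)).trans (hLmono _ _ (norm_nonneg _)
        (by simpa using hx) hr)) (by simpa using hw) (by simpa using hz)
  obtain ⟨h, -, φ, hφ, hlim⟩ := hS.tendsto_subseq hΦ
  classical
  let g : ℂ → ℂ := fun z => if hz : z ∈ unitDiscSet then h ⟨z, hz⟩ else 0
  have hg : TendstoLocallyUniformlyOn (fun n => F (φ n)) g atTop unitDiscSet := by
    rw [tendstoLocallyUniformlyOn_iff_tendstoLocallyUniformly_comp_coe]
    have e : g ∘ Subtype.val = h := by
      funext z
      have hz : (z : ℂ) ∈ unitDiscSet := z.2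
      simp only [Function.comp_apply, g, hz, dif_pos]
    rw [e]
    exact ContinuousMap.tendsto_iff_tendstoLocallyUniformly.mp hlim
  exact ⟨φ, g, hφ, hg.differentiableOn (Eventually.of_forall fun n => hF _) Metric.isOpen_ball, hg⟩

theorem measurable_dirichletDensity (p α : ℝ) (f : ℂ → ℂ) : Measurable (dirichletDensity p α f) := by
  have := measurable_deriv f
  unfold dirichletDensity
  fun_prop

theorem dirichletNorm_le_iff {p : ℝ} (hp : 0 < p) {α : ℝ} {f : ℂ → ℂ} {B : ℝ≥0∞} :
    dirichletNorm p α f ≤ B ↔ ENNReal.ofReal (‖f 0‖ ^ p) + dirichletEnergy p α f ≤ B ^ p := by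
  rw [dirichletNorm, one_div, ENNReal.rpow_inv_le_iff hp]
  rfl

theorem dirichletNorm_lt_top_iff {p : ℝ} (hp : 0 < p) {α : ℝ} {f : ℂ → ℂ} :
    dirichletNorm p α f < ∞ ↔ dirichletEnergy p α f < ∞ := by
  rw [dirichletNorm, ENNReal.rpow_lt_top_iff_of_pos (by positivity), ENNReal.add_lt_top]
  simp [dirichletEnergy, dirichletDensity]

/-- Pointwise bound of the derivative by the Dirichlet integral. -/
theorem exists_norm_deriv_le {p : ℝ} (hp : 0 < p) (α : ℝ) :
    ∃ C : ℝ, 0 < C ∧ ∀ (f : ℂ → ℂ) (M : ℝ), 0 ≤ M → DifferentiableOn ℂ f unitDiscSet →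
      dirichletEnergy p α f ≤ ENNReal.ofReal M → ∀ w ∈ unitDiscSet,
      ‖deriv f w‖ ≤ (C * M) ^ (1 / p) * (1 - ‖w‖) ^ (-((α + 2) / p)) := by
  obtain ⟨C, hC, hC'⟩ := exists_rpow_norm_deriv_le hp α
  refine ⟨C, hC, fun f M hM hf hfM w hw => ?_⟩
  have ht : 0 < 1 - ‖w‖ := by
    rw [Metric.mem_ball, dist_zero_right] at hw; linarith
  have h1 := hC' f w (1 - ‖w‖) hf ht (by linarith) le_rfl
  have h2 : ENNReal.ofReal (‖deriv f w‖ ^ p * (1 - ‖w‖) ^ (α + 2)) ≤ ENNReal.ofReal (C * M) := by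
    rw [ENNReal.ofReal_mul hC.le]
    refine h1.trans (mul_le_mul_right (le_trans (lintegral_mono_set ?_) hfM) _)
    intro z hz
    rw [Metric.mem_ball, dist_eq_norm] at hz
    rw [Metric.mem_ball, dist_zero_right]
    have : ‖z‖ ≤ ‖w‖ + ‖z - w‖ := norm_le_norm_add_norm_sub' _ _
    linarith
  rw [ENNReal.ofReal_le_ofReal_iff (by positivity)] at h2
  refine (Real.rpow_le_rpow_iff (norm_nonneg _) (by positivity) hp).mp ?_
  rw [Real.mul_rpow (by positivity) (by positivity), ← Real.rpow_mul (by positivity),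
    ← Real.rpow_mul ht.le, one_div_mul_cancel hp.ne', Real.rpow_one,
    show -((α + 2) / p) * p = -(α + 2) by field_simp, Real.rpow_neg ht.le,
    ← div_eq_mul_inv, le_div_iff₀ (by positivity)]
  exact h2

theorem ENNReal.add_rpow_le_two_rpow_mul {q : ℝ} (hq : 0 ≤ q) (a b : ℝ≥0∞) :
    (a + b) ^ q ≤ 2 ^ q * (a ^ q + b ^ q) := by
  calc (a + b) ^ q ≤ (2 * max a b) ^ q := by
        refine ENNReal.rpow_le_rpow ?_ hq
        rw [two_mul]; exact add_le_add (le_max_left _ _) (le_max_right _ _)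
    _ = 2 ^ q * max a b ^ q := ENNReal.mul_rpow_of_nonneg _ _ hq
    _ ≤ _ := by
        refine mul_le_mul_right ?_ _
        rcases le_total a b with h | h
        · rw [max_eq_right h]; exact le_add_self
        · rw [max_eq_left h]; exact le_self_add

theorem dirichletEnergy_sub_le {p : ℝ} (hp : 0 < p) (α : ℝ) {f g : ℂ → ℂ}
    (hf : DifferentiableOn ℂ f unitDiscSet) (hg : DifferentiableOn ℂ g unitDiscSet) :
    dirichletEnergy p α (f - g) ≤
      2 ^ p * (dirichletEnergy p α f + dirichletEnergy p α g) := by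
  unfold dirichletEnergy
  rw [← lintegral_add_left (measurable_dirichletDensity p α f), ← lintegral_const_mul' _ _ (by simp)]
  refine setLIntegral_mono_ae' measurableSet_ball (Eventually.of_forall fun z hz => ?_)
  have hzn := Metric.isOpen_ball.mem_nhds hz
  have hz1 : ‖z‖ < 1 := by simpa using hz
  have hw : 0 ≤ 1 - ‖z‖ ^ 2 := by nlinarith [norm_nonneg z]
  unfold dirichletDensity
  rw [deriv_sub (hf.differentiableAt hzn) (hg.differentiableAt hzn),
    ENNReal.ofReal_mul (by positivity), ENNReal.ofReal_mul (by positivity),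
    ENNReal.ofReal_mul (by positivity), ← add_mul, ← mul_assoc,
    ← ENNReal.ofReal_rpow_of_nonneg (norm_nonneg _) hp.le,
    ← ENNReal.ofReal_rpow_of_nonneg (norm_nonneg _) hp.le,
    ← ENNReal.ofReal_rpow_of_nonneg (norm_nonneg _) hp.le]
  refine mul_le_mul_left (le_trans (ENNReal.rpow_le_rpow ?_ hp.le)
    (ENNReal.add_rpow_le_two_rpow_mul hp.le _ _)) _
  rw [← ENNReal.ofReal_add (norm_nonneg _) (norm_nonneg _)]
  exact ENNReal.ofReal_le_ofReal (norm_sub_le _ _)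

/-! ### Compactness from the tail estimate. -/

/-- Near the boundary the functions of a bounded set of the Dirichlet space are close in
`L^q(μ)`, uniformly, to their values on an inner circle. -/
def TailEstimate (p α q : ℝ) (μ : Measure DiscPt) : Prop :=
  ∀ M : ℝ≥0∞, M ≠ ∞ → ∀ ε : ℝ≥0∞, 0 < ε → ∃ K : ℕ, 1 ≤ K ∧ ∀ f : ℂ → ℂ,
    DifferentiableOn ℂ f unitDiscSet → dirichletEnergy p α f ≤ M →
    ∫⁻ z in {z : DiscPt | 1 - (1 / 2 : ℝ) ^ K ≤ ‖(z : ℂ)‖},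
      ENNReal.ofReal ‖f z - f ((1 - (1 / 2) ^ K : ℝ) * ((z : ℂ) / (‖(z : ℂ)‖ : ℂ)))‖ ^ q ∂μ ≤ ε

theorem measurableSet_outerAnnulus (r : ℝ) : MeasurableSet {z : DiscPt | r ≤ ‖(z : ℂ)‖} :=
  measurableSet_le measurable_const (by fun_prop)

/-- Inside the circle |f| is at most η. Outside, |f| is at most its oscillation from the circle plus
a value on the circle, which is again at most η. -/
theorem lintegral_rpow_le_of_tail {q : ℝ} (hq : 0 < q) {μ : Measure DiscPt} {f : ℂ → ℂ} {K : ℕ}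
    (hK : 1 ≤ K) {η ε : ℝ≥0∞}
    (hη : ∀ w : ℂ, ‖w‖ ≤ 1 - (1 / 2 : ℝ) ^ K → ‖f w‖ₑ ≤ η)
    (hε : ∫⁻ z in {z : DiscPt | 1 - (1 / 2 : ℝ) ^ K ≤ ‖(z : ℂ)‖},
      ENNReal.ofReal ‖f z - f ((1 - (1 / 2) ^ K : ℝ) * ((z : ℂ) / (‖(z : ℂ)‖ : ℂ)))‖ ^ q ∂μ ≤ ε) :
    ∫⁻ z, ‖onDisc f z‖ₑ ^ q ∂μ ≤ 2 ^ q * ε + (2 ^ q + 1) * (η ^ q * μ Set.univ) := by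
  have hKhalf : (1 / 2 : ℝ) ^ K ≤ 1 / 2 := by
    simpa using pow_le_pow_of_le_one (by norm_num : (0 : ℝ) ≤ 1 / 2) (by norm_num) hK
  set A := {z : DiscPt | 1 - (1 / 2 : ℝ) ^ K ≤ ‖(z : ℂ)‖} with hA
  have hAm : MeasurableSet A := measurableSet_outerAnnulus _
  have h1 : ∫⁻ z in Aᶜ, ‖onDisc f z‖ₑ ^ q ∂μ ≤ η ^ q * μ Set.univ := by
    calc _ ≤ ∫⁻ _ in Aᶜ, η ^ q ∂μ := by
          refine setLIntegral_mono_ae' hAm.compl (Eventually.of_forall fun z hz => ?_)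
          exact ENNReal.rpow_le_rpow (hη _ (le_of_lt (not_le.mp (show ¬ (1 - (1 / 2 : ℝ) ^ K ≤ ‖(z : ℂ)‖) from hz)))) hq.le
      _ ≤ _ := by
          rw [setLIntegral_const]
          exact mul_le_mul_right (measure_mono (Set.subset_univ _)) _
  have h2 : ∫⁻ z in A, ‖onDisc f z‖ₑ ^ q ∂μ ≤ 2 ^ q * (ε + η ^ q * μ Set.univ) := by
    calc _ ≤ ∫⁻ z in A, 2 ^ q * (ENNReal.ofReal ‖f z - f ((1 - (1 / 2) ^ K : ℝ) *
              ((z : ℂ) / (‖(z : ℂ)‖ : ℂ)))‖ ^ q + η ^ q) ∂μ := by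
          refine setLIntegral_mono_ae' hAm (Eventually.of_forall fun z hz => ?_)
          refine le_trans (ENNReal.rpow_le_rpow ?_ hq.le) (ENNReal.add_rpow_le_two_rpow_mul hq.le _ _)
          have hz0 : 0 < ‖(z : ℂ)‖ := by
            have : 1 - (1 / 2 : ℝ) ^ K ≤ ‖(z : ℂ)‖ := hz
            linarith
          have h3 := hη ((1 - (1 / 2) ^ K : ℝ) * ((z : ℂ) / (‖(z : ℂ)‖ : ℂ))) (by
            rw [norm_mul, norm_div, Complex.norm_real, Complex.norm_real, Real.norm_eq_abs,
              Real.norm_eq_abs, abs_of_pos hz0, div_self hz0.ne', mul_one,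
              abs_of_nonneg (by linarith)])
          refine le_trans ?_ (add_le_add_right h3 _)
          rw [ofReal_norm]
          refine le_trans (le_of_eq ?_) (enorm_add_le _ _)
          rw [sub_add_cancel]; rfl
      _ = 2 ^ q * ((∫⁻ z in A, ENNReal.ofReal ‖f z - f ((1 - (1 / 2) ^ K : ℝ) *
              ((z : ℂ) / (‖(z : ℂ)‖ : ℂ)))‖ ^ q ∂μ) + η ^ q * μ A) := by
          rw [lintegral_const_mul' _ _ (by simp), lintegral_add_right _ measurable_const,
            setLIntegral_const]
      _ ≤ _ := mul_le_mul_right (add_le_add hε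
            (mul_le_mul_right (measure_mono (Set.subset_univ _)) _)) _
  rw [← lintegral_add_compl _ hAm]
  refine (add_le_add h2 h1).trans (le_of_eq ?_)
  ring

theorem norm_le_one_sub_subset (K : ℕ) :
    Metric.closedBall (0 : ℂ) (1 - (1 / 2) ^ K) ⊆ unitDiscSet :=
  Metric.closedBall_subset_ball (by have : (0 : ℝ) < (1 / 2) ^ K := by positivity
                                    linarith)

theorem TailEstimate.lintegral_rpow_lt_top {p α q : ℝ} (hq : 0 < q) {μ : Measure DiscPt}
    [IsFiniteMeasure μ] (h : TailEstimate p α q μ) {f : ℂ → ℂ}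
    (hf : DifferentiableOn ℂ f unitDiscSet) (hfD : dirichletEnergy p α f < ∞) :
    ∫⁻ z, ‖onDisc f z‖ₑ ^ q ∂μ < ∞ := by
  obtain ⟨K, hK, hKf⟩ := h _ hfD.ne 1 one_pos
  obtain ⟨C, hC⟩ := (isCompact_closedBall (0 : ℂ) (1 - (1 / 2) ^ K)).exists_bound_of_continuousOn
    (hf.continuousOn.mono (norm_le_one_sub_subset K))
  have := lintegral_rpow_le_of_tail hq hK (η := ENNReal.ofReal C) (fun w hw => by
    rw [← ofReal_norm]
    exact ENNReal.ofReal_le_ofReal (hC w (by simpa using hw))) (hKf f hf le_rfl)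
  refine this.trans_lt ?_
  have h2 : (2 : ℝ≥0∞) ^ q < ∞ := ENNReal.rpow_lt_top_of_nonneg hq.le (by simp)
  refine ENNReal.add_lt_top.mpr ⟨by simpa using h2, ENNReal.mul_lt_top
    (ENNReal.add_lt_top.mpr ⟨h2, ENNReal.one_lt_top⟩) (ENNReal.mul_lt_top ?_ (measure_lt_top _ _))⟩
  exact ENNReal.rpow_lt_top_of_nonneg hq.le ENNReal.ofReal_ne_top

/-- The tail is small independently of n, with `K` fixed first. Uniform convergence on the remaining
closed disc then makes η small. -/
theorem TailEstimate.tendsto_lintegral {p α q : ℝ} (hq : 0 < q) {μ : Measure DiscPt}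
    [IsFiniteMeasure μ] (h : TailEstimate p α q μ) {F : ℕ → ℂ → ℂ}
    (hF : ∀ n, DifferentiableOn ℂ (F n) unitDiscSet) {M : ℝ≥0∞} (hM : M ≠ ∞)
    (hFM : ∀ n, dirichletEnergy p α (F n) ≤ M)
    (hlim : TendstoLocallyUniformlyOn F 0 atTop unitDiscSet) :
    Tendsto (fun n => ∫⁻ z, ‖onDisc (F n) z‖ₑ ^ q ∂μ) atTop (𝓝 0) := by
  rw [ENNReal.tendsto_nhds_zero]
  intro ε hε
  have h2 : (2 : ℝ≥0∞) ^ q ≠ ∞ := (ENNReal.rpow_lt_top_of_nonneg hq.le (by simp)).ne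
  have h20 : (2 : ℝ≥0∞) ^ q ≠ 0 := by simp
  have hε2 : ε / 2 ≠ 0 := by simpa using hε.ne'
  obtain ⟨K, hK, hKf⟩ := h M hM (ε / 2 / 2 ^ q) (ENNReal.div_pos hε2 h2)
  have hDfin : (2 ^ q + 1) * μ Set.univ ≠ ∞ :=
    ENNReal.mul_ne_top (ENNReal.add_ne_top.mpr ⟨h2, ENNReal.one_ne_top⟩) (measure_ne_top _ _)
  obtain ⟨η, hη0, hη⟩ : ∃ η : ℝ, 0 < η ∧
      (2 ^ q + 1) * (ENNReal.ofReal η ^ q * μ Set.univ) ≤ ε / 2 := by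
    have ht : Tendsto (fun η : ℝ => (2 ^ q + 1) * μ Set.univ * ENNReal.ofReal η ^ q) (𝓝[>] 0)
        (𝓝 ((2 ^ q + 1) * μ Set.univ * ENNReal.ofReal 0 ^ q)) := by
      refine ENNReal.Tendsto.const_mul ?_ (Or.inr hDfin)
      exact ((ENNReal.continuous_rpow_const.comp ENNReal.continuous_ofReal).tendsto 0).mono_left
        nhdsWithin_le_nhds
    rw [ENNReal.ofReal_zero, ENNReal.zero_rpow_of_pos hq, mul_zero] at ht
    obtain ⟨η, h1, h2⟩ := ((ENNReal.tendsto_nhds_zero.mp ht (ε / 2) (pos_iff_ne_zero.mpr hε2)).and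
      self_mem_nhdsWithin).exists
    exact ⟨η, h2, by rwa [mul_comm (ENNReal.ofReal η ^ q), ← mul_assoc]⟩
  have hunif := (tendstoLocallyUniformlyOn_iff_forall_isCompact Metric.isOpen_ball).mp hlim _
    (norm_le_one_sub_subset K) (isCompact_closedBall _ _)
  filter_upwards [Metric.tendstoUniformlyOn_iff.mp hunif η hη0] with n hn
  have := lintegral_rpow_le_of_tail hq hK (η := ENNReal.ofReal η) (fun w hw => by
    rw [← ofReal_norm]
    have := hn w (by simpa using hw)
    simp only [Pi.zero_apply, dist_zero_left] at this
    exact ENNReal.ofReal_le_ofReal this.le) (hKf _ (hF n) (hFM n))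
  refine this.trans ?_
  rw [ENNReal.mul_div_cancel h20 h2]
  calc _ ≤ ε / 2 + ε / 2 := add_le_add_right hη _
    _ = ε := ENNReal.add_halves ε

theorem aestronglyMeasurable_onDisc {f : ℂ → ℂ} (hf : DifferentiableOn ℂ f unitDiscSet)
    (μ : Measure DiscPt) : AEStronglyMeasurable (onDisc f) μ :=
  (hf.continuousOn.comp_continuous continuous_subtype_val fun z => z.2).aestronglyMeasurable

theorem memLp_onDisc_iff {f : ℂ → ℂ} (hf : DifferentiableOn ℂ f unitDiscSet) {q : ℝ} (hq : 0 < q)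
    {μ : Measure DiscPt} :
    MemLp (onDisc f) (ENNReal.ofReal q) μ ↔ ∫⁻ z, ‖onDisc f z‖ₑ ^ q ∂μ < ∞ := by
  rw [MemLp, eLpNorm_lt_top_iff_lintegral_rpow_enorm_lt_top (by simpa using hq)
    ENNReal.ofReal_ne_top, ENNReal.toReal_ofReal hq.le]
  exact and_iff_right (aestronglyMeasurable_onDisc hf μ)

/-- The pointwise bound on derivatives makes a bounded sequence normal. The differences from a
locally uniform limit have bounded energy and tend to 0 locally uniformly, so the tail estimate
makes them tend to 0 in L^q(μ). -/
theorem isCompactDirichletEmbedding_of_tailEstimate {p α q : ℝ} (hp : 0 < p) (hα : -1 < α)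
    (hq : 0 < q) {μ : Measure DiscPt} [IsFiniteMeasure μ] (h : TailEstimate p α q μ) :
    IsCompactDirichletEmbedding p α q μ := by
  refine ⟨fun f hf => (memLp_onDisc_iff hf.1 hq).mpr
    (h.lintegral_rpow_lt_top hq hf.1 ((dirichletNorm_lt_top_iff hp).mp hf.2)), ?_⟩
  rintro F hF ⟨M, hM⟩
  set N : ℝ := max M 0 ^ p with hN
  have hN0 : 0 ≤ N := by positivity
  have hnorm : ∀ n, ENNReal.ofReal (‖F n 0‖ ^ p) + dirichletEnergy p α (F n) ≤ ENNReal.ofReal N := by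
    intro n
    rw [hN, ← ENNReal.ofReal_rpow_of_nonneg (le_max_right _ _) hp.le]
    exact (dirichletNorm_le_iff hp).mp ((hM n).trans (ENNReal.ofReal_le_ofReal (le_max_left _ _)))
  have hE : ∀ n, dirichletEnergy p α (F n) ≤ ENNReal.ofReal N := fun n => le_add_self.trans (hnorm n)
  have hB : ∀ n, ‖F n 0‖ ≤ max M 0 := by
    intro n
    have := (ENNReal.ofReal_le_ofReal_iff hN0).mp (le_self_add.trans (hnorm n))
    exact (Real.rpow_le_rpow_iff (norm_nonneg _) (le_max_right _ _) hp).mp this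
  obtain ⟨C, hC, hC'⟩ := exists_norm_deriv_le hp α
  obtain ⟨φ, g, hφ, hg, hlim⟩ := exists_subseq_tendstoLocallyUniformlyOn (fun n => (hF n).1) hB
    (L := fun r => (C * N) ^ (1 / p) * (1 - r) ^ (-((α + 2) / p)))
    (fun r s _ hrs hs => by
      refine mul_le_mul_of_nonneg_left (Real.rpow_le_rpow_of_nonpos (by linarith) (by linarith) ?_)
        (by positivity)
      rw [neg_nonpos]
      exact div_nonneg (by linarith) hp.le)
    (fun n w hw => hC' _ N hN0 (hF n).1 (hE n) w hw)
  -- Fatou's lemma, with locally uniform convergence of the derivatives.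
  have hgE : dirichletEnergy p α g ≤ ENNReal.ofReal N := by
    have hd := hlim.deriv (Eventually.of_forall fun n => (hF _).1) Metric.isOpen_ball
    calc dirichletEnergy p α g = ∫⁻ z in unitDiscSet,
          liminf (fun n => dirichletDensity p α (F (φ n)) z) atTop ∂normalizedArea := by
          refine setLIntegral_congr_fun measurableSet_ball fun z hz => ?_
          refine (Tendsto.liminf_eq ?_).symm
          have h1 : Tendsto (fun n => deriv (F (φ n)) z) atTop (𝓝 (deriv g z)) := hd.tendsto_at hz
          exact ENNReal.tendsto_ofReal ((h1.norm.rpow_const (Or.inr hp.le)).mul_const _)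
      _ ≤ liminf (fun n => dirichletEnergy p α (F (φ n))) atTop :=
          lintegral_liminf_le fun n => measurable_dirichletDensity p α _
      _ ≤ ENNReal.ofReal N := liminf_le_of_frequently_le' (Frequently.of_forall fun n => hE _)
  have hqne : ENNReal.ofReal q ≠ 0 := by simpa using hq
  refine ⟨φ, onDisc g, hφ, (memLp_onDisc_iff hg hq).mpr
    (h.lintegral_rpow_lt_top hq hg (hgE.trans_lt ENNReal.ofReal_lt_top)), ?_⟩
  have key := h.tendsto_lintegral hq (F := fun n => F (φ n) - g)
    (fun n => (hF _).1.sub hg) (M := 2 ^ p * (ENNReal.ofReal N + ENNReal.ofReal N))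
    (ENNReal.mul_ne_top (by simp) (by simp))
    (fun n => (dirichletEnergy_sub_le hp α (hF _).1 hg).trans
      (mul_le_mul_right (add_le_add (hE _) hgE) _))
    (by
      rw [Metric.tendstoLocallyUniformlyOn_iff] at hlim ⊢
      intro ε hε x hx
      obtain ⟨t, ht, hev⟩ := hlim ε hε x hx
      refine ⟨t, ht, hev.mono fun n hn y hy => ?_⟩
      have := hn y hy
      rw [dist_comm, dist_eq_norm] at this
      rwa [Pi.zero_apply, dist_zero_left])
  have h3 := (ENNReal.continuous_rpow_const (y := 1 / q)).tendsto 0 |>.comp key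
  rw [ENNReal.zero_rpow_of_pos (by positivity)] at h3
  refine h3.congr fun n => ?_
  rw [eLpNorm_eq_lintegral_rpow_enorm_toReal hqne ENNReal.ofReal_ne_top, ENNReal.toReal_ofReal hq.le]
  rfl

/-! ### Carleson boxes, and the tail estimate from a box condition. -/

/-- The generation of the dyadic annulus containing a point of the disc. -/
noncomputable def discLevel (z : DiscPt) : ℕ := ⌊Real.logb 2 (1 / (1 - ‖(z : ℂ)‖))⌋₊

theorem DiscPt.norm_lt_one (z : DiscPt) : ‖(z : ℂ)‖ < 1 := by
  have := Metric.mem_ball.mp z.2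
  rwa [dist_zero_right] at this

theorem le_discLevel_iff {k : ℕ} {z : DiscPt} :
    k ≤ discLevel z ↔ 1 - ‖(z : ℂ)‖ ≤ (1 / 2 : ℝ) ^ k := by
  have hz := z.norm_lt_one
  have hpos : 0 < 1 - ‖(z : ℂ)‖ := by linarith
  have h1 : 1 ≤ 1 / (1 - ‖(z : ℂ)‖) := by
    rw [le_div_iff₀ hpos]; linarith [norm_nonneg (z : ℂ)]
  rw [discLevel, Nat.le_floor_iff (Real.logb_nonneg (by norm_num) h1),
    Real.le_logb_iff_rpow_le (by norm_num) (by positivity), Real.rpow_natCast, one_div_pow,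
    le_one_div (by positivity) hpos]

theorem half_pow_lt_of_discLevel (z : DiscPt) :
    (1 / 2 : ℝ) ^ discLevel z / 2 < 1 - ‖(z : ℂ)‖ := by
  have := (le_discLevel_iff (k := discLevel z + 1) (z := z)).not.mp (by omega)
  rw [pow_succ] at this
  linarith

theorem measurable_discLevel : Measurable discLevel := by
  refine Nat.measurable_floor.comp ?_
  unfold Real.logb
  exact (Real.measurable_log.comp (by fun_prop)).div_const _

/-- The Carleson boxes of the dyadic decomposition of the disc. -/
abbrev discBox (k j : ℕ) : Set DiscPt := levelBox discLevel (fun k z => arcIndex k (z : ℂ)) k j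

/-- The dyadic arcs, as intervals of angles. -/
def dyadicArc (k j : ℕ) : Set ℝ :=
  Set.Ioc (Real.pi - 2 * Real.pi * ((j + 1) / 2 ^ k)) (Real.pi - 2 * Real.pi * (j / 2 ^ k))

theorem volume_dyadicArc (k j : ℕ) :
    volume (dyadicArc k j) = ENNReal.ofReal (2 * Real.pi * (1 / 2) ^ k) := by
  rw [dyadicArc, Real.volume_Ioc]
  congr 1
  rw [one_div_pow]
  ring

theorem isArc_dyadicArc (k j : ℕ) : IsArc (dyadicArc k j) := by
  have hπ := Real.pi_pos
  refine ⟨Set.ordConnected_Ioc, ?_, ?_⟩ <;> rw [volume_dyadicArc]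
  · simp only [ENNReal.ofReal_pos]; positivity
  · refine ENNReal.ofReal_le_ofReal (mul_le_of_le_one_right (by positivity) ?_)
    exact pow_le_one₀ (by norm_num) (by norm_num)

theorem arcLength_dyadicArc (k j : ℕ) : arcLength (dyadicArc k j) = (1 / 2) ^ k := by
  have hπ := Real.pi_pos
  rw [arcLength, volume_dyadicArc, ENNReal.toReal_ofReal (by positivity)]
  field_simp

theorem discBox_subset_carlesonSquare (k j : ℕ) : discBox k j ⊆ carlesonSquare (dyadicArc k j) := by
  rintro z ⟨h1, h2⟩
  have hπ := Real.pi_pos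
  refine ⟨‖(z : ℂ)‖, (z : ℂ).arg, ?_, ?_, z.norm_lt_one,
    (Complex.norm_mul_exp_arg_mul_I (z : ℂ)).symm⟩
  · obtain ⟨e1, e2⟩ := arcIndex_eq_iff.mp h2
    have hP : (0 : ℝ) < 2 ^ k := by positivity
    have e3 : (j : ℝ) / 2 ^ k ≤ (Real.pi - (z : ℂ).arg) / (2 * Real.pi) := by
      rw [div_le_iff₀ hP]; linarith
    have e4 : (Real.pi - (z : ℂ).arg) / (2 * Real.pi) < (j + 1) / 2 ^ k := by
      rw [lt_div_iff₀ hP]; linarith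
    rw [le_div_iff₀ (by positivity)] at e3
    rw [div_lt_iff₀ (by positivity)] at e4
    constructor <;> linarith
  · rw [arcLength_dyadicArc]
    linarith [le_discLevel_iff.mp h1]

theorem ENNReal.sum_rpow_le_sum_rpow {ι : Type*} {s : ℝ} (hs : 0 < s) (hs1 : s ≤ 1)
    (F : Finset ι) (f : ι → ℝ≥0∞) : (∑ i ∈ F, f i) ^ s ≤ ∑ i ∈ F, f i ^ s := by
  classical
  induction F using Finset.induction_on with
  | empty => simp [hs]
  | insert i F hi ih =>
    rw [Finset.sum_insert hi, Finset.sum_insert hi]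
    exact (ENNReal.rpow_add_le_add_rpow _ _ hs.le hs1).trans (add_le_add_right ih _)

theorem ENNReal.exists_pos_ofReal_mul_le {Y ε : ℝ≥0∞} (hY : Y ≠ ∞) (hε : 0 < ε) :
    ∃ t : ℝ, 0 < t ∧ ENNReal.ofReal t * Y ≤ ε := by
  have ht : Tendsto (fun t : ℝ => ENNReal.ofReal t * Y) (𝓝[>] 0) (𝓝 (ENNReal.ofReal 0 * Y)) :=
    ENNReal.Tendsto.mul_const ((ENNReal.continuous_ofReal.tendsto 0).mono_left nhdsWithin_le_nhds)
      (Or.inr hY)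
  rw [ENNReal.ofReal_zero, zero_mul] at ht
  obtain ⟨t, h1, h2⟩ := ((ENNReal.tendsto_nhds_zero.mp ht ε hε).and self_mem_nhdsWithin).exists
  exact ⟨t, h2, h1⟩

/-- The oscillation of `f` between a point and an inner circle is bounded by the sum of the
coefficients of the boxes above the point. -/
theorem norm_sub_radial_le {f : ℂ → ℂ} (hf : DifferentiableOn ℂ f unitDiscSet) {K : ℕ} (hK : 1 ≤ K)
    {z : DiscPt} (hz : 1 - (1 / 2 : ℝ) ^ K ≤ ‖(z : ℂ)‖) :
    ENNReal.ofReal ‖f z - f ((1 - (1 / 2) ^ K : ℝ) * ((z : ℂ) / (‖(z : ℂ)‖ : ℂ)))‖ ≤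
      ∑ k ∈ Finset.Icc K (discLevel z), boxCoeff f k (arcIndex k z) := by
  have hKhalf : (1 / 2 : ℝ) ^ K ≤ 1 / 2 := by
    simpa using pow_le_pow_of_le_one (by norm_num : (0 : ℝ) ≤ 1 / 2) (by norm_num) hK
  have hz0 : 0 < ‖(z : ℂ)‖ := by linarith
  have hzc : (‖(z : ℂ)‖ : ℂ) ≠ 0 := by exact_mod_cast hz0.ne'
  have hu : ‖(z : ℂ) / (‖(z : ℂ)‖ : ℂ)‖ = 1 := by
    rw [norm_div, Complex.norm_real, Real.norm_eq_abs, abs_of_pos hz0, div_self hz0.ne']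
  have hru : (‖(z : ℂ)‖ : ℂ) * ((z : ℂ) / (‖(z : ℂ)‖ : ℂ)) = z := mul_div_cancel₀ _ hzc
  have hKn : K ≤ discLevel z := le_discLevel_iff.mpr (by linarith)
  have key := norm_sub_le_sum_boxCoeff hf hu hK hKn (half_pow_lt_of_discLevel z).le
    (le_discLevel_iff.mp le_rfl)
  rw [hru] at key
  refine key.trans (le_of_eq (Finset.sum_congr rfl fun k _ => ?_))
  conv_rhs => rw [← hru, arcIndex_real_mul k hz0]

/-- The tree theorem needs an exponent above 1, while p may be small. Replacing each coefficient b
by b^{p/P} leaves the energy unchanged, and (∑ b)^{p/P} ≤ ∑ b^{p/P}, so L^q becomes L^Q with Q =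
qP/p. The hypothesis `hGw` matches the tree weights with those of the Dirichlet integral. -/
theorem tailEstimate_of_boxes {p α q P : ℝ} (hp : 0 < p) (hpq : p < q) (hP : 1 < P) (hpP : p ≤ P)
    {μ : Measure DiscPt} [IsFiniteMeasure μ] {G : ℕ → ℝ} (hG : ∀ k, 0 < G k)
    (hGw : ∀ k, G k ^ (-(P - 1)) = ((1 / 2 : ℝ) ^ k) ^ (α + 2 - p))
    (hμ : ∀ ε : ℝ, 0 < ε → ∃ K : ℕ, ∀ k, K ≤ k → ∀ j, μ (discBox k j) ≤ ENNReal.ofReal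
      (ε * (∑ i ∈ Finset.range (k + 1), G i) ^ (-(q * P / p * (1 - 1 / P))))) :
    TailEstimate p α q μ := by
  intro M hM ε₀ hε₀
  have hP0 : 0 < P := by linarith
  have hq : 0 < q := hp.trans hpq
  set Q := q * P / p with hQ
  have hPQ : P < Q := by rw [hQ, lt_div_iff₀ hp]; nlinarith
  have hQ0 : 0 < Q := hP0.trans hPQ
  have hQP : 0 < Q - P := by linarith
  obtain ⟨C, hC, hC'⟩ := exists_tsum_boxCoeff_le hp α
  set c : ℝ := 4 ^ Q * (Q / (Q - P)) ^ (Q * (1 - 1 / P)) with hc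
  have hc0 : 0 < c := by positivity
  obtain ⟨ε, hε, hεle⟩ := ENNReal.exists_pos_ofReal_mul_le
    (Y := ENNReal.ofReal c * (ENNReal.ofReal C * M) ^ (Q / P))
    (ENNReal.mul_ne_top ENNReal.ofReal_ne_top (ENNReal.rpow_lt_top_of_nonneg (by positivity)
      (ENNReal.mul_ne_top ENNReal.ofReal_ne_top hM)).ne) hε₀
  obtain ⟨K₀, hK₀⟩ := hμ ε hε
  set K := max K₀ 1 with hK
  refine ⟨K, le_max_right _ _, fun f hf hfM => ?_⟩
  -- Dropping the generations below `K` means that the box condition, with its small constant, is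
  -- needed only from `K` on.
  set a : ℕ → ℕ → ℝ≥0∞ := fun k j => if K ≤ k then boxCoeff f k j ^ (p / P) else 0 with ha
  have hE : boxEnergy P G a ≤ ENNReal.ofReal C * M := by
    refine le_trans ?_ ((hC' f hf).trans (mul_le_mul_right hfM _))
    refine ENNReal.tsum_le_tsum fun i => ?_
    rw [hGw]
    refine mul_le_mul_left ?_ _
    simp only [ha]
    split_ifs
    · rw [← ENNReal.rpow_mul, div_mul_cancel₀ _ hP0.ne']
    · rw [ENNReal.zero_rpow_of_pos hP0]; exact zero_le
  have hAm := measurableSet_outerAnnulus (1 - (1 / 2 : ℝ) ^ K)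
  calc _ ≤ ∫⁻ z in {z : DiscPt | 1 - (1 / 2 : ℝ) ^ K ≤ ‖(z : ℂ)‖},
        boxSum (levelBox discLevel (fun k z => arcIndex k (z : ℂ))) a z ^ Q ∂μ := by
        refine setLIntegral_mono_ae' hAm (Eventually.of_forall fun z hz => ?_)
        rw [boxSum_levelBox]
        have h1 := norm_sub_radial_le hf (le_max_right _ _) hz
        have h2 : ∑ k ∈ Finset.range (discLevel z + 1), a k (arcIndex k z) =
            ∑ k ∈ Finset.Icc K (discLevel z), boxCoeff f k (arcIndex k z) ^ (p / P) := by
          simp only [ha]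
          rw [← Finset.sum_filter]
          refine Finset.sum_congr ?_ fun _ _ => rfl
          ext k
          simp only [Finset.mem_filter, Finset.mem_range, Finset.mem_Icc]
          omega
        rw [h2]
        calc _ ≤ (∑ k ∈ Finset.Icc K (discLevel z), boxCoeff f k (arcIndex k z)) ^ q :=
              ENNReal.rpow_le_rpow h1 hq.le
          _ = ((∑ k ∈ Finset.Icc K (discLevel z), boxCoeff f k (arcIndex k z)) ^ (p / P)) ^ Q := by
              rw [← ENNReal.rpow_mul]; congr 1; rw [hQ]; field_simp
          _ ≤ _ := by
              refine ENNReal.rpow_le_rpow (ENNReal.sum_rpow_le_sum_rpow (by positivity) ?_ _ _) hQ0.le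
              rwa [div_le_one hP0]
    _ ≤ ∫⁻ z, boxSum (levelBox discLevel (fun k z => arcIndex k (z : ℂ))) a z ^ Q ∂μ :=
        setLIntegral_le_lintegral _ _
    _ ≤ ENNReal.ofReal (c * ε) * boxEnergy P G a ^ (Q / P) := by
        refine lintegral_boxSum_rpow_le (K := K) measurable_discLevel
          (fun k => (measurable_arcIndex k).comp measurable_subtype_coe)
          (fun k z => arcIndex_succ_div_two k z) hP hPQ hG hε
          (fun k hk j => hK₀ k ((le_max_left _ 1).trans hk) j) (fun k hk j => ?_)
        simp only [ha, not_le.mpr hk, if_false]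
    _ ≤ ENNReal.ofReal (c * ε) * (ENNReal.ofReal C * M) ^ (Q / P) :=
        mul_le_mul_right (ENNReal.rpow_le_rpow hE (by positivity)) _
    _ = ENNReal.ofReal ε * (ENNReal.ofReal c * (ENNReal.ofReal C * M) ^ (Q / P)) := by
        rw [ENNReal.ofReal_mul hc0.le]; ring
    _ ≤ ε₀ := hεle

theorem CarlesonLittleO.exists_discBox_le {μ : Measure DiscPt} {h : ℝ → ℝ}
    (hμ : CarlesonLittleO μ h) {ε : ℝ} (hε : 0 < ε) :
    ∃ K : ℕ, ∀ k, K ≤ k → ∀ j, μ (discBox k j) ≤ ENNReal.ofReal (ε * h ((1 / 2) ^ k)) := by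
  obtain ⟨δ, hδ, H⟩ := hμ ε hε
  obtain ⟨K, hK⟩ := exists_pow_lt_of_lt_one hδ (by norm_num : (1 / 2 : ℝ) < 1)
  refine ⟨K, fun k hk j => ?_⟩
  have h1 := H _ (isArc_dyadicArc k j) (by
    rw [arcLength_dyadicArc]
    exact (pow_le_pow_of_le_one (by norm_num) (by norm_num) hk).trans_lt hK)
  rw [arcLength_dyadicArc] at h1
  exact (measure_mono (discBox_subset_carlesonSquare k j)).trans h1

/-- One generation has finitely many boxes, each of finite measure, and they cover the complement of
a compact disc. -/
theorem CarlesonLittleO.isFiniteMeasure {μ : Measure DiscPt} [IsLocallyFiniteMeasure μ] {h : ℝ → ℝ}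
    (hμ : CarlesonLittleO μ h) : IsFiniteMeasure μ := by
  obtain ⟨K, hK⟩ := hμ.exists_discBox_le one_pos
  have hcpt : IsCompact {z : DiscPt | ‖(z : ℂ)‖ ≤ 1 - (1 / 2) ^ K} := by
    rw [Subtype.isCompact_iff]
    convert isCompact_closedBall (0 : ℂ) (1 - (1 / 2) ^ K) using 1
    ext z
    constructor
    · rintro ⟨w, hw, rfl⟩
      simpa using hw
    · intro hz
      exact ⟨⟨z, norm_le_one_sub_subset K hz⟩, by simpa using hz, rfl⟩
  refine ⟨?_⟩
  have hcover : (Set.univ : Set DiscPt) ⊆ {z : DiscPt | ‖(z : ℂ)‖ ≤ 1 - (1 / 2) ^ K} ∪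
      ⋃ j ∈ Finset.range (2 ^ K), discBox K j := by
    intro z _
    by_cases hz : ‖(z : ℂ)‖ ≤ 1 - (1 / 2 : ℝ) ^ K
    · exact Or.inl hz
    · refine Or.inr (Set.mem_iUnion₂.mpr ⟨arcIndex K z, Finset.mem_range.mpr (arcIndex_lt K z), ?_, rfl⟩)
      exact le_discLevel_iff.mpr (by linarith)
  refine (measure_mono hcover).trans_lt ((measure_union_le _ _).trans_lt
    (ENNReal.add_lt_top.mpr ⟨hcpt.measure_lt_top, ?_⟩))
  refine (measure_biUnion_finset_le _ _).trans_lt (ENNReal.sum_lt_top.mpr fun j _ => ?_)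
  exact (hK K le_rfl j).trans_lt ENNReal.ofReal_lt_top

/-! ### The tail estimate in the three regimes. -/

theorem tailEstimate_of_vanishingCarleson {p q α : ℝ} (hp : 0 < p) (hpq : p < q) (hpα : p < α + 2)
    {μ : Measure DiscPt} [IsFiniteMeasure μ]
    (h : IsVanishingCarleson (q * (α + 2 - p) / p) μ) : TailEstimate p α q μ := by
  have hq : 0 < q := hp.trans hpq
  have hβ : 0 < α + 2 - p := by linarith
  set ρ : ℝ := 2 ^ ((α + 2 - p) / p) with hρ
  have hρ1 : 1 < ρ := Real.one_lt_rpow (by norm_num) (by positivity)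
  have hρ0 : 0 < ρ := by linarith
  have hpow : ∀ (k : ℕ) (s : ℝ), (ρ ^ k) ^ (-s) = ((1 / 2 : ℝ) ^ k) ^ ((α + 2 - p) / p * s) := by
    intro k s
    rw [hρ, ← Real.rpow_natCast, ← Real.rpow_natCast, ← Real.rpow_mul (by positivity),
      ← Real.rpow_mul (by positivity), ← Real.rpow_mul (by positivity), one_div,
      Real.inv_rpow (by norm_num), ← Real.rpow_neg (by norm_num)]
    congr 1; ring
  -- For P = p + 1 the dual weights are the powers of ρ = 2^{(α+2-p)/p}, and the exponent Q(1 - 1/P)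
  -- equals q.
  refine tailEstimate_of_boxes (P := p + 1) (G := fun k => ρ ^ k) hp hpq (by linarith) (by linarith)
    (fun k => by positivity) (fun k => ?_) (fun ε hε => ?_)
  · rw [hpow]; congr 1; field_simp; ring
  · set c : ℝ := (ρ / (ρ - 1)) ^ (-q) with hc
    have hρ1' : 0 < ρ - 1 := by linarith
    have hc0 : 0 < c := by positivity
    obtain ⟨K, hK⟩ := CarlesonLittleO.exists_discBox_le h (ε := ε * c) (by positivity)
    refine ⟨K, fun k hk j => (hK k hk j).trans (ENNReal.ofReal_le_ofReal ?_)⟩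
    have e1 : q * (p + 1) / p * (1 - 1 / (p + 1)) = q := by field_simp; ring
    rw [e1, mul_assoc]
    refine mul_le_mul_of_nonneg_left ?_ hε.le
    have e2 : ((1 / 2 : ℝ) ^ k) ^ (q * (α + 2 - p) / p) = (ρ ^ k) ^ (-q) := by
      rw [hpow]; congr 1; ring
    rw [e2, hc, ← Real.mul_rpow (by positivity) (by positivity)]
    refine Real.rpow_le_rpow_of_nonpos (Finset.sum_pos (fun i _ => by positivity) (by simp)) ?_
      (by linarith)
    rw [geom_sum_eq hρ1.ne', div_mul_eq_mul_div]
    refine div_le_div_of_nonneg_right ?_ hρ1'.le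
    rw [pow_succ]; linarith

/-- At p = α + 2 the weights are constant, so their partial sums k + 1 are comparable to
log(1/2^{-k}) = k log 2. As p > 1 here, P = p is allowed. -/
theorem tailEstimate_of_logCarleson {p q α : ℝ} (hpq : p < q) (hα : -1 < α) (hpα : p = α + 2)
    {μ : Measure DiscPt} [IsFiniteMeasure μ]
    (h : CarlesonLittleO μ (fun t => Real.log (1 / t) ^ ((1 / p - 1) * q))) :
    TailEstimate p α q μ := by
  have hp1 : 1 < p := by linarith
  have hp : 0 < p := by linarith
  have hq : 0 < q := hp.trans hpq
  refine tailEstimate_of_boxes (P := p) (G := fun _ => 1) hp hpq hp1 le_rfl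
    (fun k => one_pos) (fun k => ?_) (fun ε hε => ?_)
  · rw [Real.one_rpow, hpα, sub_self, Real.rpow_zero]
  · have hlog : 0 < Real.log 2 := Real.log_pos (by norm_num)
    have he : (1 / p - 1) * q ≤ 0 := by
      have : 1 / p ≤ 1 := by rw [div_le_one hp]; exact hp1.le
      nlinarith
    set c : ℝ := (2 / Real.log 2) ^ ((1 / p - 1) * q) with hc
    have hc0 : 0 < c := by positivity
    obtain ⟨K, hK⟩ := h.exists_discBox_le (ε := ε * c) (by positivity)
    -- For k ≥ 1 one has k + 1 ≤ 2k, which explains the 2 in `c`; at k = 0 the logarithm vanishes.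
    refine ⟨max K 1, fun k hk j => (hK k ((le_max_left _ _).trans hk) j).trans
      (ENNReal.ofReal_le_ofReal ?_)⟩
    have hk1 : (1 : ℝ) ≤ k := by exact_mod_cast (le_max_right _ _).trans hk
    have e1 : -(q * p / p * (1 - 1 / p)) = (1 / p - 1) * q := by field_simp; ring
    have e2 : Real.log (1 / (1 / 2) ^ k) = k * Real.log 2 := by
      rw [one_div_pow, one_div_one_div, Real.log_pow]
    rw [e1, e2, mul_assoc]
    refine mul_le_mul_of_nonneg_left ?_ hε.le
    rw [hc, ← Real.mul_rpow (by positivity) (by positivity)]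
    refine Real.rpow_le_rpow_of_nonpos (by simp; positivity) ?_ he
    have e3 : 2 / Real.log 2 * (k * Real.log 2) = 2 * k := by field_simp
    rw [e3]
    simp
    linarith

/-- The energy bound for a single box already gives coefficients of size ρ^k with ρ < 1. The
oscillation beyond generation K is thus uniformly of order ρ^K, and no tree embedding is needed. -/
theorem tailEstimate_of_isFiniteMeasure {p q α : ℝ} (hp : 0 < p) (hq : 0 < q) (hpα : α + 2 < p)
    {μ : Measure DiscPt} [IsFiniteMeasure μ] : TailEstimate p α q μ := by
  intro M hM ε₀ hε₀
  obtain ⟨C, hC, hC'⟩ := exists_tsum_boxCoeff_le hp α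
  set τ : ℝ := (p - α - 2) / p with hτ
  have hτ0 : 0 < τ := div_pos (by linarith) hp
  set ρ : ℝ := (1 / 2) ^ τ with hρ
  have hρ0 : 0 < ρ := by positivity
  have hρ1 : ρ < 1 := Real.rpow_lt_one (by norm_num) (by norm_num) hτ0
  have hρ1' : 0 < 1 - ρ := by linarith
  set A := (ENNReal.ofReal C * M) ^ (1 / p) with hA
  have hAfin : A ≠ ∞ := (ENNReal.rpow_lt_top_of_nonneg (by positivity)
    (ENNReal.mul_ne_top ENNReal.ofReal_ne_top hM)).ne
  have hcoeff : ∀ f : ℂ → ℂ, DifferentiableOn ℂ f unitDiscSet → dirichletEnergy p α f ≤ M →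
      ∀ k j, boxCoeff f k j ≤ ENNReal.ofReal (ρ ^ k) * A := by
    intro f hf hfM k j
    have h1 := (ENNReal.le_tsum (f := fun i : ℕ × ℕ => boxCoeff f i.1 i.2 ^ p *
      ENNReal.ofReal (((1 / 2 : ℝ) ^ i.1) ^ (α + 2 - p))) (k, j)).trans
      ((hC' f hf).trans (mul_le_mul_right hfM _))
    have ht : (0 : ℝ) < (1 / 2) ^ k := by positivity
    have e : ENNReal.ofReal (ρ ^ k) ^ p * ENNReal.ofReal (((1 / 2 : ℝ) ^ k) ^ (α + 2 - p)) = 1 := by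
      have : (ρ ^ k : ℝ) = ((1 / 2 : ℝ) ^ k) ^ τ := by
        rw [hρ, ← Real.rpow_natCast, ← Real.rpow_natCast, ← Real.rpow_mul (by norm_num),
          ← Real.rpow_mul (by norm_num), mul_comm]
      rw [this, ENNReal.ofReal_rpow_of_pos (by positivity), ← ENNReal.ofReal_mul (by positivity),
        ← Real.rpow_mul ht.le, ← Real.rpow_add ht, hτ,
        show (p - α - 2) / p * p + (α + 2 - p) = 0 by field_simp; ring, Real.rpow_zero,
        ENNReal.ofReal_one]
    have h2 : boxCoeff f k j ^ p ≤ (ENNReal.ofReal (ρ ^ k) * A) ^ p := by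
      calc boxCoeff f k j ^ p = ENNReal.ofReal (ρ ^ k) ^ p * (boxCoeff f k j ^ p *
            ENNReal.ofReal (((1 / 2 : ℝ) ^ k) ^ (α + 2 - p))) := by
            rw [mul_left_comm, e, mul_one]
        _ ≤ ENNReal.ofReal (ρ ^ k) ^ p * (ENNReal.ofReal C * M) := mul_le_mul_right h1 _
        _ = _ := by
            rw [ENNReal.mul_rpow_of_nonneg _ _ hp.le, hA, ← ENNReal.rpow_mul,
              one_div_mul_cancel hp.ne', ENNReal.rpow_one]
    exact (ENNReal.rpow_le_rpow_iff hp).mp h2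
  have hsum : ∀ K n : ℕ, ∑ k ∈ Finset.Icc K n, ρ ^ k ≤ ρ ^ K / (1 - ρ) := by
    intro K n
    rw [← Finset.Ico_add_one_right_eq_Icc]
    exact geom_sum_Ico_le_of_lt_one hρ0.le hρ1
  obtain ⟨t, ht, htle⟩ := ENNReal.exists_pos_ofReal_mul_le (Y := A ^ q * μ Set.univ)
    (ENNReal.mul_ne_top (ENNReal.rpow_lt_top_of_nonneg hq.le hAfin).ne (measure_ne_top _ _)) hε₀
  obtain ⟨K₀, hK₀⟩ := exists_pow_lt_of_lt_one (show 0 < t ^ (1 / q) * (1 - ρ) by positivity) hρ1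
  refine ⟨max K₀ 1, le_max_right _ _, fun f hf hfM => ?_⟩
  set K := max K₀ 1
  have hK : ρ ^ K / (1 - ρ) ≤ t ^ (1 / q) := by
    rw [div_le_iff₀ hρ1']
    exact (pow_le_pow_of_le_one hρ0.le hρ1.le (le_max_left _ _)).trans hK₀.le
  calc _ ≤ ∫⁻ _ in {z : DiscPt | 1 - (1 / 2 : ℝ) ^ K ≤ ‖(z : ℂ)‖},
        (ENNReal.ofReal (t ^ (1 / q)) * A) ^ q ∂μ := by
        refine setLIntegral_mono_ae' (measurableSet_outerAnnulus _)
          (Eventually.of_forall fun z hz => ENNReal.rpow_le_rpow ?_ hq.le)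
        refine (norm_sub_radial_le hf (le_max_right _ _) hz).trans ?_
        refine (Finset.sum_le_sum fun k _ => hcoeff f hf hfM k _).trans ?_
        rw [← Finset.sum_mul, ← ENNReal.ofReal_sum_of_nonneg fun k _ => by positivity]
        exact mul_le_mul_left (ENNReal.ofReal_le_ofReal ((hsum _ _).trans hK)) _
    _ ≤ (ENNReal.ofReal (t ^ (1 / q)) * A) ^ q * μ Set.univ := by
        rw [setLIntegral_const]
        exact mul_le_mul_right (measure_mono (Set.subset_univ _)) _
    _ = ENNReal.ofReal t * (A ^ q * μ Set.univ) := by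
        rw [ENNReal.mul_rpow_of_nonneg _ _ hq.le, ENNReal.ofReal_rpow_of_pos (by positivity),
          ← Real.rpow_mul ht.le, one_div_mul_cancel hq.ne', Real.rpow_one, mul_assoc]
    _ ≤ ε₀ := htle

/-! ### Integrals of powers of |1 - (1-δ)vz|. -/

theorem norm_one_sub_mul_exp_sq (x θ : ℝ) :
    ‖1 - (x : ℂ) * (Real.cos θ + Real.sin θ * Complex.I)‖ ^ 2 =
      (1 - x) ^ 2 + 2 * x * (1 - Real.cos θ) := by
  rw [← Complex.normSq_eq_norm_sq, Complex.normSq_apply]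
  simp only [Complex.sub_re, Complex.one_re, Complex.mul_re, Complex.ofReal_re, Complex.add_re,
    Complex.I_re, Complex.ofReal_im, Complex.I_im, Complex.add_im, Complex.mul_im, Complex.sub_im,
    Complex.one_im]
  linear_combination x ^ 2 * (Real.sin_sq_add_cos_sq θ)

theorem abs_le_norm_one_sub_mul_exp {x θ : ℝ} (hx : 0 ≤ x) (hx1 : x ≤ 1)
    (hθ : |θ| ≤ Real.pi) :
    |θ| ≤ 2 * Real.pi * ‖1 - (x : ℂ) * (Real.cos θ + Real.sin θ * Complex.I)‖ := by
  have hπ := Real.pi_pos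
  have hcos := Real.cos_le_one_sub_mul_cos_sq hθ
  have hsq := norm_one_sub_mul_exp_sq x θ
  set n := ‖1 - (x : ℂ) * (Real.cos θ + Real.sin θ * Complex.I)‖
  have h1 : 2 / Real.pi ^ 2 * θ ^ 2 ≤ 1 - Real.cos θ := by linarith
  have h0 : 0 ≤ 2 / Real.pi ^ 2 * θ ^ 2 := by positivity
  have hθ2 : θ ^ 2 ≤ Real.pi ^ 2 := by rw [← sq_abs]; exact pow_le_pow_left₀ (abs_nonneg _) hθ 2
  have key : θ ^ 2 / (4 * Real.pi ^ 2) ≤ n ^ 2 := by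
    rw [hsq]
    -- For x ≤ 1/2 the distance to 1 is at least 1/2 and |θ| ≤ π suffices. For x ≥ 1/2 the cosine
    -- term dominates.
    rcases le_total x (1 / 2) with h | h
    · have h2 : θ ^ 2 / (4 * Real.pi ^ 2) ≤ 1 / 4 := by
        rw [div_le_div_iff₀ (by positivity) (by norm_num)]; linarith
      have h3 : 0 ≤ 2 * x * (1 - Real.cos θ) := mul_nonneg (by linarith) (by linarith)
      nlinarith
    · have h2 : θ ^ 2 / (4 * Real.pi ^ 2) ≤ 2 / Real.pi ^ 2 * θ ^ 2 := by
        rw [div_mul_eq_mul_div, div_le_div_iff₀ (by positivity) (by positivity)]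
        nlinarith [sq_nonneg θ, sq_nonneg Real.pi, mul_nonneg (sq_nonneg θ) (sq_nonneg Real.pi)]
      have h3 : 1 * (1 - Real.cos θ) ≤ 2 * x * (1 - Real.cos θ) :=
        mul_le_mul_of_nonneg_right (by linarith) (by linarith)
      nlinarith [sq_nonneg (1 - x)]
  have h4 : |θ| ^ 2 ≤ (2 * Real.pi * n) ^ 2 := by
    rw [div_le_iff₀ (by positivity)] at key
    rw [sq_abs]; nlinarith
  exact (sq_le_sq₀ (abs_nonneg _) (by positivity)).mp h4

theorem one_sub_le_norm_one_sub_mul_exp {x θ : ℝ} (hx : 0 ≤ x) :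
    1 - x ≤ ‖1 - (x : ℂ) * (Real.cos θ + Real.sin θ * Complex.I)‖ := by
  have hsq := norm_one_sub_mul_exp_sq x θ
  have h3 : 0 ≤ 2 * x * (1 - Real.cos θ) := mul_nonneg (by linarith) (by linarith [Real.cos_le_one θ])
  exact le_of_sq_le_sq (by linarith) (norm_nonneg _)

theorem lintegral_add_abs_rpow_le {A m : ℝ} (hA : 0 < A) (hm : 1 < m) (S : Set ℝ) :
    ∫⁻ θ in S, ENNReal.ofReal ((A + |θ|) ^ (-m)) ≤ ENNReal.ofReal (2 / (m - 1) * A ^ (1 - m)) := by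
  have hm' : 0 < m - 1 := by linarith
  have hpos : ∫⁻ θ in Set.Ioi (0 : ℝ), ENNReal.ofReal ((A + |θ|) ^ (-m)) =
      ENNReal.ofReal (A ^ (1 - m) / (m - 1)) := by
    have h1 : ∫⁻ θ in Set.Ioi (0 : ℝ), ENNReal.ofReal ((A + |θ|) ^ (-m)) =
        ∫⁻ θ in (fun θ => A + θ) ⁻¹' Set.Ioi A, ENNReal.ofReal ((A + θ) ^ (-m)) := by
      have : (fun θ => A + θ) ⁻¹' Set.Ioi A = Set.Ioi (0 : ℝ) := by ext; simp
      rw [this]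
      refine setLIntegral_congr_fun measurableSet_Ioi fun θ hθ => ?_
      simp only [abs_of_pos (show (0 : ℝ) < θ from hθ)]
    rw [h1, (measurePreserving_add_left volume A).setLIntegral_comp_preimage_emb
      (measurableEmbedding_addLeft A) (fun u => ENNReal.ofReal (u ^ (-m))) (Set.Ioi A),
      ← ofReal_integral_eq_lintegral_ofReal]
    · rw [integral_Ioi_rpow_of_lt (by linarith) hA]
      congr 1
      rw [show -m + 1 = -(m - 1) by ring, neg_div_neg_eq]
      congr 2; ring
    · exact integrableOn_Ioi_rpow_of_lt (by linarith) hA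
    · filter_upwards [ae_restrict_mem measurableSet_Ioi] with u hu
      have : 0 < u := hA.trans hu
      positivity
  have hneg : ∫⁻ θ in Set.Iio (0 : ℝ), ENNReal.ofReal ((A + |θ|) ^ (-m)) =
      ENNReal.ofReal (A ^ (1 - m) / (m - 1)) := by
    rw [← hpos]
    have := (Measure.measurePreserving_neg (volume : Measure ℝ)).setLIntegral_comp_preimage_emb
      (MeasurableEquiv.neg ℝ).measurableEmbedding (fun θ => ENNReal.ofReal ((A + |θ|) ^ (-m)))
      (Set.Ioi 0)
    rw [← this]
    simp
  calc _ ≤ ∫⁻ θ, ENNReal.ofReal ((A + |θ|) ^ (-m)) := setLIntegral_le_lintegral _ _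
    _ = (∫⁻ θ in Set.Ioi (0 : ℝ), ENNReal.ofReal ((A + |θ|) ^ (-m))) +
        ∫⁻ θ in Set.Iio (0 : ℝ), ENNReal.ofReal ((A + |θ|) ^ (-m)) := by
        rw [← lintegral_add_compl _ (measurableSet_Ioi (a := (0 : ℝ))), Set.compl_Ioi,
          setLIntegral_congr Iio_ae_eq_Iic]
    _ = _ := by
        rw [hpos, hneg, ← ENNReal.ofReal_add (by positivity) (by positivity)]
        congr 1; ring

/-- The kernel integral over the disc is controlled by an integral over the radius. -/
theorem exists_lintegral_kernel_le {α m : ℝ} (hm : 1 < m) :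
    ∃ C : ℝ, 0 < C ∧ ∀ δ : ℝ, 0 < δ → δ ≤ 1 →
      ∫⁻ z in unitDiscSet, ENNReal.ofReal ((1 - ‖z‖ ^ 2) ^ α * ‖1 - ((1 - δ : ℝ) : ℂ) * z‖ ^ (-m)) ≤
        ENNReal.ofReal C * ∫⁻ x in Set.Ioo (0 : ℝ) 1, ENNReal.ofReal (x ^ α * (δ + x) ^ (1 - m)) := by
  have hπ := Real.pi_pos
  have hm' : 0 < m - 1 := by linarith
  set b : ℝ := 2 + 2 * Real.pi with hb
  have hb0 : 0 < b := by positivity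
  refine ⟨2 ^ |α| * b ^ m * (2 / (m - 1)), by positivity, fun δ hδ hδ1 => ?_⟩
  set F : ℂ → ℝ≥0∞ := fun z =>
    ENNReal.ofReal ((1 - ‖z‖ ^ 2) ^ α * ‖1 - ((1 - δ : ℝ) : ℂ) * z‖ ^ (-m)) with hF
  set g : ℝ × ℝ → ℝ≥0∞ := fun P => ENNReal.ofReal (2 ^ |α| * b ^ m * (1 - P.1) ^ α) *
    ENNReal.ofReal ((δ + (1 - P.1) + |P.2|) ^ (-m)) with hg
  have hgm : Measurable g := by rw [hg]; fun_prop
  have hpt : ∀ P ∈ polarCoord.target, ENNReal.ofReal P.1 •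
      unitDiscSet.indicator F (Complex.polarCoord.symm P) ≤
        (Set.Ioo (0 : ℝ) 1 ×ˢ Set.Ioo (-Real.pi) Real.pi).indicator g P := by
    rintro ⟨r, θ⟩ hP
    rw [polarCoord_target] at hP
    have hr : 0 < r := hP.1
    have hθ : |θ| ≤ Real.pi := abs_le.mpr ⟨hP.2.1.le, hP.2.2.le⟩
    have hnorm : ‖Complex.polarCoord.symm (r, θ)‖ = r := by
      rw [Complex.norm_polarCoord_symm, abs_of_pos hr]
    by_cases hr1 : r < 1
    swap
    · rw [Set.indicator_of_notMem (by rw [Metric.mem_ball, dist_zero_right, hnorm]; exact hr1)]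
      simp
    rw [Set.indicator_of_mem (by rw [Metric.mem_ball, dist_zero_right, hnorm]; exact hr1),
      Set.indicator_of_mem (show (r, θ) ∈ Set.Ioo (0 : ℝ) 1 ×ˢ Set.Ioo (-Real.pi) Real.pi from ⟨⟨hr, hr1⟩, hP.2⟩), smul_eq_mul]
    refine (mul_le_of_le_one_left zero_le (ENNReal.ofReal_le_one.mpr hr1.le)).trans ?_
    simp only [hF, hg]
    rw [← ENNReal.ofReal_mul (mul_nonneg (by positivity) (Real.rpow_nonneg (by linarith) _)), hnorm]
    refine ENNReal.ofReal_le_ofReal ?_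
    have hx0 : 0 ≤ (1 - δ) * r := mul_nonneg (by linarith) hr.le
    have e : 1 - ((1 - δ : ℝ) : ℂ) * Complex.polarCoord.symm (r, θ) =
        1 - (((1 - δ) * r : ℝ) : ℂ) * (Real.cos θ + Real.sin θ * Complex.I) := by
      rw [Complex.polarCoord_symm_apply]; push_cast; ring
    rw [e]
    have h1 := abs_le_norm_one_sub_mul_exp hx0 (by nlinarith) hθ
    have h2 := one_sub_le_norm_one_sub_mul_exp (θ := θ) hx0
    set n := ‖1 - (((1 - δ) * r : ℝ) : ℂ) * (Real.cos θ + Real.sin θ * Complex.I)‖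
    set A := δ + (1 - r) + |θ| with hA
    have hA0 : 0 < A := by have := abs_nonneg θ; linarith
    -- Both δ and 1 - r are at most 1 - (1-δ)r ≤ n, and |θ| ≤ 2πn; hence b = 2 + 2π.
    have hAn : A ≤ b * n := by
      rw [hA, hb]
      nlinarith
    have hn : n ^ (-m) ≤ b ^ m * A ^ (-m) := by
      have := Real.rpow_le_rpow_of_nonpos (show 0 < A / b by positivity)
        (show A / b ≤ n by rw [div_le_iff₀ hb0]; linarith) (show -m ≤ 0 by linarith)
      refine this.trans (le_of_eq ?_)
      rw [Real.div_rpow hA0.le hb0.le, Real.rpow_neg hb0.le, div_inv_eq_mul, mul_comm]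
    have hw : (1 - r ^ 2) ^ α ≤ 2 ^ |α| * (1 - r) ^ α := by
      rw [show 1 - r ^ 2 = (1 + r) * (1 - r) by ring, Real.mul_rpow (by linarith) (by linarith)]
      refine mul_le_mul_of_nonneg_right ?_ (Real.rpow_nonneg (by linarith) _)
      calc (1 + r) ^ α ≤ (1 + r) ^ |α| := Real.rpow_le_rpow_of_exponent_le (by linarith) (le_abs_self α)
        _ ≤ 2 ^ |α| := Real.rpow_le_rpow (by linarith) (by linarith) (abs_nonneg _)
    calc _ ≤ (2 ^ |α| * (1 - r) ^ α) * (b ^ m * A ^ (-m)) :=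
          mul_le_mul hw hn (by positivity) (mul_nonneg (by positivity) (Real.rpow_nonneg (by linarith) _))
      _ = _ := by ring
  calc ∫⁻ z in unitDiscSet, F z = ∫⁻ P in polarCoord.target, ENNReal.ofReal P.1 •
        unitDiscSet.indicator F (Complex.polarCoord.symm P) := by
        rw [Complex.lintegral_comp_polarCoord_symm, lintegral_indicator measurableSet_ball]
    _ ≤ ∫⁻ P in polarCoord.target,
          (Set.Ioo (0 : ℝ) 1 ×ˢ Set.Ioo (-Real.pi) Real.pi).indicator g P :=
        setLIntegral_mono_ae' (polarCoord.open_target.measurableSet) (Eventually.of_forall hpt)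
    _ ≤ ∫⁻ P in Set.Ioo (0 : ℝ) 1 ×ˢ Set.Ioo (-Real.pi) Real.pi, g P := by
        rw [← lintegral_indicator (measurableSet_Ioo.prod measurableSet_Ioo)]
        exact setLIntegral_le_lintegral _ _
    _ = ∫⁻ r in Set.Ioo (0 : ℝ) 1, ∫⁻ θ in Set.Ioo (-Real.pi) Real.pi, g (r, θ) := by
        rw [Measure.volume_eq_prod, setLIntegral_prod _ hgm.aemeasurable]
    _ ≤ ∫⁻ r in Set.Ioo (0 : ℝ) 1, ENNReal.ofReal (2 ^ |α| * b ^ m * (2 / (m - 1))) *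
          ENNReal.ofReal ((1 - r) ^ α * (δ + (1 - r)) ^ (1 - m)) := by
        refine setLIntegral_mono_ae' measurableSet_Ioo (Eventually.of_forall fun r hr => ?_)
        have hr1 : 0 < 1 - r := by linarith [hr.2]
        simp only [hg]
        rw [lintegral_const_mul' _ _ ENNReal.ofReal_ne_top]
        refine (mul_le_mul_right (lintegral_add_abs_rpow_le (by linarith) hm _) _).trans (le_of_eq ?_)
        rw [← ENNReal.ofReal_mul (by positivity), ← ENNReal.ofReal_mul (by positivity)]
        congr 1; ring
    _ = _ := by
        rw [lintegral_const_mul' _ _ ENNReal.ofReal_ne_top]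
        congr 1
        have := (Measure.measurePreserving_sub_left volume (1 : ℝ)).setLIntegral_comp_preimage_emb
          (MeasurableEquiv.subLeft (1 : ℝ)).measurableEmbedding
          (fun x => ENNReal.ofReal (x ^ α * (δ + x) ^ (1 - m))) (Set.Ioo 0 1)
        rw [← this]
        simp

theorem lintegral_kernel_rotation {α m δ : ℝ} {v : ℂ} (hv : ‖v‖ = 1) :
    ∫⁻ z in unitDiscSet, ENNReal.ofReal ((1 - ‖z‖ ^ 2) ^ α *
        ‖1 - ((1 - δ : ℝ) : ℂ) * (v * z)‖ ^ (-m)) =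
      ∫⁻ z in unitDiscSet, ENNReal.ofReal ((1 - ‖z‖ ^ 2) ^ α *
        ‖1 - ((1 - δ : ℝ) : ℂ) * z‖ ^ (-m)) := by
  let R := rotation ⟨v, mem_sphere_zero_iff_norm.mpr hv⟩
  have hRz : ∀ z, R z = v * z := fun z => rfl
  have key := (R.measurePreserving).setLIntegral_comp_preimage_emb
    R.toMeasurableEquiv.measurableEmbedding (fun z => ENNReal.ofReal ((1 - ‖z‖ ^ 2) ^ α *
        ‖1 - ((1 - δ : ℝ) : ℂ) * z‖ ^ (-m))) unitDiscSet
  have hpre : R ⁻¹' unitDiscSet = unitDiscSet := by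
    ext z
    simp only [Set.mem_preimage, Metric.mem_ball, dist_zero_right, hRz, norm_mul, hv, one_mul]
  rw [hpre] at key
  rw [← key]
  simp only [hRz, norm_mul, hv, one_mul]

/-- Split at x = δ. Below, δ + x is replaced by δ and x^α is integrable since α > -1. Above, it is
replaced by x. The value c = 0 is allowed for the logarithmic case. -/
theorem lintegral_radial_le {α c : ℝ} (hα : -1 < α) (hc : 0 ≤ c) {δ : ℝ} (hδ : 0 < δ) :
    ∫⁻ x in Set.Ioo (0 : ℝ) 1, ENNReal.ofReal (x ^ α * (δ + x) ^ (-(1 + α + c))) ≤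
      ENNReal.ofReal (δ ^ (-c) / (α + 1)) +
        ∫⁻ x in Set.Ioo δ 1, ENNReal.ofReal (x ^ (-1 - c)) := by
  have hα1 : 0 < α + 1 := by linarith
  have hsub : Set.Ioo (0 : ℝ) 1 ⊆ Set.Ioc 0 δ ∪ Set.Ioo δ 1 := by
    intro x hx
    rcases le_or_gt x δ with h | h
    · exact Or.inl ⟨hx.1, h⟩
    · exact Or.inr ⟨h, hx.2⟩
  have hint : ∫⁻ x in Set.Ioc 0 δ, ENNReal.ofReal (x ^ α) = ENNReal.ofReal (δ ^ (α + 1) / (α + 1)) := by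
    rw [← ofReal_integral_eq_lintegral_ofReal]
    · rw [← intervalIntegral.integral_of_le hδ.le, integral_rpow (Or.inl hα),
        Real.zero_rpow hα1.ne', sub_zero]
    · exact (intervalIntegrable_iff_integrableOn_Ioc_of_le hδ.le).mp
        (intervalIntegral.intervalIntegrable_rpow' hα)
    · filter_upwards [ae_restrict_mem measurableSet_Ioc] with x hx
      exact Real.rpow_nonneg hx.1.le _
  refine (lintegral_mono_set hsub).trans ((lintegral_union_le _ _ _).trans (add_le_add ?_ ?_))
  · calc _ ≤ ∫⁻ x in Set.Ioc 0 δ, ENNReal.ofReal (δ ^ (-(1 + α + c))) * ENNReal.ofReal (x ^ α) := by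
          refine setLIntegral_mono_ae' measurableSet_Ioc (Eventually.of_forall fun x hx => ?_)
          rw [← ENNReal.ofReal_mul (by positivity), mul_comm]
          refine ENNReal.ofReal_le_ofReal (mul_le_mul_of_nonneg_right ?_ (Real.rpow_nonneg hx.1.le _))
          exact Real.rpow_le_rpow_of_nonpos hδ (by linarith [hx.1]) (by linarith)
      _ = _ := by
          rw [lintegral_const_mul' _ _ ENNReal.ofReal_ne_top, hint, ← ENNReal.ofReal_mul (by positivity),
            mul_div_assoc', ← Real.rpow_add hδ]
          congr 3; ring
  · refine setLIntegral_mono_ae' measurableSet_Ioo (Eventually.of_forall fun x hx => ?_)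
    have hx0 : 0 < x := hδ.trans hx.1
    refine ENNReal.ofReal_le_ofReal ?_
    calc x ^ α * (δ + x) ^ (-(1 + α + c)) ≤ x ^ α * x ^ (-(1 + α + c)) :=
          mul_le_mul_of_nonneg_left (Real.rpow_le_rpow_of_nonpos hx0 (by linarith) (by linarith))
            (by positivity)
      _ = _ := by rw [← Real.rpow_add hx0]; congr 1; ring

theorem exists_lintegral_kernel_le_rpow {α c : ℝ} (hα : -1 < α) (hc : 0 < c) :
    ∃ C : ℝ, 0 < C ∧ ∀ (δ : ℝ) (v : ℂ), 0 < δ → δ ≤ 1 → ‖v‖ = 1 →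
      ∫⁻ z in unitDiscSet, ENNReal.ofReal ((1 - ‖z‖ ^ 2) ^ α *
        ‖1 - ((1 - δ : ℝ) : ℂ) * (v * z)‖ ^ (-(2 + α + c))) ≤ ENNReal.ofReal (C * δ ^ (-c)) := by
  obtain ⟨C, hC, H⟩ := exists_lintegral_kernel_le (α := α) (m := 2 + α + c) (by linarith)
  have hα1 : 0 < α + 1 := by linarith
  refine ⟨C * (1 / (α + 1) + 1 / c), by positivity, fun δ v hδ hδ1 hv => ?_⟩
  rw [lintegral_kernel_rotation hv]
  refine (H δ hδ hδ1).trans ?_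
  rw [mul_assoc, ENNReal.ofReal_mul hC.le, show 1 - (2 + α + c) = -(1 + α + c) by ring]
  refine mul_le_mul_right ((lintegral_radial_le hα hc.le hδ).trans ?_) _
  have hint : ∫⁻ x in Set.Ioi δ, ENNReal.ofReal (x ^ (-1 - c)) = ENNReal.ofReal (δ ^ (-c) / c) := by
    rw [← ofReal_integral_eq_lintegral_ofReal]
    · rw [integral_Ioi_rpow_of_lt (by linarith) hδ, show -1 - c + 1 = -c by ring, neg_div_neg_eq]
    · exact integrableOn_Ioi_rpow_of_lt (by linarith) hδ
    · filter_upwards [ae_restrict_mem measurableSet_Ioi] with x hx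
      have : 0 < x := hδ.trans hx
      positivity
  refine (add_le_add_right ((lintegral_mono_set Set.Ioo_subset_Ioi_self).trans hint.le) _).trans
    (le_of_eq ?_)
  rw [← ENNReal.ofReal_add (by positivity) (by positivity)]
  congr 1; ring

theorem exists_lintegral_kernel_le_log {α : ℝ} (hα : -1 < α) :
    ∃ C : ℝ, 0 < C ∧ ∀ (δ : ℝ) (v : ℂ), 0 < δ → δ ≤ 1 → ‖v‖ = 1 →
      ∫⁻ z in unitDiscSet, ENNReal.ofReal ((1 - ‖z‖ ^ 2) ^ α *
        ‖1 - ((1 - δ : ℝ) : ℂ) * (v * z)‖ ^ (-(2 + α))) ≤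
          ENNReal.ofReal (C * (1 + Real.log (1 / δ))) := by
  obtain ⟨C, hC, H⟩ := exists_lintegral_kernel_le (α := α) (m := 2 + α) (by linarith)
  have hα1 : 0 < α + 1 := by linarith
  refine ⟨C * (1 / (α + 1) + 1), by positivity, fun δ v hδ hδ1 hv => ?_⟩
  rw [lintegral_kernel_rotation hv]
  refine (H δ hδ hδ1).trans ?_
  have hlog : 0 ≤ Real.log (1 / δ) := Real.log_nonneg (by rw [le_div_iff₀ hδ]; linarith)
  rw [mul_assoc, ENNReal.ofReal_mul hC.le, show 1 - (2 + α) = -(1 + α + 0) by ring]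
  refine mul_le_mul_right ((lintegral_radial_le hα le_rfl hδ).trans ?_) _
  have hint : ∫⁻ x in Set.Ioc δ 1, ENNReal.ofReal (x ^ (-1 - 0 : ℝ)) =
      ENNReal.ofReal (Real.log (1 / δ)) := by
    rw [← integral_one_div_of_pos hδ one_pos, intervalIntegral.integral_of_le hδ1,
      ofReal_integral_eq_lintegral_ofReal]
    · refine setLIntegral_congr_fun measurableSet_Ioc fun x _ => ?_
      simp only [sub_zero, Real.rpow_neg_one, one_div]
    · exact (intervalIntegrable_iff_integrableOn_Ioc_of_le hδ1).mp
        (intervalIntegral.intervalIntegrable_one_div (fun x hx => by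
          rw [Set.uIcc_of_le hδ1] at hx
          exact (hδ.trans_le hx.1).ne') continuousOn_id)
    · filter_upwards [ae_restrict_mem measurableSet_Ioc] with x hx
      have : 0 < x := hδ.trans hx.1
      positivity
  refine (add_le_add_right ((lintegral_mono_set Set.Ioo_subset_Ioc_self).trans hint.le) _).trans ?_
  rw [← ENNReal.ofReal_add (by positivity) hlog, neg_zero, Real.rpow_zero]
  refine ENNReal.ofReal_le_ofReal ?_
  have : 0 ≤ 1 / (α + 1) * Real.log (1 / δ) := by positivity
  nlinarith

/-! ### Arcs and the denominators of the test functions. -/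

theorem IsArc.volume_eq {J : Set ℝ} (hJ : IsArc J) :
    volume J = ENNReal.ofReal (2 * Real.pi * arcLength J) := by
  have hπ := Real.pi_pos
  rw [arcLength, mul_div_cancel₀ _ (by positivity), ENNReal.ofReal_toReal]
  exact (hJ.2.2.trans_lt ENNReal.ofReal_lt_top).ne

theorem IsArc.arcLength_pos {J : Set ℝ} (hJ : IsArc J) : 0 < arcLength J := by
  have hπ := Real.pi_pos
  have h := hJ.2.1
  rw [hJ.volume_eq, ENNReal.ofReal_pos] at h
  exact pos_of_mul_pos_right h (by positivity)

theorem IsArc.exists_center {J : Set ℝ} (hJ : IsArc J) :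
    ∃ θ₀, ∀ θ ∈ J, |θ - θ₀| ≤ 2 * Real.pi * arcLength J := by
  obtain ⟨θ₀, hθ₀⟩ := nonempty_of_measure_ne_zero hJ.2.1.ne'
  refine ⟨θ₀, fun θ hθ => ?_⟩
  have h1 : volume (Set.uIcc θ₀ θ) ≤ volume J := measure_mono (hJ.1.uIcc_subset hθ₀ hθ)
  rw [Real.volume_interval, hJ.volume_eq, ENNReal.ofReal_le_ofReal_iff] at h1
  · exact h1
  · have := hJ.arcLength_pos
    positivity

/-- The function `1 - (1 - δ) v z` whose powers and logarithm provide test functions. -/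
noncomputable def szegoDenom (δ : ℝ) (v z : ℂ) : ℂ := 1 - ((1 - δ : ℝ) : ℂ) * (v * z)

section SzegoDenom

variable {δ : ℝ} {v z : ℂ}

theorem norm_mul_szego_le (hδ : 0 < δ) (hδ1 : δ ≤ 1) (hv : ‖v‖ = 1) :
    ‖((1 - δ : ℝ) : ℂ) * (v * z)‖ ≤ ‖z‖ := by
  rw [norm_mul, norm_mul, hv, one_mul, Complex.norm_real, Real.norm_eq_abs,
    abs_of_nonneg (by linarith)]
  exact mul_le_of_le_one_left (norm_nonneg z) (by linarith)

theorem one_sub_norm_le_szegoDenom (hδ : 0 < δ) (hδ1 : δ ≤ 1) (hv : ‖v‖ = 1) :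
    1 - ‖z‖ ≤ ‖szegoDenom δ v z‖ := by
  have h1 := norm_mul_szego_le (z := z) hδ hδ1 hv
  have h2 := norm_sub_norm_le (1 : ℂ) (((1 - δ : ℝ) : ℂ) * (v * z))
  rw [norm_one] at h2
  unfold szegoDenom
  linarith

theorem norm_szegoDenom_le_two (hδ : 0 < δ) (hδ1 : δ ≤ 1) (hv : ‖v‖ = 1) (hz : ‖z‖ < 1) :
    ‖szegoDenom δ v z‖ ≤ 2 := by
  have h1 := norm_mul_szego_le (z := z) hδ hδ1 hv
  have h2 := norm_sub_le (1 : ℂ) (((1 - δ : ℝ) : ℂ) * (v * z))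
  rw [norm_one] at h2
  unfold szegoDenom
  linarith

theorem szegoDenom_mem_slitPlane (hδ : 0 < δ) (hδ1 : δ ≤ 1) (hv : ‖v‖ = 1) (hz : ‖z‖ < 1) :
    szegoDenom δ v z ∈ Complex.slitPlane := by
  have h1 := norm_mul_szego_le (z := z) hδ hδ1 hv
  have h2 := Complex.re_le_norm (((1 - δ : ℝ) : ℂ) * (v * z))
  refine Or.inl ?_
  rw [szegoDenom, Complex.sub_re, Complex.one_re]
  linarith

theorem hasDerivAt_szegoDenom (δ : ℝ) (v z : ℂ) :
    HasDerivAt (szegoDenom δ v) (-(((1 - δ : ℝ) : ℂ) * v)) z := by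
  have := (((hasDerivAt_id z).const_mul v).const_mul ((1 - δ : ℝ) : ℂ)).const_sub 1
  rw [mul_one] at this
  exact this

theorem norm_szegoDenom_deriv_le (hδ : 0 < δ) (hδ1 : δ ≤ 1) (hv : ‖v‖ = 1) :
    ‖-(((1 - δ : ℝ) : ℂ) * v)‖ ≤ 1 := by
  rw [norm_neg, norm_mul, hv, mul_one, Complex.norm_real, Real.norm_eq_abs,
    abs_of_nonneg (by linarith)]
  linarith

/-- On a Carleson square the denominator adapted to it is small. -/
theorem norm_szegoDenom_le_of_mem_carlesonSquare {J : Set ℝ} {θ₀ : ℝ}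
    (hθ₀ : ∀ θ ∈ J, |θ - θ₀| ≤ 2 * Real.pi * arcLength J) (ht0 : 0 < arcLength J)
    (ht1 : arcLength J < 1) {z : DiscPt} (hz : z ∈ carlesonSquare J) :
    ‖szegoDenom (arcLength J) (Complex.exp (-θ₀ * Complex.I)) z‖ ≤ 9 * arcLength J := by
  obtain ⟨r, θ, hθ, hr, hr1, hzr⟩ := hz
  set t := arcLength J
  set x : ℝ := (1 - t) * r with hx
  have hx0 : 0 ≤ x := mul_nonneg (by linarith) (by linarith)
  have e : szegoDenom t (Complex.exp (-θ₀ * Complex.I)) z =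
      ((1 - x : ℝ) : ℂ) - x * (Complex.exp (Complex.I * ((θ - θ₀ : ℝ) : ℂ)) - 1) := by
    rw [szegoDenom, hzr, hx, show Complex.I * ((θ - θ₀ : ℝ) : ℂ) = -θ₀ * Complex.I + θ * Complex.I by
      push_cast; ring, Complex.exp_add]
    push_cast; ring
  rw [e]
  refine (norm_sub_le _ _).trans ?_
  rw [norm_mul, Complex.norm_real, Complex.norm_real, Real.norm_eq_abs, Real.norm_eq_abs,
    abs_of_nonneg hx0, abs_of_nonneg (by nlinarith : 0 ≤ 1 - x)]
  -- The constant 9 is 2 + 7: r ≥ 1 - t gives 1 - x ≤ 2t, and 2π < 7 bounds the angular part.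
  have h1 := (Real.norm_exp_I_mul_ofReal_sub_one_le (x := θ - θ₀)).trans (hθ₀ θ hθ)
  have h2 : 2 * Real.pi * t ≤ 7 * t := by nlinarith [Real.pi_lt_d2]
  have h3 : x ≤ 1 := by nlinarith
  have h4 := mul_le_of_le_one_left (norm_nonneg
    (Complex.exp (Complex.I * ((θ - θ₀ : ℝ) : ℂ)) - 1)) h3
  nlinarith

theorem norm_exp_neg_mul_I (θ₀ : ℝ) : ‖Complex.exp (-θ₀ * Complex.I)‖ = 1 := by
  have := Complex.norm_exp_ofReal_mul_I (-θ₀)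
  rwa [Complex.ofReal_neg] at this

theorem dirichletEnergy_le_of_norm_deriv_rpow_le {p α m A : ℝ} {f : ℂ → ℂ} (hA : 0 ≤ A)
    (h : ∀ z ∈ unitDiscSet, ‖deriv f z‖ ^ p ≤ A * ‖szegoDenom δ v z‖ ^ (-m)) :
    dirichletEnergy p α f ≤ ENNReal.ofReal A *
      ∫⁻ z in unitDiscSet, ENNReal.ofReal ((1 - ‖z‖ ^ 2) ^ α *
        ‖1 - ((1 - δ : ℝ) : ℂ) * (v * z)‖ ^ (-m)) := by
  rw [dirichletEnergy, normalizedArea, Measure.restrict_smul, lintegral_smul_measure, smul_eq_mul]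
  have hπ : ENNReal.ofReal Real.pi⁻¹ ≤ 1 := by
    rw [ENNReal.ofReal_le_one]
    exact inv_le_one_of_one_le₀ (by linarith [Real.pi_gt_three])
  refine (mul_le_of_le_one_left zero_le hπ).trans ?_
  rw [← lintegral_const_mul' _ _ ENNReal.ofReal_ne_top]
  refine setLIntegral_mono_ae' measurableSet_ball (Eventually.of_forall fun z hz => ?_)
  have hz1 : ‖z‖ < 1 := by simpa using hz
  have hw : 0 ≤ (1 - ‖z‖ ^ 2) ^ α := Real.rpow_nonneg (by nlinarith [norm_nonneg z]) _
  rw [dirichletDensity, ← ENNReal.ofReal_mul hA]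
  refine ENNReal.ofReal_le_ofReal ((mul_le_mul_of_nonneg_right (h z hz) hw).trans (le_of_eq ?_))
  rw [szegoDenom]; ring

end SzegoDenom

/-! ### Necessity by test functions. -/

/-- Convergence in L^q(μ) gives almost everywhere convergence along a further subsequence, so the
limit agrees with the pointwise limit 0. -/
theorem IsCompactDirichletEmbedding.exists_lintegral_lt {p α q : ℝ} (hq : 0 < q) {μ : Measure DiscPt}
    (h : IsCompactDirichletEmbedding p α q μ) {F : ℕ → ℂ → ℂ}
    (hF : ∀ n, F n ∈ dirichletSpace p α) {M : ℝ}
    (hM : ∀ n, dirichletNorm p α (F n) ≤ ENNReal.ofReal M)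
    (hlim : ∀ z ∈ unitDiscSet, Tendsto (fun n => F n z) atTop (𝓝 0)) {ε : ℝ≥0∞} (hε : 0 < ε) :
    ∃ n, ∫⁻ z, ‖onDisc (F n) z‖ₑ ^ q ∂μ < ε := by
  have hq0 : ENNReal.ofReal q ≠ 0 := by simpa using hq
  obtain ⟨φ, g, hφ, hg, hconv⟩ := h.2 F hF ⟨M, hM⟩
  obtain ⟨ns, hns, hae⟩ := (tendstoInMeasure_of_tendsto_eLpNorm hq0
    (fun n => aestronglyMeasurable_onDisc (hF (φ n)).1 μ) hg.1 hconv).exists_seq_tendsto_ae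
  have hg0 : g =ᵐ[μ] 0 := by
    filter_upwards [hae] with z hz
    refine tendsto_nhds_unique hz ?_
    exact (hlim z z.2).comp (hφ.tendsto_atTop.comp hns.tendsto_atTop)
  have hconv' : Tendsto (fun n => eLpNorm (onDisc (F (φ n))) (ENNReal.ofReal q) μ) atTop (𝓝 0) := by
    refine hconv.congr fun n => eLpNorm_congr_ae ?_
    filter_upwards [hg0] with z hz
    simp [hz]
  have h3 := (ENNReal.continuous_rpow_const (y := q)).tendsto 0 |>.comp hconv'
  rw [ENNReal.zero_rpow_of_pos hq] at h3
  obtain ⟨n, hn⟩ := (h3.eventually (gt_mem_nhds hε)).exists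
  refine ⟨φ n, ?_⟩
  rwa [Function.comp_apply, eLpNorm_eq_lintegral_rpow_enorm_toReal hq0 ENNReal.ofReal_ne_top,
    ENNReal.toReal_ofReal hq.le, ← ENNReal.rpow_mul, one_div_mul_cancel hq.ne', ENNReal.rpow_one] at hn

/-- Necessity of a little-o Carleson condition from a family of test functions. -/
theorem carlesonLittleO_of_testFunctions {p α q : ℝ} (hp : 0 < p) (hq : 0 < q) {μ : Measure DiscPt}
    (h : IsCompactDirichletEmbedding p α q μ) {ω : ℝ → ℝ} {c A t₀ : ℝ} (hc : 0 < c) (hA : 0 ≤ A)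
    (ht₀ : 0 < t₀) (hω : ∀ t, 0 < t → t < t₀ → 0 < ω t) {κ : ℂ → ℝ → ℝ}
    (hκ : ∀ z ∈ unitDiscSet, Tendsto (κ z) (𝓝[>] 0) (𝓝 0))
    (H : ∀ J, IsArc J → arcLength J < t₀ → ∃ f : ℂ → ℂ, DifferentiableOn ℂ f unitDiscSet ∧
      ‖f 0‖ ≤ 1 ∧ dirichletEnergy p α f ≤ ENNReal.ofReal A ∧
      (∀ z ∈ unitDiscSet, ‖f z‖ ≤ κ z (arcLength J)) ∧
      ∀ z ∈ carlesonSquare J, c ≤ ‖f z‖ ^ q * ω (arcLength J)) :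
    CarlesonLittleO μ ω := by
  by_contra hcon
  unfold CarlesonLittleO at hcon
  push Not at hcon
  obtain ⟨ε, hε, hcon⟩ := hcon
  choose J hJ hJlen hJμ using fun n : ℕ => hcon (min t₀ (1 / (n + 1))) (by positivity)
  choose f hf hf0 hfA hfκ hfc using fun n => H (J n) (hJ n) ((hJlen n).trans_le (min_le_left _ _))
  have hnorm : ∀ n, dirichletNorm p α (f n) ≤ ENNReal.ofReal ((1 + A) ^ (1 / p)) := by
    intro n
    rw [dirichletNorm_le_iff hp, ENNReal.ofReal_rpow_of_nonneg (by positivity) hp.le,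
      ← Real.rpow_mul (by positivity), one_div_mul_cancel hp.ne', Real.rpow_one,
      ENNReal.ofReal_add zero_le_one hA]
    exact add_le_add (ENNReal.ofReal_le_ofReal (Real.rpow_le_one (norm_nonneg _) (hf0 n) hp.le))
      (hfA n)
  have hlen0 : Tendsto (fun n => arcLength (J n)) atTop (𝓝[>] 0) := by
    refine tendsto_nhdsWithin_iff.mpr ⟨?_, Eventually.of_forall fun n => (hJ n).arcLength_pos⟩
    exact squeeze_zero (fun n => (hJ n).arcLength_pos.le)
      (fun n => (hJlen n).le.trans (min_le_right _ _)) tendsto_one_div_add_atTop_nhds_zero_nat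
  obtain ⟨n, hn⟩ := h.exists_lintegral_lt hq
    (fun n => ⟨hf n, (hnorm n).trans_lt ENNReal.ofReal_lt_top⟩) hnorm
    (fun z hz => squeeze_zero_norm (fun n => hfκ n z hz) ((hκ z hz).comp hlen0))
    (show (0 : ℝ≥0∞) < ENNReal.ofReal (c * ε) by simp; positivity)
  set t := arcLength (J n)
  have hωt : 0 < ω t := hω t (hJ n).arcLength_pos ((hJlen n).trans_le (min_le_left _ _))
  refine absurd hn (not_lt.mpr ?_)
  -- Chebyshev's inequality: |f|^q ≥ c/ω on the square, whose measure exceeds εω by the choice of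
  -- the arcs.
  calc ENNReal.ofReal (c * ε) = ENNReal.ofReal (c / ω t) * ENNReal.ofReal (ε * ω t) := by
        rw [← ENNReal.ofReal_mul (by positivity)]
        congr 1; field_simp
    _ ≤ ENNReal.ofReal (c / ω t) * μ {z | ENNReal.ofReal (c / ω t) ≤ ‖onDisc (f n) z‖ₑ ^ q} := by
        refine mul_le_mul_right ((hJμ n).le.trans (measure_mono fun z hz => ?_)) _
        have := hfc n z hz
        rw [Set.mem_ofPred_eq, onDisc, ← ofReal_norm, ENNReal.ofReal_rpow_of_nonneg (norm_nonneg _) hq.le]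
        exact ENNReal.ofReal_le_ofReal (by rwa [div_le_iff₀ hωt])
    _ ≤ _ := mul_meas_ge_le_lintegral₀
        ((aestronglyMeasurable_onDisc (hf n) μ).enorm.pow_const q) _

/-- The test function is t^s (1 - (1-t)vz)^{-N} with s = N - γ. An integer N needs no branch of the
power, and N > γ makes s positive, so the functions vanish pointwise as t → 0. On the square they
are at least 9^{-N} t^{-γ}. -/
theorem isVanishingCarleson_of_isCompact {p q α : ℝ} (hp : 0 < p) (hq : 0 < q) (hα : -1 < α)
    (hpα : p < α + 2) {μ : Measure DiscPt} (h : IsCompactDirichletEmbedding p α q μ) :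
    IsVanishingCarleson (q * (α + 2 - p) / p) μ := by
  set γ : ℝ := (α + 2 - p) / p with hγ
  have hγ0 : 0 < γ := div_pos (by linarith) hp
  set N : ℕ := ⌊γ⌋₊ + 1 with hN
  set s : ℝ := N - γ with hs
  have hs0 : 0 < s := by
    have := Nat.lt_floor_add_one γ
    rw [hs, hN]; push_cast; linarith
  -- For c = sp the kernel exponent 2 + α + c is (N+1)p, that of |f'|^p, and t^{sp} cancels the
  -- growth t^{-sp}.
  obtain ⟨C, hC, hC'⟩ := exists_lintegral_kernel_le_rpow hα (c := s * p) (by positivity)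
  refine carlesonLittleO_of_testFunctions hp hq h (c := (9 ^ N : ℝ)⁻¹ ^ q) (A := (N : ℝ) ^ p * C)
    (t₀ := 1) (κ := fun z t => t ^ s * ((1 - ‖z‖) ^ N)⁻¹) (by positivity) (by positivity) one_pos
    (fun t ht _ => by positivity) (fun z _ => ?_) (fun J hJ hJ1 => ?_)
  · have h1 : Tendsto (fun t : ℝ => t ^ s) (𝓝[>] 0) (𝓝 ((0 : ℝ) ^ s)) :=
      ((Real.continuous_rpow_const hs0.le).tendsto 0).mono_left nhdsWithin_le_nhds
    rw [Real.zero_rpow hs0.ne'] at h1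
    simpa using h1.mul_const (((1 - ‖z‖) ^ N)⁻¹)
  · obtain ⟨θ₀, hθ₀⟩ := hJ.exists_center
    have ht := hJ.arcLength_pos
    set t := arcLength J with htdef
    set v := Complex.exp (-θ₀ * Complex.I)
    have hv : ‖v‖ = 1 := norm_exp_neg_mul_I θ₀
    have hkpos : ∀ z : ℂ, ‖z‖ < 1 → 0 < ‖szegoDenom t v z‖ := fun z hz =>
      (by linarith : 0 < 1 - ‖z‖).trans_le (one_sub_norm_le_szegoDenom ht hJ1.le hv)
    set f : ℂ → ℂ := fun z => ((t ^ s : ℝ) : ℂ) * (szegoDenom t v z) ^ (-(N : ℤ)) with hf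
    have hnorm : ∀ z, ‖f z‖ = t ^ s * (‖szegoDenom t v z‖ ^ N)⁻¹ := by
      intro z
      rw [hf, norm_mul, Complex.norm_real, Real.norm_eq_abs, abs_of_pos (by positivity), norm_zpow,
        zpow_neg, zpow_natCast]
    have hder : ∀ z : ℂ, ‖z‖ < 1 → HasDerivAt f (((t ^ s : ℝ) : ℂ) *
        (((-(N : ℤ) : ℤ) : ℂ) * szegoDenom t v z ^ (-(N : ℤ) - 1) * -(((1 - t : ℝ) : ℂ) * v))) z :=
      fun z hz => ((hasDerivAt_zpow (-(N : ℤ)) (szegoDenom t v z)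
        (Or.inl (norm_pos_iff.mp (hkpos z hz)))).comp z (hasDerivAt_szegoDenom t v z)).const_mul _
    refine ⟨f, fun z hz => (hder z (by simpa using hz)).differentiableAt.differentiableWithinAt,
      ?_, ?_, fun z hz => ?_, fun z hz => ?_⟩
    · rw [hnorm]
      simp [szegoDenom]
      exact Real.rpow_le_one ht.le hJ1.le hs0.le
    · have hE := dirichletEnergy_le_of_norm_deriv_rpow_le (δ := t) (v := v) (p := p) (α := α)
        (m := 2 + α + s * p) (A := t ^ (s * p) * N ^ p) (f := f) (by positivity) (fun z hz => ?_)
      · refine hE.trans ((mul_le_mul_right (hC' t v ht hJ1.le hv) _).trans (le_of_eq ?_))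
        rw [← ENNReal.ofReal_mul (by positivity)]
        congr 1
        rw [Real.rpow_neg ht.le]
        have : 0 < t ^ (s * p) := by positivity
        field_simp
      · have hz1 : ‖z‖ < 1 := by simpa using hz
        have hk := hkpos z hz1
        have h1 : ‖deriv f z‖ ≤ t ^ s * (N * ‖szegoDenom t v z‖ ^ (-(N + 1 : ℝ))) := by
          rw [(hder z hz1).deriv, norm_mul, Complex.norm_real, Real.norm_eq_abs,
            abs_of_pos (by positivity), norm_mul, norm_mul, norm_zpow]
          refine mul_le_mul_of_nonneg_left ?_ (by positivity)
          refine (mul_le_of_le_one_right (by positivity)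
            (norm_szegoDenom_deriv_le ht hJ1.le hv)).trans (le_of_eq ?_)
          have e1 : ‖((-(N : ℤ) : ℤ) : ℂ)‖ = N := by simp
          rw [e1, ← Real.rpow_intCast]
          congr 2; push_cast; ring
        calc ‖deriv f z‖ ^ p ≤ (t ^ s * (N * ‖szegoDenom t v z‖ ^ (-(N + 1 : ℝ)))) ^ p :=
              Real.rpow_le_rpow (norm_nonneg _) h1 hp.le
          _ = _ := by
              rw [Real.mul_rpow (by positivity) (by positivity), Real.mul_rpow (by positivity)
                (by positivity), ← Real.rpow_mul ht.le, ← Real.rpow_mul hk.le, mul_assoc]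
              congr 3
              rw [hs, hγ]; field_simp; ring
    · rw [hnorm]
      have hz1 : ‖z‖ < 1 := by simpa using hz
      have h2 := one_sub_norm_le_szegoDenom (z := z) ht hJ1.le hv
      have h3 : 0 < 1 - ‖z‖ := by linarith
      gcongr
    · rw [hnorm]
      have hk := hkpos z z.norm_lt_one
      have h2 := norm_szegoDenom_le_of_mem_carlesonSquare hθ₀ ht hJ1 hz
      have h3 : t ^ s * ((9 * t) ^ N)⁻¹ ≤ t ^ s * (‖szegoDenom t v z‖ ^ N)⁻¹ := by gcongr
      calc ((9 ^ N : ℝ)⁻¹) ^ q = (t ^ s * ((9 * t) ^ N)⁻¹) ^ q * t ^ (q * (α + 2 - p) / p) := by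
            have e2 : t ^ (q * (α + 2 - p) / p) = (t ^ γ) ^ q := by
              rw [← Real.rpow_mul ht.le]; congr 1; rw [hγ]; ring
            have e3 : t ^ s * t ^ γ = t ^ N := by
              rw [← Real.rpow_add ht, hs, sub_add_cancel, Real.rpow_natCast]
            rw [e2, ← Real.mul_rpow (by positivity) (by positivity)]
            congr 1
            rw [mul_pow, mul_inv, mul_right_comm, e3]
            field_simp
        _ ≤ _ := by gcongr

/-- The test function is L^{-1/p} log(1 - (1-t)vz) with L = log(1/t). At p = 2 + α the integral of
|f'|^p without the normalization is O(1 + L), so the energy stays bounded; on the square the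
logarithm is at least L/2 in modulus. -/
theorem logCarleson_of_isCompact {p q α : ℝ} (hq : 0 < q) (hα : -1 < α) (hpα : p = α + 2)
    {μ : Measure DiscPt} (h : IsCompactDirichletEmbedding p α q μ) :
    CarlesonLittleO μ (fun t => Real.log (1 / t) ^ ((1 / p - 1) * q)) := by
  have hp : 0 < p := by linarith
  obtain ⟨C, hC, hC'⟩ := exists_lintegral_kernel_le_log hα
  -- The threshold 1/81 = 9^{-2} gives log 9 < L/2, hence log(1/(9t)) > L/2. It also gives L > 1, so
  -- 1 + L ≤ 2L, which is the 2 in `A`.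
  have hlog : ∀ t : ℝ, 0 < t → t < 1 / 81 → 2 * Real.log 9 < Real.log (1 / t) := by
    intro t ht ht1
    have : 2 * Real.log 9 = Real.log (9 ^ 2) := by rw [Real.log_pow]; norm_num
    rw [this]
    refine Real.log_lt_log (by norm_num) ?_
    rw [lt_div_iff₀ ht]; linarith
  have hlog9 : 1 < Real.log 9 := by
    rw [Real.lt_log_iff_exp_lt (by norm_num)]
    linarith [Real.exp_one_lt_d9]
  refine carlesonLittleO_of_testFunctions hp hq h (c := (1 / 2) ^ q) (A := 2 * C)
    (t₀ := 1 / 81) (κ := fun z t => Real.log (1 / t) ^ (-(1 / p)) *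
      (Real.log 2 + Real.log (1 / (1 - ‖z‖)) + Real.pi)) (by positivity) (by positivity) (by norm_num)
    (fun t ht ht1 => ?_) (fun z _ => ?_) (fun J hJ hJ1 => ?_)
  · have := hlog t ht ht1
    have : 0 < Real.log (1 / t) := by linarith
    positivity
  · have h1 : Tendsto (fun t : ℝ => Real.log (1 / t)) (𝓝[>] 0) atTop := by
      simp only [one_div]
      exact Real.tendsto_log_atTop.comp tendsto_inv_nhdsGT_zero
    have h2 := (tendsto_rpow_neg_atTop (y := 1 / p) (by positivity)).comp h1
    simpa using h2.mul_const (Real.log 2 + Real.log (1 / (1 - ‖z‖)) + Real.pi)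
  · obtain ⟨θ₀, hθ₀⟩ := hJ.exists_center
    have ht := hJ.arcLength_pos
    set t := arcLength J with htdef
    have ht1 : t < 1 := by linarith
    set v := Complex.exp (-θ₀ * Complex.I)
    have hv : ‖v‖ = 1 := norm_exp_neg_mul_I θ₀
    set L := Real.log (1 / t) with hL
    have hL2 := hlog t ht hJ1
    have hL1 : 1 < L := by linarith
    have hL0 : 0 < L := by linarith
    have hkpos : ∀ z : ℂ, ‖z‖ < 1 → 0 < ‖szegoDenom t v z‖ := fun z hz =>
      (by linarith : 0 < 1 - ‖z‖).trans_le (one_sub_norm_le_szegoDenom ht ht1.le hv)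
    set f : ℂ → ℂ := fun z => ((L ^ (-(1 / p)) : ℝ) : ℂ) * Complex.log (szegoDenom t v z) with hf
    have hnorm : ∀ z, ‖f z‖ = L ^ (-(1 / p)) * ‖Complex.log (szegoDenom t v z)‖ := by
      intro z
      rw [hf, norm_mul, Complex.norm_real, Real.norm_eq_abs, abs_of_pos (by positivity)]
    have hder : ∀ z : ℂ, ‖z‖ < 1 → HasDerivAt f (((L ^ (-(1 / p)) : ℝ) : ℂ) *
        (-(((1 - t : ℝ) : ℂ) * v) / szegoDenom t v z)) z :=
      fun z hz => ((hasDerivAt_szegoDenom t v z).clog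
        (szegoDenom_mem_slitPlane ht ht1.le hv hz)).const_mul _
    refine ⟨f, fun z hz => (hder z (by simpa using hz)).differentiableAt.differentiableWithinAt,
      ?_, ?_, fun z hz => ?_, fun z hz => ?_⟩
    · rw [hnorm]
      simp [szegoDenom]
    · have hE := dirichletEnergy_le_of_norm_deriv_rpow_le (δ := t) (v := v) (p := p) (α := α)
        (m := 2 + α) (A := L⁻¹) (f := f) (by positivity) (fun z hz => ?_)
      · refine hE.trans ((mul_le_mul_right (hC' t v ht ht1.le hv) _).trans ?_)
        rw [← ENNReal.ofReal_mul (by positivity)]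
        refine ENNReal.ofReal_le_ofReal ?_
        rw [inv_mul_le_iff₀ hL0]
        nlinarith
      · have hz1 : ‖z‖ < 1 := by simpa using hz
        have hk := hkpos z hz1
        have h1 : ‖deriv f z‖ ≤ L ^ (-(1 / p)) * ‖szegoDenom t v z‖⁻¹ := by
          rw [(hder z hz1).deriv, norm_mul, Complex.norm_real, Real.norm_eq_abs,
            abs_of_pos (by positivity), norm_div, div_eq_mul_inv]
          refine mul_le_mul_of_nonneg_left ?_ (by positivity)
          exact mul_le_of_le_one_left (by positivity) (norm_szegoDenom_deriv_le ht ht1.le hv)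
        calc ‖deriv f z‖ ^ p ≤ (L ^ (-(1 / p)) * ‖szegoDenom t v z‖⁻¹) ^ p :=
              Real.rpow_le_rpow (norm_nonneg _) h1 hp.le
          _ = _ := by
              rw [Real.mul_rpow (by positivity) (by positivity), ← Real.rpow_mul hL0.le,
                Real.inv_rpow hk.le, ← Real.rpow_neg hk.le, neg_mul, one_div_mul_cancel hp.ne',
                Real.rpow_neg_one, hpα, add_comm α]
    · rw [hnorm]
      have hz1 : ‖z‖ < 1 := by simpa using hz
      have h3 : 0 < 1 - ‖z‖ := by linarith
      refine mul_le_mul_of_nonneg_left ?_ (by positivity)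
      refine (Complex.norm_le_abs_re_add_abs_im _).trans (add_le_add ?_ ?_)
      · rw [Complex.log_re, one_div, Real.log_inv]
        have h4 := Real.log_le_log h3 (one_sub_norm_le_szegoDenom (z := z) ht ht1.le hv)
        have h5 := Real.log_le_log (hkpos z hz1) (norm_szegoDenom_le_two ht ht1.le hv hz1)
        have h6 : Real.log (1 - ‖z‖) ≤ 0 := Real.log_nonpos h3.le (by linarith [norm_nonneg z])
        have h7 : 0 ≤ Real.log 2 := Real.log_nonneg (by norm_num)
        rw [abs_le]; constructor <;> linarith
      · rw [Complex.log_im]; exact Complex.abs_arg_le_pi _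
    · rw [hnorm]
      have hk := hkpos z z.norm_lt_one
      have h2 := norm_szegoDenom_le_of_mem_carlesonSquare hθ₀ ht ht1 hz
      have h3 : L / 2 ≤ ‖Complex.log (szegoDenom t v z)‖ := by
        have h4 := Complex.abs_re_le_norm (Complex.log (szegoDenom t v z))
        rw [Complex.log_re] at h4
        have h5 := Real.log_le_log hk h2
        rw [Real.log_mul (by norm_num) ht.ne'] at h5
        have h6 : L = -Real.log t := by rw [hL, one_div, Real.log_inv]
        have h7 := neg_le_abs (Real.log ‖szegoDenom t v z‖)
        linarith
      calc (1 / 2 : ℝ) ^ q = (L ^ (-(1 / p)) * (L / 2)) ^ q * L ^ ((1 / p - 1) * q) := by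
            rw [Real.rpow_mul hL0.le, ← Real.mul_rpow (by positivity) (by positivity)]
            congr 1
            have : L ^ (-(1 / p)) * (L / 2) * L ^ (1 / p - 1) =
                (L ^ (-(1 / p)) * L ^ (1 / p - 1) * L ^ (1 : ℝ)) / 2 := by rw [Real.rpow_one]; ring
            rw [this, ← Real.rpow_add hL0, ← Real.rpow_add hL0,
              show -(1 / p) + (1 / p - 1) + 1 = 0 by ring, Real.rpow_zero]
        _ ≤ _ := by gcongr

/-- The constant 1 has zero Dirichlet integral, and its membership in L^q(μ) says that the total
mass is finite. -/
theorem isFiniteMeasure_of_isCompact {p q α : ℝ} (hp : 0 < p) (hq : 0 < q) {μ : Measure DiscPt}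
    (h : IsCompactDirichletEmbedding p α q μ) : IsFiniteMeasure μ := by
  have h1 := h.1 (fun _ => 1) ⟨differentiableOn_const _, by
    rw [dirichletNorm_lt_top_iff hp]
    simp [dirichletEnergy, dirichletDensity, Real.zero_rpow hp.ne']⟩
  rw [memLp_onDisc_iff (differentiableOn_const _) hq] at h1
  exact ⟨by simpa [onDisc] using h1⟩

/-! ### The theorem. -/

theorem mainTheorem7 (p q α : ℝ) (hp : 0 < p) (hpq : p < q) (hα : -1 < α)
    (μ : Measure DiscPt) :
    (p < α + 2 → IsLocallyFiniteMeasure μ →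
      (IsCompactDirichletEmbedding p α q μ ↔ IsVanishingCarleson (q * (α + 2 - p) / p) μ)) ∧
    (p = α + 2 → IsLocallyFiniteMeasure μ →
      (IsCompactDirichletEmbedding p α q μ ↔
        CarlesonLittleO μ (fun t => Real.log (1 / t) ^ ((1 / p - 1) * q)))) ∧
    (α + 2 < p →
      (IsCompactDirichletEmbedding p α q μ ↔ IsFiniteMeasure μ)) := by
  have hq : 0 < q := hp.trans hpq
  refine ⟨fun hpα _ => ⟨isVanishingCarleson_of_isCompact hp hq hα hpα, fun h => ?_⟩,
    fun hpα _ => ⟨logCarleson_of_isCompact hq hα hpα, fun h => ?_⟩,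
    fun hpα => ⟨isFiniteMeasure_of_isCompact hp hq, fun _ => ?_⟩⟩
  · have := CarlesonLittleO.isFiniteMeasure h
    exact isCompactDirichletEmbedding_of_tailEstimate hp hα hq
      (tailEstimate_of_vanishingCarleson hp hpq hpα h)
  · have := CarlesonLittleO.isFiniteMeasure h
    exact isCompactDirichletEmbedding_of_tailEstimate hp hα hq
      (tailEstimate_of_logCarleson hpq hα hpα h)
  · exact isCompactDirichletEmbedding_of_tailEstimate hp hα hq
      (tailEstimate_of_isFiniteMeasure hp hq hpα)
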